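/- Let $k$ be a field, and let $P$ be a poset in which every closed interval $[x,y]=\{z: x\le z\le y\}$ is finite. Let $\mathrm{Int}(P)$ be the set of closed intervals $[x,y]$ with $x\le y$, and let $\sim$ be an equivalence relation on $\mathrm{Int}(P)$, with classes denoted $\widetilde{[x,y]}$, satisfying the following four axioms. 1. (Order-compatibility) If $[x,y]\sim[x',y']$ and $[y,z]\sim[y',z']$, then $[x,z]\sim[x',z']$. 2. (Invariance) If $[x,y]\sim[x',y']$, then there is a unique map $\tau:[x,y]\to[x',y']$ such that $[x,z]\sim[x',\tau(z)]$ and $[z,y]\sim[\tau(z),y']$ for all $z\in[x,y]$. 3. (Finiteness) The equivalence relation on $P$ defined by $x\sim y$ if $[x,x]\sim[y,y]$ has only finitely many classes. 4. (Concatenation) If $x\le y_1$ and $y_2\le z$ with $[y_1,y_1]\sim[y_2,y_2]$, then there are $x'\le y'\le z'$ in $P$ with $[x',y']\sim[x,y_1]$ and $[y',z']\sim[y_2,z]$. The reduced incidence algebra $A=k[P]_{\mathrm{red}}$ is the $k$-vector space with basis $\{\xi_\alpha\}$ indexed by $\alpha\in\mathrm{Int}(P)/\!\sim$, with the bilinear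 multiplication in which $\xi_\alpha\xi_\beta=\xi_{\widetilde{[x,z]}}$ if there are $x\le y\le z$ in $P$ with $\widetilde{[x,y]}=\alpha$ and $\widetilde{[y,z]}=\beta$, and $\xi_\alpha\xi_\beta=0$ otherwise. Then $A=A_0\oplus I$, where the semisimple subring $A_0$ is the $k$-span of the $\xi_{\widetilde{[x,x]}}$ and the two-sided ideal $I$ is the $k$-span of the $\xi_{\widetilde{[x,y]}}$ with $x<y$. A $\mathbb Z$-graded right module $M$ over an $\mathbb N$-graded ring $R=\bigoplus_{d\ge0}R_d$ with $R_0$ semisimple is called Koszul if it has a graded projective resolution $\cdots\to P^{(1)}\to P^{(0)}\to M\to0$ in which each $P^{(i)}$ is generated in degree $i$. A right $A$-module $M$ is called nongraded Koszul (with respect to $A=A_0\oplus I$) if $\mathrm{gr}_I M=\bigoplus_{d\ge0}MI^d/MI^{d+1}$ is a Koszul right module over $\mathrm{gr}_I A=\bigoplus_{d\ge0}I^d/I^{d+1}$ (where $I^0=A$). Let $J\subseteq I$ be a monomial right ideal of $A$, that is, a right ideal of $A$ contained in $I$ and generated by a (possibly infinite) set of basis elements $\xi_\alpha$. Write $\alpha\in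 J$ if $\xi_\alpha\in J$. For $x\le y$ in $P$ let $(x,y)|_J=\{z\in P: x<z<y,\ \widetilde{[x,z]}\in J\}$, a subposet of $P$. For a simplicial complex $\Delta$ (with $\varnothing$ allowed as a face, of dimension $-1$) let $\Delta^{\langle j\rangle}$ be the subcomplex generated by all faces of dimension at least $j$. The complex $\Delta$ is sequentially acyclic over $k$ if $\tilde H_i(\Delta^{\langle j\rangle};k)=0$ whenever $-1\le i<j\le\dim\Delta$. A poset is sequentially acyclic over $k$ if its order complex, whose faces are the finite chains, is. **Theorem.** $J$ is a nongraded Koszul right $k[P]_{\mathrm{red}}$-module if and only if, for every class $\widetilde{[x,y]}$ in $J$, the poset $(x,y)|_J$ is sequentially acyclic over $k$. -/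

import Mathlib

universe u v w

noncomputable section

/-! ## Ordered simplicial complexes, reduced homology, sequential acyclicity -/

/-- An abstract simplicial complex whose vertices lie in a partially ordered set, in such a way
that every face is a chain (so that every face comes with an ordering of its vertices).
The empty set is allowed as a face (of dimension `-1`): the void complex, without any face, and the
complex `{∅}` are different objects. -/
structure OrdComplex (V : Type u) [PartialOrder V] where
  /-- the faces -/
  faces : Set (Finset V)
  down_closed : ∀ F ∈ faces, ∀ G : Finset V, G ⊆ F → G ∈ faces
  isChain : ∀ F ∈ faces, IsChain (· ≤ ·) (F : Set V)

/-- The quotient `Z / (Z ∩ W)` of submodules of a module; it is `Z / W` when `W ≤ Z`. -/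
abbrev Subquotient {k : Type u} {M : Type v} [Ring k] [AddCommGroup M] [Module k M]
    (Z W : Submodule k M) : Type v :=
  Z ⧸ W.submoduleOf Z

namespace OrdComplex

variable {V : Type u} [PartialOrder V]

/-- The dimension of a finite set of vertices, as an integer: `dim ∅ = -1`. -/
def faceDim (F : Finset V) : ℤ := (F.card : ℤ) - 1

/-- The sequential layer `Δ^⟨j⟩`: the subcomplex generated by all faces of dimension at least
`j`. It is the void complex when there is no such face. -/
def layer (Δ : OrdComplex V) (j : ℤ) : OrdComplex V where
  faces := {F | ∃ G ∈ Δ.faces, F ⊆ G ∧ j ≤ faceDim G}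
  down_closed := fun _ ⟨G, hG, hFG, hj⟩ _ h => ⟨G, hG, h.trans hFG, hj⟩
  isChain := fun _ ⟨G, hG, hFG, _⟩ => (Δ.isChain G hG).mono (Finset.coe_subset.2 hFG)

open Classical in
/-- The simplicial boundary operator. For a face `F = {v₀ < ⋯ < vₙ}` it is
`∂ F = ∑ᵢ (-1)^i (F \ {vᵢ})`, the exponent `i` being the number of vertices of `F` below `vᵢ`. -/
def boundary (k : Type v) [Field k] (V : Type u) [PartialOrder V] :
    (Finset V →₀ k) →ₗ[k] (Finset V →₀ k) :=
  Finsupp.linearCombination k fun F =>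
    ∑ w ∈ F, Finsupp.single (F.erase w) ((-1 : k) ^ (F.filter (· < w)).card)

/-- The (augmented) simplicial chains in degree `i`: the vector space with basis the
`i`-dimensional faces. In degree `-1` the empty face contributes. -/
def chains (k : Type v) [Field k] (Δ : OrdComplex V) (i : ℤ) : Submodule k (Finset V →₀ k) :=
  Finsupp.supported k k {F | F ∈ Δ.faces ∧ faceDim F = i}

/-- The reduced cycles in degree `i`. -/
def cycles (k : Type v) [Field k] (Δ : OrdComplex V) (i : ℤ) : Submodule k (Finset V →₀ k) :=
  chains k Δ i ⊓ LinearMap.ker (boundary k V)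

/-- The reduced boundaries in degree `i`. -/
def boundaries (k : Type v) [Field k] (Δ : OrdComplex V) (i : ℤ) : Submodule k (Finset V →₀ k) :=
  (chains k Δ (i + 1)).map (boundary k V)

/-- Reduced simplicial homology `H̃ᵢ(Δ; k)`: cycles modulo boundaries. -/
abbrev ReducedHomology (k : Type v) [Field k] (Δ : OrdComplex V) (i : ℤ) : Type (max u v) :=
  Subquotient (cycles k Δ i) (boundaries k Δ i)

/-- `Δ` is sequentially acyclic over `k`: `H̃ᵢ(Δ^⟨j⟩; k) = 0` for `-1 ≤ i < j ≤ dim Δ`. The bound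
`j ≤ dim Δ` says that some face has dimension at least `j`. -/
def IsSequentiallyAcyclic (k : Type v) [Field k] (Δ : OrdComplex V) : Prop :=
  ∀ i j : ℤ, -1 ≤ i → i < j → (∃ F ∈ Δ.faces, j ≤ faceDim F) →
    Subsingleton (ReducedHomology k (Δ.layer j) i)

/-- The order complex of a subposet `S`: its faces are the finite chains contained in `S`. -/
def orderComplex (S : Set V) : OrdComplex V where
  faces := {F | (F : Set V) ⊆ S ∧ IsChain (· ≤ ·) (F : Set V)}
  down_closed := fun _ ⟨hS, hc⟩ _ h =>
    ⟨(Finset.coe_subset.2 h).trans hS, hc.mono (Finset.coe_subset.2 h)⟩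
  isChain := fun _ h => h.2

end OrdComplex

/-! ## Graded modules over graded rings and the Koszul property -/

section Koszul

open scoped DirectSum

variable (R : ℕ → Type u) [∀ d, AddCommGroup (R d)] [DirectSum.GRing R]

/-- `ℳ` is a `ℤ`-grading of the module `M` over the `ℕ`-graded ring `⨁ d, R d`. -/
structure IsGradedModule {M : Type v} [AddCommGroup M] [Module (⨁ d, R d) M]
    (ℳ : ℤ → AddSubgroup M) : Prop where
  isInternal : DirectSum.IsInternal ℳ
  smul_mem : ∀ (d : ℕ) (r : R d) (n : ℤ) (m : M), m ∈ ℳ n →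
    DirectSum.of R d r • m ∈ ℳ ((d : ℤ) + n)

/-- A graded projective resolution `⋯ → P₂ → P₁ → P₀ → M → 0` of the graded module `(M, ℳ)` in
which each `Pᵢ` is generated in degree `i`. -/
structure LinearResolution {M : Type v} [AddCommGroup M] [Module (⨁ d, R d) M]
    (ℳ : ℤ → AddSubgroup M) where
  /-- the modules of the resolution -/
  P : ℕ → Type (max u v)
  [addCommGroup : ∀ i, AddCommGroup (P i)]
  [module : ∀ i, Module (⨁ d, R d) (P i)]
  /-- their gradings -/
  grading : ∀ i, ℤ → AddSubgroup (P i)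
  isGraded : ∀ i, IsGradedModule R (grading i)
  projective : ∀ i, Module.Projective (⨁ d, R d) (P i)
  generated : ∀ i : ℕ, Submodule.span (⨁ d, R d) (grading i (i : ℤ) : Set (P i)) = ⊤
  /-- the differentials -/
  diff : ∀ i, P (i + 1) →ₗ[⨁ d, R d] P i
  /-- the augmentation -/
  aug : P 0 →ₗ[⨁ d, R d] M
  diff_mem : ∀ i n x, x ∈ grading (i + 1) n → diff i x ∈ grading i n
  aug_mem : ∀ n x, x ∈ grading 0 n → aug x ∈ ℳ n
  aug_surjective : Function.Surjective aug
  exact_aug : Function.Exact (diff 0) aug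
  exact_diff : ∀ i, Function.Exact (diff (i + 1)) (diff i)

/-- Koszulness in the graded sense: the degree zero part `R 0` of the graded ring is semisimple,
`M` is a `ℤ`-graded module over it, and `M` has a graded projective resolution whose `i`-th module
is generated in degree `i`, for all `i`. -/
structure IsGradedKoszul {M : Type v} [AddCommGroup M] [Module (⨁ d, R d) M]
    (ℳ : ℤ → AddSubgroup M) : Prop where
  semisimple : IsSemisimpleRing (R 0)
  isGraded : IsGradedModule R ℳ
  resolution : Nonempty (LinearResolution R ℳ)

end Koszul

/-! ## Associated graded rings and modules -/

section AssocGraded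

open scoped DirectSum

variable {B : Type u} [Ring B] (I : Ideal B)

/-- The `I`-adic filtration `Iᵈ M` of a module. For `M = B` it is `Iᵈ B = Iᵈ`. -/
def adicFiltration (M : Type v) [AddCommGroup M] [Module B M] (d : ℕ) : Submodule B M :=
  I ^ d • (⊤ : Submodule B M)

/-- The graded piece `Iᵈ M / Iᵈ⁺¹ M`. -/
def GrPiece (M : Type v) [AddCommGroup M] [Module B M] (d : ℕ) : Type v :=
  adicFiltration I M d ⧸ (adicFiltration I M (d + 1)).submoduleOf (adicFiltration I M d)

instance (M : Type v) [AddCommGroup M] [Module B M] (d : ℕ) : AddCommGroup (GrPiece I M d) :=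
  inferInstanceAs (AddCommGroup
    (adicFiltration I M d ⧸ (adicFiltration I M (d + 1)).submoduleOf (adicFiltration I M d)))

/-- The class in `Iᵈ M / Iᵈ⁺¹ M` of an element of `Iᵈ M`. -/
def grMk {M : Type v} [AddCommGroup M] [Module B M] (d : ℕ) :
    adicFiltration I M d →+ GrPiece I M d :=
  (Submodule.mkQ
    ((adicFiltration I M (d + 1)).submoduleOf (adicFiltration I M d))).toAddMonoidHom

theorem grMk_surjective {M : Type v} [AddCommGroup M] [Module B M] (d : ℕ) :
    Function.Surjective (grMk I (M := M) d) :=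
  Submodule.mkQ_surjective _

theorem grMk_eq_zero {M : Type v} [AddCommGroup M] [Module B M] {d : ℕ}
    (a : adicFiltration I M d) :
    grMk I d a = 0 ↔ (a : M) ∈ adicFiltration I M (d + 1) :=
  (Submodule.Quotient.mk_eq_zero _).trans Submodule.mem_comap

theorem grMk_sigma_ext {M : Type v} [AddCommGroup M] [Module B M] {d e : ℕ} (h : d = e)
    (a : adicFiltration I M d) (b : adicFiltration I M e) (hab : (a : M) = b) :
    (⟨d, grMk I d a⟩ : GradedMonoid (GrPiece I M)) = ⟨e, grMk I e b⟩ := by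
  subst h
  rw [Subtype.ext hab]

variable [I.IsTwoSided]

theorem smul_mem_adicFiltration {M : Type v} [AddCommGroup M] [Module B M] {i j : ℕ} {a : B}
    (ha : a ∈ adicFiltration I B i) {m : M} (hm : m ∈ adicFiltration I M j) :
    a • m ∈ adicFiltration I M (i + j) := by
  have ha' : a ∈ I ^ i := (Ideal.mul_le_left : I ^ i * ⊤ ≤ I ^ i) ha
  unfold adicFiltration
  rw [Ideal.IsTwoSided.pow_add, Submodule.mul_smul]
  exact Submodule.smul_mem_smul ha' hm

theorem smul_sub_smul_mem {M : Type v} [AddCommGroup M] [Module B M] {i j : ℕ} {a a' : B}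
    {m m' : M} (ha' : a' ∈ adicFiltration I B i) (hm : m ∈ adicFiltration I M j)
    (ha : a - a' ∈ adicFiltration I B (i + 1)) (hmm : m - m' ∈ adicFiltration I M (j + 1)) :
    a • m - a' • m' ∈ adicFiltration I M (i + j + 1) := by
  have h : a • m - a' • m' = (a - a') • m + a' • (m - m') := by
    rw [sub_smul, smul_sub]; abel
  rw [h]
  refine Submodule.add_mem _ ?_ ?_
  · rw [add_right_comm]
    exact smul_mem_adicFiltration I ha hm
  · rw [add_assoc]
    exact smul_mem_adicFiltration I ha' hmm

/-- The action `(Iⁱ/Iⁱ⁺¹) × (Iʲ M/Iʲ⁺¹ M) → Iⁱ⁺ʲ M/Iⁱ⁺ʲ⁺¹ M`, `([a], [m]) ↦ [a m]`. -/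
def grSMul {M : Type v} [AddCommGroup M] [Module B M] {i j : ℕ} :
    GrPiece I B i → GrPiece I M j → GrPiece I M (i + j) :=
  Quotient.map₂ (fun a m => ⟨(a : B) • (m : M), smul_mem_adicFiltration I a.2 m.2⟩)
    fun _ a' ha m _ hm => by
      have h1 := (Submodule.quotientRel_def _).1 ha
      have h2 := (Submodule.quotientRel_def _).1 hm
      exact (Submodule.quotientRel_def _).2 (smul_sub_smul_mem I a'.2 m.2 h1 h2)

theorem grSMul_mk {M : Type v} [AddCommGroup M] [Module B M] {i j : ℕ}
    (a : adicFiltration I B i) (m : adicFiltration I M j) :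
    grSMul I (grMk I i a) (grMk I j m) =
      grMk I (i + j) ⟨(a : B) • (m : M), smul_mem_adicFiltration I a.2 m.2⟩ :=
  rfl

/-- The class of `1` in `B/I`. -/
def grOne : GrPiece I B 0 :=
  grMk I 0 ⟨1, by simp [adicFiltration, Submodule.pow_zero]⟩

section laws

variable {M : Type v} [AddCommGroup M] [Module B M] {i j : ℕ}

theorem grSMul_add (a : GrPiece I B i) (m n : GrPiece I M j) :
    grSMul I a (m + n) = grSMul I a m + grSMul I a n := by
  obtain ⟨a, rfl⟩ := grMk_surjective I i a
  obtain ⟨m, rfl⟩ := grMk_surjective I j m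
  obtain ⟨n, rfl⟩ := grMk_surjective I j n
  rw [← map_add, grSMul_mk, grSMul_mk, grSMul_mk, ← map_add]
  exact congrArg _ (Subtype.ext (smul_add _ _ _))

theorem add_grSMul (a b : GrPiece I B i) (m : GrPiece I M j) :
    grSMul I (a + b) m = grSMul I a m + grSMul I b m := by
  obtain ⟨a, rfl⟩ := grMk_surjective I i a
  obtain ⟨b, rfl⟩ := grMk_surjective I i b
  obtain ⟨m, rfl⟩ := grMk_surjective I j m
  rw [← map_add, grSMul_mk, grSMul_mk, grSMul_mk, ← map_add]
  exact congrArg _ (Subtype.ext (add_smul _ _ _))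

theorem grSMul_zero (a : GrPiece I B i) : grSMul I a (0 : GrPiece I M j) = 0 := by
  have h := grSMul_add I a (0 : GrPiece I M j) 0
  rwa [add_zero, left_eq_add] at h

theorem zero_grSMul (m : GrPiece I M j) : grSMul I (0 : GrPiece I B i) m = 0 := by
  have h := add_grSMul I (0 : GrPiece I B i) 0 m
  rwa [add_zero, left_eq_add] at h

theorem grOne_grSMul (m : GradedMonoid (GrPiece I M)) :
    (⟨0 + m.1, grSMul I (grOne I) m.2⟩ : GradedMonoid (GrPiece I M)) = m := by
  obtain ⟨j, m⟩ := m
  obtain ⟨m, rfl⟩ := grMk_surjective I j m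
  exact grMk_sigma_ext I (zero_add j) _ _ (one_smul B (m : M))

theorem grSMul_grSMul (a b : GradedMonoid (GrPiece I B)) (m : GradedMonoid (GrPiece I M)) :
    (⟨a.1 + b.1 + m.1, grSMul I (grSMul I a.2 b.2) m.2⟩ : GradedMonoid (GrPiece I M)) =
      ⟨a.1 + (b.1 + m.1), grSMul I a.2 (grSMul I b.2 m.2)⟩ := by
  obtain ⟨i, a⟩ := a
  obtain ⟨j, b⟩ := b
  obtain ⟨l, m⟩ := m
  obtain ⟨a, rfl⟩ := grMk_surjective I i a
  obtain ⟨b, rfl⟩ := grMk_surjective I j b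
  obtain ⟨m, rfl⟩ := grMk_surjective I l m
  exact grMk_sigma_ext I (add_assoc i j l) _ _ (mul_smul (a : B) (b : B) (m : M))

theorem grSMul_grOne (a : GradedMonoid (GrPiece I B)) :
    (⟨a.1 + 0, grSMul I a.2 (grOne I)⟩ : GradedMonoid (GrPiece I B)) = a := by
  obtain ⟨i, a⟩ := a
  obtain ⟨a, rfl⟩ := grMk_surjective I i a
  exact grMk_sigma_ext I (add_zero i) _ _ (mul_one (a : B))

end laws

instance : GradedMonoid.GMul (GrPiece I B) := ⟨grSMul I⟩

instance : GradedMonoid.GOne (GrPiece I B) := ⟨grOne I⟩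

/-- The multiplication `[a] [b] = [a b]` of the associated graded ring
`gr_I B = ⨁ d, Iᵈ B/Iᵈ⁺¹ B`. -/
instance grRing : DirectSum.GRing (GrPiece I B) where
  mul_zero := grSMul_zero I
  zero_mul := zero_grSMul I
  mul_add := grSMul_add I
  add_mul := add_grSMul I
  one_mul := grOne_grSMul I
  mul_one := grSMul_grOne I
  mul_assoc := grSMul_grSMul I
  natCast n := n • grOne I
  natCast_zero := zero_nsmul _
  natCast_succ n := succ_nsmul _ n
  intCast n := n • grOne I
  intCast_ofNat n := natCast_zsmul _ n
  intCast_negSucc_ofNat n := negSucc_zsmul _ n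

/-- The action `[a] [m] = [a m]` of `gr_I B` on `gr_I M = ⨁ d, Iᵈ M/Iᵈ⁺¹ M`. -/
instance grModule (M : Type v) [AddCommGroup M] [Module B M] :
    DirectSum.Gmodule (GrPiece I B) (GrPiece I M) where
  smul := grSMul I
  one_smul := grOne_grSMul I
  mul_smul := grSMul_grSMul I
  smul_add := grSMul_add I
  smul_zero := grSMul_zero I
  add_smul := add_grSMul I
  zero_smul := zero_grSMul I

/-- The grading of `gr_I M = ⨁ d, Iᵈ M/Iᵈ⁺¹ M`, seen as a `ℤ`-grading that vanishes in negative
degrees. -/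
def grGrading (M : Type v) [AddCommGroup M] [Module B M] :
    ℤ → AddSubgroup (⨁ d, GrPiece I M d)
  | Int.ofNat d => (DirectSum.of (GrPiece I M) d).range
  | Int.negSucc _ => ⊥

end AssocGraded

/-! ## Nongraded Koszulness -/

section NongradedKoszul

variable {A : Type u} [Ring A]

/-- A two-sided ideal `I` of `A`, seen as a left ideal of the opposite ring, is two-sided. -/
instance asIdealOpposite_isTwoSided (I : TwoSidedIdeal A) :
    (TwoSidedIdeal.asIdealOpposite I).IsTwoSided where
  mul_mem_of_left b h := by
    rw [TwoSidedIdeal.mem_asIdealOpposite] at *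
    exact I.mul_mem_left _ _ h

/-- Let `A = A₀ ⊕ I` with `A₀` a semisimple subring and `I` a two-sided ideal. A right `A`-module
`M` is (nongraded) Koszul if `gr_I M = ⨁ d, M Iᵈ / M Iᵈ⁺¹` is a Koszul right module, in the graded
sense, over `gr_I A = ⨁ d, Iᵈ / Iᵈ⁺¹`.

Right modules over `A` are left modules over the opposite ring `Aᵐᵒᵖ`. Under this identification
`M Iᵈ` is `(Iᵒᵖ)ᵈ M`, and the opposite ring of `gr_I A` is the associated graded ring of `Aᵐᵒᵖ` for
the ideal `Iᵒᵖ`, which is `I` seen as an ideal of `Aᵐᵒᵖ`. -/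
structure IsNongradedKoszul (A₀ : Subring A) (I : TwoSidedIdeal A) (M : Type v) [AddCommGroup M]
    [Module Aᵐᵒᵖ M] : Prop where
  isCompl : IsCompl A₀.toAddSubgroup I.asIdeal.toAddSubgroup
  semisimple : IsSemisimpleRing A₀
  koszul : IsGradedKoszul (GrPiece (TwoSidedIdeal.asIdealOpposite I) Aᵐᵒᵖ)
    (grGrading (TwoSidedIdeal.asIdealOpposite I) M)

end NongradedKoszul

/-! ## Reduced incidence algebras -/

section ReducedIncidence

variable {P : Type u} [PartialOrder P]

/-- The closed interval `[x, y]`, for `x ≤ y`, as an element of `Int(P)`. -/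
abbrev ivl {x y : P} (h : x ≤ y) : NonemptyInterval P := ⟨(x, y), h⟩

/-- The four axioms on an equivalence relation `∼` on the intervals of a poset. -/
class IntervalAxioms (s : Setoid (NonemptyInterval P)) : Prop where
  /-- Order-compatibility: if `[x,y] ∼ [x',y']` and `[y,z] ∼ [y',z']`, then `[x,z] ∼ [x',z']`. -/
  order_compatible : ∀ {x y z x' y' z' : P} (hxy : x ≤ y) (hyz : y ≤ z) (hxy' : x' ≤ y')
    (hyz' : y' ≤ z'), s (ivl hxy) (ivl hxy') → s (ivl hyz) (ivl hyz') →
    s (ivl (hxy.trans hyz)) (ivl (hxy'.trans hyz'))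
  /-- Invariance: if `[x,y] ∼ [x',y']`, there is a unique map `τ : [x,y] → [x',y']` such that
  `[x,z] ∼ [x',τ z]` and `[z,y] ∼ [τ z,y']` for all `z` in `[x,y]`. -/
  invariance : ∀ {x y x' y' : P} (h : x ≤ y) (h' : x' ≤ y'), s (ivl h) (ivl h') →
    ∃! τ : Set.Icc x y → Set.Icc x' y', ∀ z : Set.Icc x y,
      s (ivl z.2.1) (ivl (τ z).2.1) ∧ s (ivl z.2.2) (ivl (τ z).2.2)
  /-- Finiteness: the relation `x ∼ y :⇔ [x,x] ∼ [y,y]` on `P` has finitely many classes. -/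
  finiteness : Finite (Quotient (s.comap fun x : P => ivl (le_refl x)))
  /-- Concatenation: if `x ≤ y₁` and `y₂ ≤ z` with `y₁ ∼ y₂`, there are `x' ≤ y' ≤ z'` with
  `[x',y'] ∼ [x,y₁]` and `[y',z'] ∼ [y₂,z]`. -/
  concatenation : ∀ {x y₁ y₂ z : P} (h₁ : x ≤ y₁) (h₂ : y₂ ≤ z),
    s (ivl (le_refl y₁)) (ivl (le_refl y₂)) →
    ∃ (x' y' z' : P) (h₁' : x' ≤ y') (h₂' : y' ≤ z'),
      s (ivl h₁') (ivl h₁) ∧ s (ivl h₂') (ivl h₂)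

variable (k : Type v) [Field k] (s : Setoid (NonemptyInterval P))

/-- The underlying vector space of the reduced incidence algebra `k[P]_red`: its basis is the set
`Int(P)/∼` of equivalence classes of intervals. -/
def RedIncAlg : Type (max u v) := Quotient s →₀ k

instance : AddCommGroup (RedIncAlg k s) := inferInstanceAs (AddCommGroup (Quotient s →₀ k))

instance : Module k (RedIncAlg k s) := inferInstanceAs (Module k (Quotient s →₀ k))

variable {s}

/-- The equivalence class of the interval `[x, y]`. -/
def cls (s : Setoid (NonemptyInterval P)) {x y : P} (h : x ≤ y) : Quotient s :=
  Quotient.mk s (ivl h)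

namespace RedIncAlg

/-- The basis element (monomial) `ξ_α`. -/
def xi (α : Quotient s) : RedIncAlg k s := Finsupp.single α (1 : k)

open Classical in
/-- The product of two monomials: `ξ_α ξ_β = ξ_[x,z]` if there are `x ≤ y ≤ z` with `[x,y]` in the
class `α` and `[y,z]` in the class `β`, and `ξ_α ξ_β = 0` otherwise. (The class of `[x,z]` does not
depend on the choice of `x ≤ y ≤ z`, by order-compatibility.) -/
def xiMul (α β : Quotient s) : RedIncAlg k s :=
  if h : ∃ γ : Quotient s, ∃ (x y z : P) (hxy : x ≤ y) (hyz : y ≤ z),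
      cls s hxy = α ∧ cls s hyz = β ∧ cls s (hxy.trans hyz) = γ
  then xi k h.choose else 0

/-- The bilinear extension of `xiMul`. -/
def mulHom : RedIncAlg k s →ₗ[k] RedIncAlg k s →ₗ[k] RedIncAlg k s :=
  Finsupp.linearCombination k fun α => Finsupp.linearCombination k fun β => xiMul k α β

instance : Mul (RedIncAlg k s) := ⟨fun a b => mulHom k a b⟩

variable {k}

theorem mul_def (a b : RedIncAlg k s) : a * b = mulHom k a b := rfl

theorem xi_mul_xi (α β : Quotient s) : xi k α * xi k β = xiMul k α β := by
  rw [mul_def, mulHom, xi, xi]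
  erw [Finsupp.linearCombination_single, one_smul, Finsupp.linearCombination_single, one_smul]

theorem mem_span_xi (a : RedIncAlg k s) :
    a ∈ Submodule.span k (Set.range (xi k (s := s))) := by
  have h := Finsupp.mem_span_range_iff_exists_finsupp (R := k) (v := xi k (s := s)) (x := a)
  refine h.2 ⟨a, ?_⟩
  simp only [xi]
  exact (Finsupp.sum_congr fun α _ => Finsupp.smul_single_one α _).trans (Finsupp.sum_single a)

theorem hom_ext {M : Type w} [AddCommMonoid M] [Module k M] {f g : RedIncAlg k s →ₗ[k] M}
    (h : ∀ α, f (xi k α) = g (xi k α)) : f = g :=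
  Finsupp.lhom_ext' fun α => LinearMap.ext_ring (h α)

theorem xiMul_eq_zero {α β : Quotient s} (h : ¬ ∃ (x y z : P) (hxy : x ≤ y) (hyz : y ≤ z),
    cls s hxy = α ∧ cls s hyz = β) : xiMul k α β = 0 := by
  rw [xiMul, dif_neg]
  rintro ⟨_, x, y, z, hxy, hyz, h₁, h₂, -⟩
  exact h ⟨x, y, z, hxy, hyz, h₁, h₂⟩

variable [IntervalAxioms s]

theorem eq_of_cls_eq_refl {x y z : P} (h : x ≤ y) (e : cls s h = cls s (le_refl z)) : x = y := by
  have e' : s (ivl h) (ivl (le_refl z)) := Quotient.exact e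
  obtain ⟨τ, hτ, -⟩ := IntervalAxioms.invariance h (le_refl z) e'
  obtain ⟨τ', hτ', -⟩ := IntervalAxioms.invariance (le_refl z) h (s.symm e')
  obtain ⟨σ, -, hσ⟩ := IntervalAxioms.invariance h h (s.refl _)
  have h1 : (fun w => w) = σ := hσ _ fun w => ⟨s.refl _, s.refl _⟩
  have h2 : (fun w => τ' (τ w)) = σ := hσ _ fun w =>
    ⟨s.trans (hτ w).1 (hτ' (τ w)).1, s.trans (hτ w).2 (hτ' (τ w)).2⟩
  have h3 : ∀ w, τ' (τ w) = w := fun w => congrFun (h2.trans h1.symm) w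
  have h4 : τ ⟨x, le_rfl, h⟩ = τ ⟨y, h, le_rfl⟩ := Subsingleton.elim _ _
  have h5 := congrArg τ' h4
  rw [h3, h3] at h5
  exact congrArg Subtype.val h5

theorem cls_left_eq {x y x' y' : P} (h : x ≤ y) (h' : x' ≤ y') (e : cls s h = cls s h') :
    cls s (le_refl x) = cls s (le_refl x') := by
  obtain ⟨τ, hτ, -⟩ := IntervalAxioms.invariance h h' (Quotient.exact e)
  have h1 := Quotient.sound (hτ ⟨x, le_rfl, h⟩).1
  have h2 : x' = (τ ⟨x, le_rfl, h⟩ : P) := eq_of_cls_eq_refl _ h1.symm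
  exact h1.trans (by unfold cls; congr 2; exact h2.symm)

theorem cls_right_eq {x y x' y' : P} (h : x ≤ y) (h' : x' ≤ y') (e : cls s h = cls s h') :
    cls s (le_refl y) = cls s (le_refl y') := by
  obtain ⟨τ, hτ, -⟩ := IntervalAxioms.invariance h h' (Quotient.exact e)
  have h1 := Quotient.sound (hτ ⟨y, h, le_rfl⟩).2
  have h2 : (τ ⟨y, h, le_rfl⟩ : P) = y' := eq_of_cls_eq_refl _ h1.symm
  exact h1.trans (by unfold cls; congr 2)

theorem xiMul_eq {α β : Quotient s} {x y z : P} (hxy : x ≤ y) (hyz : y ≤ z)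
    (h₁ : cls s hxy = α) (h₂ : cls s hyz = β) :
    xiMul k α β = xi k (cls s (hxy.trans hyz)) := by
  have h : ∃ γ : Quotient s, ∃ (x y z : P) (hxy : x ≤ y) (hyz : y ≤ z),
      cls s hxy = α ∧ cls s hyz = β ∧ cls s (hxy.trans hyz) = γ :=
    ⟨_, x, y, z, hxy, hyz, h₁, h₂, rfl⟩
  rw [xiMul, dif_pos h]
  obtain ⟨x', y', z', hxy', hyz', h₁', h₂', h₃'⟩ := h.choose_spec
  rw [← h₃']
  exact congrArg _ (Quotient.sound (IntervalAxioms.order_compatible _ _ _ _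
    (Quotient.exact (h₁'.trans h₁.symm)) (Quotient.exact (h₂'.trans h₂.symm))))

/-- In an interval equivalent to `[x, z]`, a point `y` of `[x, z]` has a counterpart. -/
theorem exists_transport {x y z x' z' : P} (hxy : x ≤ y) (hyz : y ≤ z) (h' : x' ≤ z')
    (e : cls s (hxy.trans hyz) = cls s h') : ∃ (y' : P) (h₁ : x' ≤ y') (h₂ : y' ≤ z'),
    cls s h₁ = cls s hxy ∧ cls s h₂ = cls s hyz := by
  obtain ⟨τ, hτ, -⟩ := IntervalAxioms.invariance (hxy.trans hyz) h' (Quotient.exact e)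
  exact ⟨τ ⟨y, hxy, hyz⟩, (τ ⟨y, hxy, hyz⟩).2.1, (τ ⟨y, hxy, hyz⟩).2.2,
    (Quotient.sound (hτ ⟨y, hxy, hyz⟩).1).symm, (Quotient.sound (hτ ⟨y, hxy, hyz⟩).2).symm⟩

theorem xi_mul_assoc (α β γ : Quotient s) :
    xi k α * xi k β * xi k γ = xi k α * (xi k β * xi k γ) := by
  -- both sides are `ξ_[x,w]` if there is a chain `x ≤ y ≤ z ≤ w` with consecutive classes
  -- `α, β, γ`, and both are zero otherwise
  by_cases h : ∃ (x y z w : P) (hxy : x ≤ y) (hyz : y ≤ z) (hzw : z ≤ w),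
      cls s hxy = α ∧ cls s hyz = β ∧ cls s hzw = γ
  · obtain ⟨x, y, z, w, hxy, hyz, hzw, h₁, h₂, h₃⟩ := h
    rw [xi_mul_xi, xi_mul_xi, xiMul_eq hxy hyz h₁ h₂, xiMul_eq hyz hzw h₂ h₃, xi_mul_xi,
      xi_mul_xi, xiMul_eq (hxy.trans hyz) hzw rfl h₃, xiMul_eq hxy (hyz.trans hzw) h₁ rfl]
  · have hl : xi k α * xi k β * xi k γ = 0 := by
      rw [xi_mul_xi]
      by_cases h1 : ∃ (x y z : P) (hxy : x ≤ y) (hyz : y ≤ z), cls s hxy = α ∧ cls s hyz = β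
      · obtain ⟨x, y, z, hxy, hyz, h₁, h₂⟩ := h1
        rw [xiMul_eq hxy hyz h₁ h₂, xi_mul_xi, xiMul_eq_zero]
        rintro ⟨x', z', w', hxz', hzw', h₃, h₄⟩
        obtain ⟨y', h₅, h₆, h₇, h₈⟩ := exists_transport hxy hyz hxz' h₃.symm
        exact h ⟨x', y', z', w', h₅, h₆, hzw', h₇.trans h₁, h₈.trans h₂, h₄⟩
      · rw [xiMul_eq_zero h1, mul_def, map_zero, LinearMap.zero_apply]
    have hr : xi k α * (xi k β * xi k γ) = 0 := by
      rw [xi_mul_xi]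
      by_cases h1 : ∃ (x y z : P) (hxy : x ≤ y) (hyz : y ≤ z), cls s hxy = β ∧ cls s hyz = γ
      · obtain ⟨y, z, w, hyz, hzw, h₂, h₃⟩ := h1
        rw [xiMul_eq hyz hzw h₂ h₃, xi_mul_xi, xiMul_eq_zero]
        rintro ⟨x', y', w', hxy', hyw', h₁, h₄⟩
        obtain ⟨z', h₅, h₆, h₇, h₈⟩ := exists_transport hyz hzw hyw' h₄.symm
        exact h ⟨x', y', z', w', hxy', h₅, h₆, h₁, h₇.trans h₂, h₈.trans h₃⟩
      · rw [xiMul_eq_zero h1, mul_def, map_zero]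
    rw [hl, hr]

theorem mul_assoc' (a b c : RedIncAlg k s) : a * b * c = a * (b * c) := by
  simp only [mul_def]
  induction mem_span_xi a using Submodule.span_induction with
  | zero => simp
  | add a a' _ _ h h' => simp only [map_add, LinearMap.add_apply, h, h']
  | smul t a _ h => simp only [map_smul, LinearMap.smul_apply, h]
  | mem a ha =>
    obtain ⟨α, rfl⟩ := ha
    induction mem_span_xi b using Submodule.span_induction with
    | zero => simp
    | add b b' _ _ h h' => simp only [map_add, LinearMap.add_apply, h, h']
    | smul t b _ h => simp only [map_smul, LinearMap.smul_apply, h]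
    | mem b hb =>
      obtain ⟨β, rfl⟩ := hb
      induction mem_span_xi c using Submodule.span_induction with
      | zero => simp
      | add c c' _ _ h h' => simp only [map_add, h, h']
      | smul t c _ h => simp only [map_smul, h]
      | mem c hc =>
        obtain ⟨γ, rfl⟩ := hc
        exact xi_mul_assoc α β γ

theorem finite_range_refl (s : Setoid (NonemptyInterval P)) [IntervalAxioms s] :
    (Set.range fun x : P => cls s (le_refl x)).Finite := by
  have := IntervalAxioms.finiteness (s := s)
  refine (Set.finite_range (Quotient.lift (s := s.comap fun x : P => ivl (le_refl x))
    (fun x : P => cls s (le_refl x)) fun _ _ h => Quotient.sound h)).subset ?_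
  rintro _ ⟨x, rfl⟩
  exact ⟨Quotient.mk _ x, rfl⟩

/-- The unit element of `k[P]_red` is the sum of the `ξ_α` over the finitely many classes `α` of
one-point intervals `[x, x]`. -/
instance : One (RedIncAlg k s) := ⟨∑ α ∈ (finite_range_refl s).toFinset, xi k α⟩

theorem one_def : (1 : RedIncAlg k s) = ∑ α ∈ (finite_range_refl s).toFinset, xi k α := rfl

theorem one_mul' (a : RedIncAlg k s) : 1 * a = a := by
  suffices h : mulHom k 1 = LinearMap.id from congrArg (fun f => f a) h
  refine hom_ext fun β => ?_
  obtain ⟨⟨⟨x, y⟩, hxy⟩, rfl⟩ := Quotient.exists_rep β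
  change x ≤ y at hxy
  change mulHom k 1 (xi k (cls s hxy)) = xi k (cls s hxy)
  rw [one_def, map_sum, LinearMap.sum_apply, Finset.sum_eq_single (cls s (le_refl x))]
  · exact (xi_mul_xi _ _).trans (xiMul_eq (le_refl x) hxy rfl rfl)
  · intro α hα hne
    rw [Set.Finite.mem_toFinset] at hα
    obtain ⟨u, rfl⟩ := hα
    refine (xi_mul_xi _ _).trans (xiMul_eq_zero ?_)
    rintro ⟨x', y', z', h₁, h₂, h₃, h₄⟩
    obtain rfl := eq_of_cls_eq_refl h₁ h₃
    exact hne (h₃.symm.trans (cls_left_eq _ _ h₄))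
  · intro h
    exact absurd ((Set.Finite.mem_toFinset (finite_range_refl s)).2 (Set.mem_range_self x)) h

theorem mul_one' (a : RedIncAlg k s) : a * 1 = a := by
  suffices h : (mulHom k).flip 1 = LinearMap.id from congrArg (fun f => f a) h
  refine hom_ext fun β => ?_
  obtain ⟨⟨⟨x, y⟩, hxy⟩, rfl⟩ := Quotient.exists_rep β
  change x ≤ y at hxy
  change mulHom k (xi k (cls s hxy)) 1 = xi k (cls s hxy)
  rw [one_def, map_sum, Finset.sum_eq_single (cls s (le_refl y))]
  · exact (xi_mul_xi _ _).trans (xiMul_eq hxy (le_refl y) rfl rfl)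
  · intro α hα hne
    rw [Set.Finite.mem_toFinset] at hα
    obtain ⟨u, rfl⟩ := hα
    refine (xi_mul_xi _ _).trans (xiMul_eq_zero ?_)
    rintro ⟨x', y', z', h₁, h₂, h₃, h₄⟩
    obtain rfl := eq_of_cls_eq_refl h₂ h₄
    exact hne (h₄.symm.trans (cls_right_eq _ _ h₃))
  · intro h
    exact absurd ((Set.Finite.mem_toFinset (finite_range_refl s)).2 (Set.mem_range_self y)) h

/-- The ring structure of the reduced incidence algebra. -/
instance : Ring (RedIncAlg k s) :=
  { (inferInstance : AddCommGroup (RedIncAlg k s)) with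
    mul := (· * ·)
    one := 1
    left_distrib := fun a b c => map_add (mulHom k a) b c
    right_distrib := fun a b c => by
      rw [mul_def, map_add, LinearMap.add_apply, ← mul_def, ← mul_def]
    zero_mul := fun a => by rw [mul_def, map_zero, LinearMap.zero_apply]
    mul_zero := fun a => map_zero (mulHom k a)
    mul_assoc := mul_assoc'
    one_mul := one_mul'
    mul_one := mul_one'
    zsmul := fun n a => n • a
    zsmul_zero' := fun a => zero_zsmul a
    zsmul_succ' := fun n a => SubNegMonoid.zsmul_succ' n a
    zsmul_neg' := fun n a => SubNegMonoid.zsmul_neg' n a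
    neg_add_cancel := fun a => neg_add_cancel a }

instance : Algebra k (RedIncAlg k s) :=
  Algebra.ofModule
    (fun t a b => by rw [mul_def, map_smul, LinearMap.smul_apply, ← mul_def])
    (fun t a b => map_smul (mulHom k a) t b)

variable (k s)

/-- The subring `A₀`: the `k`-span of the `ξ_[x,x]`. -/
def degreeZero : Subring (RedIncAlg k s) where
  carrier := Submodule.span k {a | ∃ x : P, a = xi k (cls s (le_refl x))}
  zero_mem' := Submodule.zero_mem _
  add_mem' := Submodule.add_mem _
  neg_mem' := Submodule.neg_mem _
  one_mem' := by
    refine Submodule.sum_mem _ fun α hα => Submodule.subset_span ?_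
    obtain ⟨x, rfl⟩ := (Set.Finite.mem_toFinset _).1 hα
    exact ⟨x, rfl⟩
  mul_mem' := by
    intro a b ha hb
    refine LinearMap.BilinMap.apply_apply_mem_of_mem_span _ _ _ (mulHom k) ?_ a b ha hb
    rintro _ ⟨x, rfl⟩ _ ⟨y, rfl⟩
    rw [← mul_def, xi_mul_xi]
    by_cases h : ∃ (x' y' z' : P) (h₁ : x' ≤ y') (h₂ : y' ≤ z'),
        cls s h₁ = cls s (le_refl x) ∧ cls s h₂ = cls s (le_refl y)
    · obtain ⟨x', y', z', h₁, h₂, h₃, h₄⟩ := h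
      rw [xiMul_eq h₁ h₂ h₃ h₄]
      obtain rfl := eq_of_cls_eq_refl h₁ h₃
      obtain rfl := eq_of_cls_eq_refl h₂ h₄
      exact Submodule.subset_span ⟨x', rfl⟩
    · rw [xiMul_eq_zero h]
      exact Submodule.zero_mem _

/-- The `k`-span of the `ξ_[x,y]` with `x < y`. -/
def positiveSpan : Submodule k (RedIncAlg k s) :=
  Submodule.span k {a | ∃ (x y : P) (h : x < y), a = xi k (cls s h.le)}

variable {k s} in
theorem xi_mem_positiveSpan {x y : P} (h : x < y) : xi k (cls s h.le) ∈ positiveSpan k s :=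
  Submodule.subset_span ⟨x, y, h, rfl⟩

/-- The two-sided ideal `I`: the `k`-span of the `ξ_[x,y]` with `x < y`. -/
def positiveIdeal : TwoSidedIdeal (RedIncAlg k s) :=
  TwoSidedIdeal.mk'
    (positiveSpan k s : Set (RedIncAlg k s))
    (Submodule.zero_mem _) (Submodule.add_mem _) (Submodule.neg_mem _)
    (by
      intro a b hb
      refine LinearMap.BilinMap.apply_apply_mem_of_mem_span (positiveSpan k s) _ _ (mulHom k) ?_ a b
        (mem_span_xi a) hb
      rintro _ ⟨α, rfl⟩ _ ⟨x, y, hlt, rfl⟩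
      rw [← mul_def, xi_mul_xi]
      by_cases h : ∃ (x' y' z' : P) (h₁ : x' ≤ y') (h₂ : y' ≤ z'),
          cls s h₁ = α ∧ cls s h₂ = cls s hlt.le
      · obtain ⟨x', y', z', h₁, h₂, h₃, h₄⟩ := h
        rw [xiMul_eq h₁ h₂ h₃ h₄]
        refine xi_mem_positiveSpan (h₁.trans_lt (lt_of_le_of_ne h₂ ?_))
        rintro rfl
        exact hlt.ne (eq_of_cls_eq_refl hlt.le h₄.symm)
      · rw [xiMul_eq_zero h]
        exact Submodule.zero_mem _)
    (by
      intro a b ha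
      refine LinearMap.BilinMap.apply_apply_mem_of_mem_span (positiveSpan k s) _ _ (mulHom k) ?_ a b
        ha (mem_span_xi b)
      rintro _ ⟨x, y, hlt, rfl⟩ _ ⟨β, rfl⟩
      rw [← mul_def, xi_mul_xi]
      by_cases h : ∃ (x' y' z' : P) (h₁ : x' ≤ y') (h₂ : y' ≤ z'),
          cls s h₁ = cls s hlt.le ∧ cls s h₂ = β
      · obtain ⟨x', y', z', h₁, h₂, h₃, h₄⟩ := h
        rw [xiMul_eq h₁ h₂ h₃ h₄]
        refine xi_mem_positiveSpan ((lt_of_le_of_ne h₁ ?_).trans_le h₂)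
        rintro rfl
        exact hlt.ne (eq_of_cls_eq_refl hlt.le h₃.symm)
      · rw [xiMul_eq_zero h]
        exact Submodule.zero_mem _)

variable {k s}

/-- A monomial right ideal: a right ideal of `k[P]_red` (that is, a submodule over the opposite
ring) which is contained in `I` and generated, as a right ideal, by a set of monomials `ξ_α`. -/
structure IsMonomialRightIdeal
    (J : Submodule (RedIncAlg k s)ᵐᵒᵖ (RedIncAlg k s)) : Prop where
  le_positive : ∀ a ∈ J, a ∈ positiveIdeal k s
  generated : ∃ S : Set (Quotient s), J = Submodule.span (RedIncAlg k s)ᵐᵒᵖ (xi k '' S)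

/-- The subposet `(x,y)|_J` of `P`: those `z` with `x < z < y` such that `ξ_[x,z]` lies in `J`. -/
def restrictedInterval (J : Submodule (RedIncAlg k s)ᵐᵒᵖ (RedIncAlg k s)) (x y : P) : Set P :=
  {z | ∃ h : x < z, z < y ∧ xi k (cls s h.le) ∈ J}

end RedIncAlg

end ReducedIncidence

end

/-! Koszulness is first turned into a vanishing statement for Tor. A graded module over `gr_I A`
that vanishes in negative degrees has a resolution with i-th term generated in degree i exactly when
its i-th Tor group against the degree-zero part sits in internal degree i for all i
(`MonomialAlgebra.nonempty_linearResolution_iff`). One direction is dimension shifting along the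
resolution. The other covers the module by a projective generated in the lowest degree and iterates
on the kernel. Tor is computed by the normalized bar complex, with elements n ⊗ [β₁|…|βᵢ], each βₘ a
monomial of positive degree.

Both `gr_I A` and `gr_I J` have bases of interval classes. The product of two classes is their
composite if the ranks in the `I`-adic filtrations add up, and zero otherwise. So the bar complex
has a basis of composable lists (α; β₁, …, βᵢ) with α in `J`. Its differential preserves the total
composite, and the complex splits over the classes of intervals [x,y] in `J`. By the invariance
axiom a list with composite [x,y] is the list of gaps of a unique chain x < z₁ < … < zᵢ < y with
[x,z₁] in `J`. Since `J` is a right ideal, all [x,zₘ] then lie in `J`. The lists with composite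
[x,y] are therefore the faces of the order complex Δ of (x,y)|_J, and the homological degree i is
the number of vertices. Concatenation guarantees that every composable list has a composite.

The internal degree also has a simplicial meaning. The rank of [x,z] in `J` is the largest size of a
chain in (x,z)|_J, and the degree of [a,b] is the largest number of steps from a to b. Hence the
internal degree of a face is the largest size of a face of Δ containing it (`PathModule.wt_spec`).
Multiplying neighbouring letters deletes a vertex, and the product survives in the graded algebra
exactly when this largest size does not grow. So the strand of internal degree j is, up to a shift,
the relative chain complex of the pair of layers Δ^⟨j-1⟩ and Δ^⟨j⟩ (`PathModule.D_codeVec`,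
`PathModule.label_exact_iff`).

Off the diagonal nothing lives in degrees j < i, because letters have positive degree. For i < j the
condition is the vanishing of the relative homology of consecutive layers. The exact sequences of
the pairs, with a descending induction on j, make this equivalent to sequential acyclicity
(`OrdComplex.isSequentiallyAcyclic_iff_relExact`). -/

noncomputable section

set_option linter.unusedSectionVars false

/-! ## The bar complex of a graded module over a monomial algebra -/

/-- A `k`-algebra `S` with a `k`-basis `b α`, indexed by the morphisms `α` of a category with finitely
many objects and graded by `deg`, such that `b β * b α` is either the basis element of a composite
`mul α β` or zero, and such that the morphisms of degree zero are the identities. -/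
structure MonomialAlgebra (k : Type*) (S : Type*) (Q O : Type*) [Field k] [Ring S] [Algebra k S]
    [Fintype O] where
  /-- the basis -/
  b : Module.Basis Q k S
  /-- source of a morphism -/
  src : Q → O
  /-- target of a morphism -/
  tgt : Q → O
  /-- degree of a morphism -/
  deg : Q → ℕ
  /-- identity morphisms -/
  idn : O → Q
  /-- the partial product -/
  mul : Q → Q → Option Q
  b_mul_b : ∀ α β, b β * b α = (mul α β).elim 0 b
  src_mul : ∀ {α β γ}, mul α β = some γ → src γ = src α
  tgt_mul : ∀ {α β γ}, mul α β = some γ → tgt γ = tgt β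
  deg_mul : ∀ {α β γ}, mul α β = some γ → deg γ = deg α + deg β
  comp_mul : ∀ {α β γ}, mul α β = some γ → tgt α = src β
  src_idn : ∀ o, src (idn o) = o
  tgt_idn : ∀ o, tgt (idn o) = o
  deg_idn : ∀ o, deg (idn o) = 0
  eq_idn : ∀ α, deg α = 0 → α = idn (src α)
  idn_mul : ∀ α, mul (idn (src α)) α = some α
  mul_idn : ∀ α, mul α (idn (tgt α)) = some α
  sum_idn : ∑ o, b (idn o) = 1

namespace MonomialAlgebra

variable {k S Q O : Type*} [Field k] [Ring S] [Algebra k S] [Fintype O]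
  (A : MonomialAlgebra k S Q O)

/-- A `ℤ`-grading of an `S`-module, given by the projections to the homogeneous components. -/
structure Grading (N : Type*) [AddCommGroup N] [Module S N] where
  /-- the projection to the component of a given degree -/
  p : ℤ → N →+ N
  p_same : ∀ n x, p n (p n x) = p n x
  p_ne : ∀ m n x, m ≠ n → p m (p n x) = 0
  exists_sum : ∀ x, ∃ s : Finset ℤ, ∑ n ∈ s, p n x = x
  p_b_smul : ∀ α n x, p (A.deg α + n) (A.b α • x) = A.b α • p n x
  p_algebraMap_smul : ∀ (t : k) n x, p n (algebraMap k S t • x) = algebraMap k S t • p n x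

/-- Associativity descends from the ring: basis elements are distinct and nonzero, so an element
that is zero or a basis element determines the underlying option. -/
theorem mul_assoc' (α β γ : Q) :
    (A.mul α β).bind (fun δ => A.mul δ γ) = (A.mul β γ).bind (fun δ => A.mul α δ) := by
  have h := mul_assoc (A.b γ) (A.b β) (A.b α)
  have key : ∀ o o' : Option Q, o.elim 0 A.b = o'.elim 0 A.b → o = o' := by
    rintro (_ | a) (_ | a') h
    · rfl
    · exact absurd h.symm (A.b.ne_zero a')
    · exact absurd h (A.b.ne_zero a)
    · exact congrArg some (A.b.injective h)
  apply key
  have h1 : ((A.mul α β).bind (fun δ => A.mul δ γ)).elim 0 A.b = A.b γ * (A.b β * A.b α) := by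
    rw [A.b_mul_b α β]
    cases A.mul α β with
    | none => simp
    | some δ => simp [A.b_mul_b]
  have h2 : ((A.mul β γ).bind (fun δ => A.mul α δ)).elim 0 A.b = A.b γ * A.b β * A.b α := by
    rw [A.b_mul_b β γ]
    cases A.mul β γ with
    | none => simp
    | some δ => simp [A.b_mul_b]
  rw [h1, h2, h]

section Bar

/-- Prepending a letter to lists. -/
def consHom (N : Type*) [AddCommGroup N] (β : Q) : (List Q →₀ N) →+ (List Q →₀ N) :=
  Finsupp.mapDomain.addMonoidHom (List.cons β)

/-- Multiplying the head of a list by a letter, on lists. -/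
def mergeList (N : Type*) [AddCommGroup N] (β : Q) : List Q → N →+ (List Q →₀ N)
  | [] => 0
  | β' :: c => (A.mul β β').elim 0 fun γ => Finsupp.singleAddHom (γ :: c)

/-- Multiplying the head of lists by a letter. -/
def mergeHom (N : Type*) [AddCommGroup N] (β : Q) : (List Q →₀ N) →+ (List Q →₀ N) :=
  Finsupp.liftAddHom (A.mergeList N β)

/-- The part of the bar differential that merges consecutive letters, on lists. -/
def delList (N : Type*) [AddCommGroup N] : List Q → N →+ (List Q →₀ N)
  | [] => 0
  | β :: c => (A.mergeHom N β).comp (Finsupp.singleAddHom c) - (consHom N β).comp (delList N c)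

/-- The part of the bar differential that merges consecutive letters. -/
def delHom (N : Type*) [AddCommGroup N] : (List Q →₀ N) →+ (List Q →₀ N) :=
  Finsupp.liftAddHom (A.delList N)

variable {N : Type*} [AddCommGroup N]

@[simp] theorem consHom_single (β : Q) (c : List Q) (n : N) :
    consHom N β (Finsupp.single c n) = Finsupp.single (β :: c) n := by
  simp [consHom]

theorem hom_ext_cons {X : Type*} [AddCommGroup X] {f g : (List Q →₀ N) →+ X}
    (h0 : ∀ n, f (Finsupp.single [] n) = g (Finsupp.single [] n))
    (h1 : ∀ β u, f (consHom N β u) = g (consHom N β u)) : f = g := by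
  refine Finsupp.addHom_ext fun c n => ?_
  cases c with
  | nil => exact h0 n
  | cons β c => simpa using h1 β (Finsupp.single c n)

@[simp] theorem mergeHom_single_nil (β : Q) (n : N) :
    A.mergeHom N β (Finsupp.single [] n) = 0 := by simp [mergeHom, mergeList]

@[simp] theorem mergeHom_single_cons (β β' : Q) (c : List Q) (n : N) :
    A.mergeHom N β (Finsupp.single (β' :: c) n) =
      (A.mul β β').elim 0 fun γ => Finsupp.single (γ :: c) n := by
  simp only [mergeHom, mergeList, Finsupp.liftAddHom_apply_single]
  cases A.mul β β' <;> simp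

theorem mergeHom_consHom (β β' : Q) (u : List Q →₀ N) :
    A.mergeHom N β (consHom N β' u) = (A.mul β β').elim 0 fun γ => consHom N γ u := by
  induction u using Finsupp.induction_linear with
  | zero => simp; cases A.mul β β' <;> simp
  | add f g hf hg => simp only [map_add, hf, hg]; cases A.mul β β' <;> simp
  | single c n => simp

@[simp] theorem delHom_single_nil (n : N) : A.delHom N (Finsupp.single [] n) = 0 := by
  rw [delHom, Finsupp.liftAddHom_apply_single, delList, AddMonoidHom.zero_apply]

theorem delHom_consHom (β : Q) (u : List Q →₀ N) :
    A.delHom N (consHom N β u) = A.mergeHom N β u - consHom N β (A.delHom N u) := by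
  induction u using Finsupp.induction_linear with
  | zero => simp
  | add f g hf hg => simp only [map_add, hf, hg]; abel
  | single c n => simp [delHom, delList]

theorem mergeHom_mergeHom (β β' : Q) (u : List Q →₀ N) :
    A.mergeHom N β (A.mergeHom N β' u) = (A.mul β β').elim 0 fun γ => A.mergeHom N γ u := by
  induction u using Finsupp.induction_linear with
  | zero => simp; cases A.mul β β' <;> simp
  | add f g hf hg => simp only [map_add, hf, hg]; cases A.mul β β' <;> simp
  | single c n =>
    cases c with
    | nil => simp; cases A.mul β β' <;> simp
    | cons β'' c =>
      have h := A.mul_assoc' β β' β''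
      have h1 : A.mergeHom N β (A.mergeHom N β' (Finsupp.single (β'' :: c) n)) =
          ((A.mul β' β'').bind (fun δ => A.mul β δ)).elim 0
            fun γ => Finsupp.single (γ :: c) n := by
        rw [mergeHom_single_cons]
        cases A.mul β' β'' <;> simp
      rw [h1, ← h]
      cases A.mul β β' <;> simp

theorem delHom_mergeHom (β : Q) (u : List Q →₀ N) :
    A.delHom N (A.mergeHom N β u) = A.mergeHom N β (A.delHom N u) := by
  have : (A.delHom N).comp (A.mergeHom N β) = (A.mergeHom N β).comp (A.delHom N) := by
    refine hom_ext_cons (by simp) fun β' u => ?_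
    simp only [AddMonoidHom.comp_apply]
    rw [mergeHom_consHom, delHom_consHom, map_sub, mergeHom_mergeHom, mergeHom_consHom]
    cases A.mul β β' with
    | none => simp
    | some γ => simp [delHom_consHom]
  exact DFunLike.congr_fun this u

/-- Expanding twice along the first letter leaves two mixed terms. They cancel because merging into
the head commutes with the differential (`delHom_mergeHom`). -/
theorem delHom_delHom (u : List Q →₀ N) : A.delHom N (A.delHom N u) = 0 := by
  induction u using Finsupp.induction_linear with
  | zero => simp
  | add f g hf hg => simp only [map_add, hf, hg, add_zero]
  | single c n =>
    induction c with
    | nil => simp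
    | cons β c ih =>
      rw [← consHom_single, delHom_consHom, map_sub, delHom_consHom, ih, delHom_mergeHom]
      simp

section naturality

variable {N' : Type*} [AddCommGroup N'] (f : N →+ N')

theorem consHom_mapRange (β : Q) (u : List Q →₀ N) :
    consHom N' β (Finsupp.mapRange.addMonoidHom f u) =
      Finsupp.mapRange.addMonoidHom f (consHom N β u) := by
  induction u using Finsupp.induction_linear with
  | zero => simp
  | add g h hg hh => simp only [map_add, hg, hh]
  | single c n => simp

theorem mergeHom_mapRange (β : Q) (u : List Q →₀ N) :
    A.mergeHom N' β (Finsupp.mapRange.addMonoidHom f u) =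
      Finsupp.mapRange.addMonoidHom f (A.mergeHom N β u) := by
  induction u using Finsupp.induction_linear with
  | zero => simp
  | add g h hg hh => simp only [map_add, hg, hh]
  | single c n =>
    cases c with
    | nil => simp
    | cons β' c => simp; cases A.mul β β' <;> simp

/-- Merging letters never touches the coefficient, so it commutes with every additive map of
coefficients. This yields compatibility with ring multiplication, with module maps and with the
homotopy below. -/
theorem delHom_mapRange (u : List Q →₀ N) :
    A.delHom N' (Finsupp.mapRange.addMonoidHom f u) =
      Finsupp.mapRange.addMonoidHom f (A.delHom N u) := by
  induction u using Finsupp.induction_linear with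
  | zero => simp
  | add g h hg hh => simp only [map_add, hg, hh]
  | single c n =>
    induction c with
    | nil => simp
    | cons β c ih =>
      rw [← consHom_single, ← consHom_mapRange, delHom_consHom, delHom_consHom, ih, map_sub,
        mergeHom_mapRange, consHom_mapRange]

end naturality

end Bar

section BarModule

variable (N : Type*) [AddCommGroup N] [Module S N]

/-- Multiplication by a ring element, coefficientwise. -/
def smulHom (r : S) : (List Q →₀ N) →+ (List Q →₀ N) :=
  Finsupp.mapRange.addMonoidHom (DistribSMul.toAddMonoidHom N r)

@[simp] theorem smulHom_single (r : S) (c : List Q) (n : N) :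
    smulHom N r (Finsupp.single c n) = Finsupp.single c (r • n) := by
  simp [smulHom]

/-- The action of the head of a list on the coefficient. -/
def actList : List Q → N →+ (List Q →₀ N)
  | [] => 0
  | β :: c => (Finsupp.singleAddHom c).comp (DistribSMul.toAddMonoidHom N (A.b β))

/-- The part of the bar differential acting by the head of the list on the coefficient. -/
def actHom : (List Q →₀ N) →+ (List Q →₀ N) :=
  Finsupp.liftAddHom (A.actList N)

/-- The bar differential. -/
def D : (List Q →₀ N) →+ (List Q →₀ N) := A.actHom N - A.delHom N

variable {N}


@[simp] theorem actHom_single_nil (n : N) : A.actHom N (Finsupp.single [] n) = 0 := by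
  simp [actHom, actList]

@[simp] theorem actHom_consHom (β : Q) (u : List Q →₀ N) :
    A.actHom N (consHom N β u) = smulHom N (A.b β) u := by
  induction u using Finsupp.induction_linear with
  | zero => simp
  | add f g hf hg => simp only [map_add, hf, hg]
  | single c n => simp [actHom, actList]

theorem delHom_smulHom (r : S) (u : List Q →₀ N) :
    A.delHom N (smulHom N r u) = smulHom N r (A.delHom N u) :=
  A.delHom_mapRange _ u

theorem smulHom_smulHom (r r' : S) (u : List Q →₀ N) :
    smulHom N r (smulHom N r' u) = smulHom N (r * r') u := by
  induction u using Finsupp.induction_linear with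
  | zero => simp
  | add f g hf hg => simp only [map_add, hf, hg]
  | single c n => simp [mul_smul]

theorem D_consHom (β : Q) (u : List Q →₀ N) :
    A.D N (consHom N β u) =
      smulHom N (A.b β) u - A.mergeHom N β u + consHom N β (A.delHom N u) := by
  simp only [D, AddMonoidHom.sub_apply, actHom_consHom, delHom_consHom]
  abel

@[simp] theorem D_single_nil (n : N) : A.D N (Finsupp.single [] n) = 0 := by
  simp [D]

/-- This is associativity of the action: `b β' * b β` is the basis element of the composite of `β`
and `β'`, or zero. -/
theorem actHom_mergeHom (β : Q) (u : List Q →₀ N) :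
    A.actHom N (A.mergeHom N β u) = A.actHom N (smulHom N (A.b β) u) := by
  have : (A.actHom N).comp (A.mergeHom N β) = (A.actHom N).comp (smulHom N (A.b β)) := by
    refine hom_ext_cons (by simp) fun β' u => ?_
    simp only [AddMonoidHom.comp_apply]
    have h : smulHom N (A.b β) (consHom N β' u) = consHom N β' (smulHom N (A.b β) u) :=
      (consHom_mapRange _ β' u).symm
    rw [mergeHom_consHom, h, actHom_consHom, smulHom_smulHom, A.b_mul_b]
    cases A.mul β β' with
    | none =>
      have : smulHom N (0 : S) u = 0 := by
        ext c; simp [smulHom]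
      simp [this]
    | some γ => simp
  exact DFunLike.congr_fun this u

theorem D_D (u : List Q →₀ N) : A.D N (A.D N u) = 0 := by
  have : (A.D N).comp (A.D N) = 0 := by
    refine hom_ext_cons (by simp) fun β u => ?_
    simp only [AddMonoidHom.comp_apply, AddMonoidHom.zero_apply]
    rw [D_consHom, map_add, map_sub, D_consHom, delHom_delHom, map_zero, add_zero]
    simp only [D, AddMonoidHom.sub_apply]
    rw [actHom_mergeHom, delHom_mergeHom, delHom_smulHom]
    abel
  exact DFunLike.congr_fun this u

variable {N' : Type*} [AddCommGroup N'] [Module S N']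

/-- The map of bar complexes induced by a linear map. -/
def barMap (f : N →ₗ[S] N') : (List Q →₀ N) →+ (List Q →₀ N') :=
  Finsupp.mapRange.addMonoidHom f.toAddMonoidHom

@[simp] theorem barMap_single (f : N →ₗ[S] N') (c : List Q) (n : N) :
    barMap f (Finsupp.single c n) = Finsupp.single c (f n) := by
  simp [barMap]

@[simp] theorem barMap_apply (f : N →ₗ[S] N') (u : List Q →₀ N) (c : List Q) :
    barMap f u c = f (u c) := by
  simp [barMap]

theorem D_barMap (f : N →ₗ[S] N') (u : List Q →₀ N) :
    A.D N' (barMap f u) = barMap f (A.D N u) := by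
  have h : (A.D N').comp (barMap f) = (barMap f).comp (A.D N) := by
    refine hom_ext_cons (by simp) fun β u => ?_
    simp only [AddMonoidHom.comp_apply]
    have h1 : barMap f (consHom N β u) = consHom N' β (barMap f u) :=
      (consHom_mapRange _ β u).symm
    have h2 : barMap f (consHom N β (A.delHom N u)) = consHom N' β (barMap f (A.delHom N u)) :=
      (consHom_mapRange _ β _).symm
    have h3 : smulHom N' (A.b β) (barMap f u) = barMap f (smulHom N (A.b β) u) := by
      ext c; simp [smulHom]
    have h4 : A.mergeHom N' β (barMap f u) = barMap f (A.mergeHom N β u) :=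
      A.mergeHom_mapRange _ β u
    have h5 : A.delHom N' (barMap f u) = barMap f (A.delHom N u) :=
      A.delHom_mapRange _ u
    rw [h1, D_consHom, D_consHom, map_add, map_sub, h2, h3, h4, h5]
  exact DFunLike.congr_fun h u

end BarModule

end MonomialAlgebra

end

/-! ### The normalized bar complex and its exactness on projective modules -/

noncomputable section

set_option linter.unusedSectionVars false

namespace MonomialAlgebra

variable {k S Q O : Type*} [Field k] [Ring S] [Algebra k S] [Fintype O]
  (A : MonomialAlgebra k S Q O)

/-- The total degree of a list of morphisms. -/
def listDeg (c : List Q) : ℕ := (c.map A.deg).sum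

@[simp] theorem listDeg_nil : A.listDeg [] = 0 := rfl

@[simp] theorem listDeg_cons (β : Q) (c : List Q) :
    A.listDeg (β :: c) = A.deg β + A.listDeg c := by simp [listDeg]

/-- A list of composable morphisms of positive degree. -/
def Valid (c : List Q) : Prop :=
  (∀ α ∈ c, 0 < A.deg α) ∧ c.IsChain fun α β => A.tgt α = A.src β

/-- The idempotent at the source of a list. -/
def headIdem : List Q → S
  | [] => 1
  | β :: _ => A.b (A.idn (A.src β))

/-- Functions whose values lie in given subgroups. -/
def coeffIn {N : Type*} [AddCommGroup N] (W : List Q → AddSubgroup N) :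
    AddSubgroup (List Q →₀ N) where
  carrier := {u | ∀ c, u c ∈ W c}
  zero_mem' c := (W c).zero_mem
  add_mem' hu hv c := (W c).add_mem (hu c) (hv c)
  neg_mem' hu c := (W c).neg_mem (hu c)

theorem single_mem_coeffIn {N : Type*} [AddCommGroup N] {W : List Q → AddSubgroup N} {c : List Q}
    {n : N} (hn : n ∈ W c) : Finsupp.single c n ∈ coeffIn W := by
  classical
  intro c'
  rw [Finsupp.single_apply]
  split_ifs with h
  · exact h ▸ hn
  · exact zero_mem _

theorem map_mem_of_coeffIn {N X : Type*} [AddCommGroup N] [AddCommGroup X]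
    {W : List Q → AddSubgroup N} {f : (List Q →₀ N) →+ X} {H : AddSubgroup X}
    (h : ∀ c, ∀ n ∈ W c, f (Finsupp.single c n) ∈ H) {u : List Q →₀ N} (hu : u ∈ coeffIn W) :
    f u ∈ H := by
  rw [← Finsupp.sum_single u, Finsupp.sum, map_sum]
  exact sum_mem fun c _ => h c _ (hu c)

/-- The subgroup of coefficients allowed at a list in the bar complex. -/
def barCoeff (N : Type*) [AddCommGroup N] [Module S N] (i : ℕ) (c : List Q) : AddSubgroup N where
  carrier := {n | A.headIdem c • n = n ∧ (¬ (A.Valid c ∧ c.length = i) → n = 0)}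
  zero_mem' := by simp
  add_mem' := by
    rintro a b ⟨h1, h2⟩ ⟨h3, h4⟩
    exact ⟨by rw [smul_add, h1, h3], fun h => by rw [h2 h, h4 h, add_zero]⟩
  neg_mem' := by
    rintro a ⟨h1, h2⟩
    exact ⟨by rw [smul_neg, h1], fun h => by rw [h2 h, neg_zero]⟩

/-- The bar complex, without grading. -/
def Bar (N : Type*) [AddCommGroup N] [Module S N] (i : ℕ) : AddSubgroup (List Q →₀ N) :=
  coeffIn (A.barCoeff N i)

theorem b_idn_mul_b {α : Q} {o : O} (h : A.tgt α = o) : A.b (A.idn o) * A.b α = A.b α := by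
  rw [A.b_mul_b, ← h, A.mul_idn]; rfl

theorem b_mul_b_idn {α : Q} {o : O} (h : A.src α = o) : A.b α * A.b (A.idn o) = A.b α := by
  rw [A.b_mul_b, ← h, A.idn_mul]; rfl

theorem b_idn_mul_b_of_ne {α : Q} {o : O} (h : A.tgt α ≠ o) : A.b (A.idn o) * A.b α = 0 := by
  rw [A.b_mul_b]
  cases h' : A.mul α (A.idn o) with
  | none => rfl
  | some γ => exact absurd ((A.comp_mul h').trans (A.src_idn o)) h

theorem b_mul_b_idn_of_ne {α : Q} {o : O} (h : A.src α ≠ o) : A.b α * A.b (A.idn o) = 0 := by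
  rw [A.b_mul_b]
  cases h' : A.mul (A.idn o) α with
  | none => rfl
  | some γ => exact absurd ((A.comp_mul h').symm.trans (A.tgt_idn o)) h

theorem headIdem_mul_self (c : List Q) : A.headIdem c * A.headIdem c = A.headIdem c := by
  cases c with
  | nil => simp [headIdem]
  | cons β c => exact A.b_idn_mul_b (A.tgt_idn _)

theorem valid_nil : A.Valid [] := ⟨by simp, .nil⟩

theorem valid_cons {β : Q} {c : List Q} : A.Valid (β :: c) ↔
    0 < A.deg β ∧ A.Valid c ∧ ∀ β' ∈ c.head?, A.tgt β = A.src β' := by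
  simp only [Valid, List.isChain_cons, List.mem_cons, forall_eq_or_imp]
  tauto

section

variable {N : Type*} [AddCommGroup N]

/-- Coefficients in `W` on the composable lists of length `i` with source `o`. -/
def pathCoeff (W : AddSubgroup N) (i : ℕ) (o : O) (c : List Q) : AddSubgroup N where
  carrier := {n | n ∈ W ∧ (¬ (A.Valid c ∧ c.length = i ∧ ∃ β ∈ c.head?, A.src β = o) → n = 0)}
  zero_mem' := ⟨W.zero_mem, fun _ => rfl⟩
  add_mem' := by
    rintro a b ⟨h1, h2⟩ ⟨h3, h4⟩
    exact ⟨W.add_mem h1 h3, fun h => by rw [h2 h, h4 h, add_zero]⟩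
  neg_mem' := by
    rintro a ⟨h1, h2⟩
    exact ⟨W.neg_mem h1, fun h => by rw [h2 h, neg_zero]⟩

theorem consHom_mem_pathCoeff {W : AddSubgroup N} {i : ℕ} {β : Q} (hβ : 0 < A.deg β)
    {u : List Q →₀ N} (hu : u ∈ coeffIn (A.pathCoeff W i (A.tgt β))) :
    consHom N β u ∈ coeffIn (A.pathCoeff W (i + 1) (A.src β)) := by
  refine map_mem_of_coeffIn (fun c n hn => ?_) hu
  rw [consHom_single]
  refine single_mem_coeffIn ⟨hn.1, fun h => hn.2 fun ⟨h1, h2, β', h3, h4⟩ => h ?_⟩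
  refine ⟨A.valid_cons.2 ⟨hβ, h1, fun β'' h => ?_⟩, by simpa using h2, β, by simp, rfl⟩
  rw [Option.mem_unique h h3, h4]

/-- The source of the list has to be carried through the induction, since it is what keeps the
prefixed letter composable with the result. The subgroup `W` is arbitrary because coefficients are
only copied; it will be the set of elements fixed by the source idempotent. -/
theorem delHom_single_mem {W : AddSubgroup N} {n : N} (hn : n ∈ W) (c : List Q) :
    ∀ β, A.Valid (β :: c) →
      A.delHom N (Finsupp.single (β :: c) n) ∈
        coeffIn (A.pathCoeff W c.length (A.src β)) := by
  induction c with
  | nil =>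
    intro β _
    rw [← consHom_single, delHom_consHom]
    simp [zero_mem]
  | cons β' c ih =>
    intro β h
    rw [A.valid_cons] at h
    obtain ⟨h1, h2, h3⟩ := h
    have h3 : A.tgt β = A.src β' := h3 β' rfl
    rw [← consHom_single, delHom_consHom, mergeHom_single_cons]
    refine sub_mem ?_ (A.consHom_mem_pathCoeff h1 (h3 ▸ ih β' h2))
    cases h4 : A.mul β β' with
    | none => exact zero_mem _
    | some γ =>
      rw [A.valid_cons] at h2
      refine single_mem_coeffIn ⟨hn, fun h => absurd ?_ h⟩
      refine ⟨A.valid_cons.2 ⟨?_, h2.2.1, fun β'' h => ?_⟩, rfl, γ, rfl, A.src_mul h4⟩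
      · rw [A.deg_mul h4]; omega
      · rw [A.tgt_mul h4]; exact h2.2.2 β'' h

variable [Module S N]

theorem D_mem_Bar {i : ℕ} {u : List Q →₀ N} (hu : u ∈ A.Bar N (i + 1)) : A.D N u ∈ A.Bar N i := by
  refine map_mem_of_coeffIn (fun c n hn => ?_) hu
  obtain ⟨h1, h2⟩ := hn
  by_cases hv : A.Valid c ∧ c.length = i + 1
  swap
  · rw [h2 hv]; simp [zero_mem]
  obtain ⟨hv, hl⟩ := hv
  cases c with
  | nil => simp at hl
  | cons β c =>
    rw [D, AddMonoidHom.sub_apply]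
    have hl' : c.length = i := by simpa using hl
    refine sub_mem ?_ ?_
    · rw [← consHom_single, actHom_consHom, smulHom_single]
      rw [A.valid_cons] at hv
      refine single_mem_coeffIn ⟨?_, fun h => absurd ⟨hv.2.1, hl'⟩ h⟩
      cases c with
      | nil => simp [headIdem]
      | cons β' c =>
        rw [headIdem, smul_smul, A.b_idn_mul_b (hv.2.2 β' rfl)]
    -- Being fixed by the source idempotent is membership in the kernel of an additive map, which is
    -- a subgroup to which `delHom_single_mem` applies.
    · have hW : n ∈ (DistribSMul.toAddMonoidHom N (A.b (A.idn (A.src β))) -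
          AddMonoidHom.id N).ker := by
        simpa [AddMonoidHom.mem_ker, sub_eq_zero, headIdem] using h1
      have h := A.delHom_single_mem hW c β hv
      rw [hl'] at h
      intro c'
      obtain ⟨h3, h4⟩ := h c'
      refine ⟨?_, fun h => h4 fun h' => h ⟨h'.1, h'.2.1⟩⟩
      by_cases hc : A.Valid c' ∧ c'.length = i ∧ ∃ β' ∈ c'.head?, A.src β' = A.src β
      · obtain ⟨-, -, β', h5, h6⟩ := hc
        cases c' with
        | nil => simp at h5
        | cons β'' c' =>
          obtain rfl : β'' = β' := by simpa using h5
          rw [headIdem, h6]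
          simpa [AddMonoidHom.mem_ker, sub_eq_zero] using h3
      · rw [h4 hc, smul_zero]

variable {N' : Type*} [AddCommGroup N'] [Module S N']

theorem barMap_mem_Bar (f : N →ₗ[S] N') {i : ℕ} {u : List Q →₀ N} (hu : u ∈ A.Bar N i) :
    barMap f u ∈ A.Bar N' i := by
  intro c
  rw [barMap_apply]
  exact ⟨by rw [← map_smul, (hu c).1], fun h => by rw [(hu c).2 h, map_zero]⟩

end

/-! ### The contracting homotopy on free modules -/

section Free

variable (X : Type*)

/-- The contracting homotopy on the bar complex of a free module. -/
def homotopy : (List Q →₀ (X →₀ S)) →+ (List Q →₀ (X →₀ S)) :=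
  Finsupp.liftAddHom fun c => Finsupp.liftAddHom fun x =>
    (Finsupp.liftAddHom fun β => if 0 < A.deg β then
      (Finsupp.singleAddHom (β :: c)).comp ((Finsupp.singleAddHom x).comp
        (LinearMap.toSpanSingleton k S (A.b (A.idn (A.src β)))).toAddMonoidHom) else 0).comp
      A.b.repr.toLinearMap.toAddMonoidHom

variable {X}

theorem homotopy_single (c : List Q) (x : X) (t : k) (β : Q) :
    A.homotopy X (Finsupp.single c (Finsupp.single x (t • A.b β))) =
      if 0 < A.deg β then
        Finsupp.single (β :: c) (Finsupp.single x (t • A.b (A.idn (A.src β)))) else 0 := by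
  simp only [homotopy, Finsupp.liftAddHom_apply_single, AddMonoidHom.comp_apply]
  have : A.b.repr.toLinearMap.toAddMonoidHom (t • A.b β) = Finsupp.single β t := by
    simp
  rw [this, Finsupp.liftAddHom_apply_single]
  split_ifs <;> simp

/-- The integral multiples of a monomial element of a free module. -/
def monoHom (x : X) (t : k) (β : Q) : ℤ →+ (X →₀ S) :=
  zmultiplesHom _ (Finsupp.single x (t • A.b β))

theorem single_monoHom (c : List Q) (x : X) (t : k) (β : Q) (n : ℤ) :
    Finsupp.single c (A.monoHom x t β n) =
      n • Finsupp.single c (Finsupp.single x (t • A.b β)) := by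
  rw [monoHom, zmultiplesHom_apply, Finsupp.smul_single n c]

/-- The homotopy moves the monomial coefficient `b β` to the front of the list, whatever the list
is. Presenting chains as images of integral chains lets `delHom_mapRange` exchange this with the
merging of letters. -/
theorem homotopy_mapRange (x : X) (t : k) {β : Q} (hβ : 0 < A.deg β) (u : List Q →₀ ℤ) :
    A.homotopy X (Finsupp.mapRange.addMonoidHom (A.monoHom x t β) u) =
      consHom _ β (Finsupp.mapRange.addMonoidHom (A.monoHom x t (A.idn (A.src β))) u) := by
  induction u using Finsupp.induction_linear with
  | zero => simp
  | add f g hf hg => simp only [map_add, hf, hg]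
  | single c n =>
    simp only [Finsupp.mapRange.addMonoidHom_apply, Finsupp.mapRange_single, single_monoHom]
    refine (map_zsmul (A.homotopy X) n _).trans ?_
    rw [homotopy_single, if_pos hβ, map_zsmul, consHom_single]

theorem homotopy_mapRange_of_deg_eq_zero (x : X) (t : k) {β : Q} (hβ : A.deg β = 0)
    (u : List Q →₀ ℤ) :
    A.homotopy X (Finsupp.mapRange.addMonoidHom (A.monoHom x t β) u) = 0 := by
  induction u using Finsupp.induction_linear with
  | zero => simp
  | add f g hf hg => simp only [map_add, hf, hg, add_zero]
  | single c n =>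
    simp only [Finsupp.mapRange.addMonoidHom_apply, Finsupp.mapRange_single, single_monoHom]
    refine (map_zsmul (A.homotopy X) n _).trans ?_
    rw [homotopy_single, if_neg (by omega), smul_zero]

theorem single_eq_mapRange (c : List Q) (x : X) (t : k) (β : Q) :
    Finsupp.single c (Finsupp.single x (t • A.b β)) =
      Finsupp.mapRange.addMonoidHom (A.monoHom x t β) (Finsupp.single c 1) := by
  simp [monoHom]

theorem b_smul_single (x : X) (t : k) (β β' : Q) :
    A.b β' • Finsupp.single x (t • A.b β) =
      (A.mul β β').elim 0 fun γ => Finsupp.single x (t • A.b γ) := by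
  rw [Finsupp.smul_single, smul_eq_mul, mul_smul_comm, A.b_mul_b]
  cases A.mul β β' <;> simp

/-- If `β` has positive degree, the homotopy turns the coefficient into a first letter. In the
differential of the longer list, letting this letter act restores the original element, and the
remaining terms cancel against the homotopy of the differential. If `β` has degree zero it is an
identity and the homotopy vanishes on it. Letting `β'` act then makes `b β'` the coefficient, and
the homotopy turns it back into a letter. -/
theorem homotopy_formula (x : X) (t : k) (β β' : Q) (c : List Q) (h : A.tgt β = A.src β')
    (hβ' : 0 < A.deg β') :
    A.D _ (A.homotopy X (Finsupp.single (β' :: c) (Finsupp.single x (t • A.b β)))) +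
      A.homotopy X (A.D _ (Finsupp.single (β' :: c) (Finsupp.single x (t • A.b β)))) =
      Finsupp.single (β' :: c) (Finsupp.single x (t • A.b β)) := by
  have hact : A.actHom _ (Finsupp.single (β' :: c) (Finsupp.single x (t • A.b β))) =
      (A.mul β β').elim 0 fun γ => Finsupp.single c (Finsupp.single x (t • A.b γ)) := by
    rw [← consHom_single, actHom_consHom, smulHom_single, b_smul_single]
    cases A.mul β β' <;> simp
  by_cases hβ : 0 < A.deg β
  · have h1 : A.homotopy X (A.delHom _ (Finsupp.single (β' :: c) (Finsupp.single x (t • A.b β)))) =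
        consHom _ β (A.delHom _ (Finsupp.single (β' :: c)
          (Finsupp.single x (t • A.b (A.idn (A.src β)))))) := by
      rw [single_eq_mapRange, delHom_mapRange, homotopy_mapRange _ _ _ hβ, ← delHom_mapRange,
        ← single_eq_mapRange]
    have h2 : A.homotopy X (A.actHom _ (Finsupp.single (β' :: c)
        (Finsupp.single x (t • A.b β)))) =
        A.mergeHom _ β (Finsupp.single (β' :: c)
          (Finsupp.single x (t • A.b (A.idn (A.src β))))) := by
      rw [hact, mergeHom_single_cons]
      cases h3 : A.mul β β' with
      | none => simp
      | some γ =>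
        simp only [Option.elim_some]
        rw [homotopy_single, if_pos (by rw [A.deg_mul h3]; omega), A.src_mul h3]
    rw [homotopy_single, if_pos hβ]
    rw [← consHom_single, D_consHom, D, AddMonoidHom.sub_apply, map_sub, h1, h2, smulHom_single, b_smul_single, A.idn_mul]
    simp only [Option.elim_some]
    abel
  · have hβ : A.deg β = 0 := by omega
    rw [homotopy_single, if_neg (by omega), map_zero, zero_add, D, AddMonoidHom.sub_apply, map_sub,
      hact]
    have h1 : A.homotopy X (A.delHom _ (Finsupp.single (β' :: c)
        (Finsupp.single x (t • A.b β)))) = 0 := by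
      rw [single_eq_mapRange, delHom_mapRange, homotopy_mapRange_of_deg_eq_zero _ _ _ hβ]
    have h2 := A.eq_idn β hβ
    have h3 : A.src β = A.src β' := by rw [← h, h2, A.tgt_idn, A.src_idn]
    rw [h3] at h2
    rw [h1, h2, A.idn_mul]
    refine (sub_zero _).trans ?_
    simp only [Option.elim_some]
    rw [homotopy_single, if_pos hβ']

/-- Additive maps on a free module agree if they agree on monomial elements. -/
theorem free_hom_ext {Y : Type*} [AddCommGroup Y] {f g : (X →₀ S) →+ Y}
    (h : ∀ (x : X) (t : k) β, f (Finsupp.single x (t • A.b β)) = g (Finsupp.single x (t • A.b β))) : f = g := by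
  refine Finsupp.addHom_ext fun x s => ?_
  rw [← A.b.linearCombination_repr s, Finsupp.linearCombination_apply, Finsupp.sum]
  rw [← Finsupp.singleAddHom_apply x, map_sum, map_sum, map_sum]
  exact Finset.sum_congr rfl fun β _ => h x _ β

theorem homotopy_spec {i : ℕ} {u : List Q →₀ (X →₀ S)} (hu : u ∈ A.Bar (X →₀ S) (i + 1)) :
    A.D _ (A.homotopy X u) + A.homotopy X (A.D _ u) = u := by
  let f : (List Q →₀ (X →₀ S)) →+ (List Q →₀ (X →₀ S)) :=
    (A.D _).comp (A.homotopy X) + (A.homotopy X).comp (A.D _) - AddMonoidHom.id _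
  suffices h : f u ∈ (⊥ : AddSubgroup (List Q →₀ (X →₀ S))) by
    rw [AddSubgroup.mem_bot] at h
    exact sub_eq_zero.1 h
  refine map_mem_of_coeffIn (N := X →₀ S) (X := List Q →₀ (X →₀ S)) (f := f) (W := A.barCoeff (X →₀ S) (i + 1)) (fun c n hn => ?_) hu
  by_cases hv : A.Valid c ∧ c.length = i + 1
  swap
  · rw [hn.2 hv]; simp [zero_mem]
  obtain ⟨hv, hl⟩ := hv
  cases c with
  | nil => simp at hl
  | cons β' c =>
    -- Replacing the coefficient by its image under the source idempotent kills all monomials whose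
    -- target is not the source of `β'`, so only composable ones need checking.
    rw [AddSubgroup.mem_bot, ← hn.1]
    suffices h : (f.comp (Finsupp.singleAddHom (β' :: c))).comp
        (DistribSMul.toAddMonoidHom _ (A.headIdem (β' :: c))) = 0 from DFunLike.congr_fun h n
    refine A.free_hom_ext (Y := List Q →₀ (X →₀ S)) fun x t β => ?_
    simp only [AddMonoidHom.comp_apply, DistribSMul.toAddMonoidHom_apply, AddMonoidHom.zero_apply,
      Finsupp.singleAddHom_apply, headIdem, Finsupp.smul_single, smul_eq_mul, mul_smul_comm]
    by_cases h : A.tgt β = A.src β'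
    · rw [A.b_idn_mul_b h]
      exact sub_eq_zero.2 (A.homotopy_formula x t β β' c h (A.valid_cons.1 hv).1)
    · rw [A.b_idn_mul_b_of_ne h]
      simp

theorem homotopy_mem_Bar {i : ℕ} {u : List Q →₀ (X →₀ S)} (hu : u ∈ A.Bar (X →₀ S) (i + 1)) :
    A.homotopy X u ∈ A.Bar (X →₀ S) (i + 2) := by
  refine map_mem_of_coeffIn (fun c n hn => ?_) hu
  by_cases hv : A.Valid c ∧ c.length = i + 1
  swap
  · rw [hn.2 hv]; simp [zero_mem]
  obtain ⟨hv, hl⟩ := hv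
  cases c with
  | nil => simp at hl
  | cons β' c =>
    rw [← hn.1]
    -- Membership becomes the vanishing of an additive map into a quotient, which can be tested on
    -- monomials.
    rw [← QuotientAddGroup.eq_zero_iff]
    suffices h : (((QuotientAddGroup.mk' (A.Bar (X →₀ S) (i + 2))).comp
        ((A.homotopy X).comp (Finsupp.singleAddHom (β' :: c)))).comp
        (DistribSMul.toAddMonoidHom _ (A.headIdem (β' :: c)))) = 0 from DFunLike.congr_fun h n
    refine A.free_hom_ext fun x t β => ?_
    simp only [AddMonoidHom.comp_apply, DistribSMul.toAddMonoidHom_apply, AddMonoidHom.zero_apply,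
      Finsupp.singleAddHom_apply, headIdem, Finsupp.smul_single, smul_eq_mul, mul_smul_comm]
    by_cases h : A.tgt β = A.src β'
    · rw [A.b_idn_mul_b h, homotopy_single]
      split_ifs with hβ
      · refine (QuotientAddGroup.eq_zero_iff _).2 (single_mem_coeffIn ⟨?_, fun h' => absurd ?_ h'⟩)
        · rw [headIdem, Finsupp.smul_single, smul_eq_mul, mul_smul_comm,
            A.b_idn_mul_b (A.tgt_idn _)]
        · refine ⟨A.valid_cons.2 ⟨hβ, hv, fun β'' h' => ?_⟩, by simpa using hl⟩
          obtain rfl : β' = β'' := by simpa using h'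
          exact h
      · simp
    · rw [A.b_idn_mul_b_of_ne h]
      simp

theorem exists_of_free {i : ℕ} {z : List Q →₀ (X →₀ S)} (hz : z ∈ A.Bar (X →₀ S) (i + 1))
    (h : A.D _ z = 0) : ∃ w ∈ A.Bar (X →₀ S) (i + 2), A.D _ w = z := by
  refine ⟨A.homotopy X z, A.homotopy_mem_Bar hz, ?_⟩
  have := A.homotopy_spec hz
  rwa [h, map_zero, add_zero] at this

end Free

/-- A projective module is a retract of a free one and the bar complex is functorial, so a filling
found over the free module is pushed back along the retraction. -/
theorem exists_of_projective {N : Type*} [AddCommGroup N] [Module S N] [Module.Projective S N]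
    {i : ℕ} {z : List Q →₀ N} (hz : z ∈ A.Bar N (i + 1)) (h : A.D _ z = 0) :
    ∃ w ∈ A.Bar N (i + 2), A.D _ w = z := by
  obtain ⟨σ, hσ⟩ := Module.projective_def'.1 ‹Module.Projective S N›
  obtain ⟨w, hw, hwz⟩ := A.exists_of_free (A.barMap_mem_Bar σ hz) (by rw [D_barMap, h, map_zero])
  refine ⟨barMap (Finsupp.linearCombination S id) w, A.barMap_mem_Bar _ hw, ?_⟩
  rw [D_barMap, hwz]
  ext c
  simp only [barMap_apply]
  exact LinearMap.congr_fun hσ (z c)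

end MonomialAlgebra

end

/-! ### Internal degrees, dimension shifting and the meaning of bar homology in degree zero -/

noncomputable section

set_option linter.unusedSectionVars false

namespace MonomialAlgebra

variable {k S Q O : Type*} [Field k] [Ring S] [Algebra k S] [Fintype O]
  {A : MonomialAlgebra k S Q O}

namespace Grading

variable {N : Type*} [AddCommGroup N] [Module S N] (G : A.Grading N)

theorem p_p (m n : ℤ) (x : N) : G.p m (G.p n x) = if m = n then G.p n x else 0 := by
  split_ifs with h
  · rw [h, G.p_same]
  · exact G.p_ne m n x h

theorem p_of_eq {m n : ℤ} {x : N} (h : G.p n x = x) : G.p m x = if m = n then x else 0 := by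
  rw [← h, p_p]

theorem p_b_smul' (α : Q) (n : ℤ) (x : N) :
    G.p n (A.b α • x) = A.b α • G.p (n - A.deg α) x := by
  rw [← G.p_b_smul, add_sub_cancel]

theorem p_b_idn_smul (o : O) (n : ℤ) (x : N) :
    G.p n (A.b (A.idn o) • x) = A.b (A.idn o) • G.p n x := by
  rw [p_b_smul', A.deg_idn, Nat.cast_zero, sub_zero]

theorem p_headIdem_smul (c : List Q) (n : ℤ) (x : N) :
    G.p n (A.headIdem c • x) = A.headIdem c • G.p n x := by
  cases c with
  | nil => simp [headIdem]
  | cons β c => exact G.p_b_idn_smul _ n x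

/-- The projection of the bar complex to a homogeneous component. -/
def barProj (j : ℤ) : (List Q →₀ N) →+ (List Q →₀ N) :=
  Finsupp.liftAddHom fun c => (Finsupp.singleAddHom c).comp (G.p (j - A.listDeg c))

@[simp] theorem barProj_single (j : ℤ) (c : List Q) (n : N) :
    G.barProj j (Finsupp.single c n) = Finsupp.single c (G.p (j - A.listDeg c) n) := by
  simp [barProj]

theorem barProj_apply (j : ℤ) (u : List Q →₀ N) (c : List Q) :
    G.barProj j u c = G.p (j - A.listDeg c) (u c) := by
  classical
  induction u using Finsupp.induction_linear with
  | zero => simp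
  | add f g hf hg => simp only [map_add, Finsupp.add_apply, hf, hg]
  | single c' n =>
    rw [barProj_single, Finsupp.single_apply, Finsupp.single_apply]
    split_ifs with h
    · rw [h]
    · simp

theorem barProj_barProj (j : ℤ) (u : List Q →₀ N) :
    G.barProj j (G.barProj j u) = G.barProj j u := by
  ext c
  rw [barProj_apply, barProj_apply, p_same]

theorem barProj_consHom (j : ℤ) (β : Q) (u : List Q →₀ N) :
    G.barProj j (consHom N β u) = consHom N β (G.barProj (j - A.deg β) u) := by
  induction u using Finsupp.induction_linear with
  | zero => simp
  | add f g hf hg => simp only [map_add, hf, hg]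
  | single c n => simp [sub_sub]

theorem barProj_smulHom (j : ℤ) (β : Q) (u : List Q →₀ N) :
    G.barProj j (smulHom N (A.b β) u) = smulHom N (A.b β) (G.barProj (j - A.deg β) u) := by
  induction u using Finsupp.induction_linear with
  | zero => simp
  | add f g hf hg => simp only [map_add, hf, hg]
  | single c n => simp [p_b_smul', sub_right_comm]

theorem barProj_mergeHom (j : ℤ) (β : Q) (u : List Q →₀ N) :
    G.barProj j (A.mergeHom N β u) = A.mergeHom N β (G.barProj (j - A.deg β) u) := by
  induction u using Finsupp.induction_linear with
  | zero => simp
  | add f g hf hg => simp only [map_add, hf, hg]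
  | single c n =>
    cases c with
    | nil => simp
    | cons β' c =>
      simp only [mergeHom_single_cons, barProj_single, listDeg_cons]
      cases h : A.mul β β' with
      | none => simp
      | some γ => simp [A.deg_mul h, sub_sub, add_assoc]

theorem barProj_delHom (j : ℤ) (u : List Q →₀ N) :
    G.barProj j (A.delHom N u) = A.delHom N (G.barProj j u) := by
  induction u using Finsupp.induction_linear with
  | zero => simp
  | add f g hf hg => simp only [map_add, hf, hg]
  | single c n =>
    induction c generalizing j with
    | nil => simp
    | cons β c ih =>
      rw [← consHom_single, barProj_consHom, delHom_consHom, delHom_consHom, map_sub,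
        barProj_mergeHom, barProj_consHom, ih]

theorem barProj_D (j : ℤ) (u : List Q →₀ N) :
    G.barProj j (A.D N u) = A.D N (G.barProj j u) := by
  have h : (G.barProj j).comp (A.D N) = (A.D N).comp (G.barProj j) := by
    refine hom_ext_cons (by simp) fun β u => ?_
    simp only [AddMonoidHom.comp_apply]
    rw [barProj_consHom, D_consHom, D_consHom, map_add, map_sub, barProj_smulHom,
      barProj_mergeHom, barProj_consHom, barProj_delHom]
  exact DFunLike.congr_fun h u

theorem barProj_mem_Bar (j : ℤ) {i : ℕ} {u : List Q →₀ N} (hu : u ∈ A.Bar N i) :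
    G.barProj j u ∈ A.Bar N i := by
  intro c
  rw [barProj_apply]
  exact ⟨by rw [← p_headIdem_smul, (hu c).1], fun h => by rw [(hu c).2 h, map_zero]⟩

/-- The homology of the bar complex vanishes in homological degree `i` and internal degree `j`. -/
def BarExact (i : ℕ) (j : ℤ) : Prop :=
  ∀ z ∈ A.Bar N i, G.barProj j z = z → A.D N z = 0 → ∃ w ∈ A.Bar N (i + 1), A.D N w = z

variable {G}

/-- The differential preserves the internal degree, so the homogeneous component of a filling is
again a filling. -/
theorem BarExact.exists_graded {i : ℕ} {j : ℤ} (h : G.BarExact i j) {z : List Q →₀ N}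
    (hz : z ∈ A.Bar N i) (hj : G.barProj j z = z) (hD : A.D N z = 0) :
    ∃ w ∈ A.Bar N (i + 1), G.barProj j w = w ∧ A.D N w = z := by
  obtain ⟨w, hw, hwz⟩ := h z hz hj hD
  exact ⟨G.barProj j w, G.barProj_mem_Bar j hw, G.barProj_barProj j w, by
    rw [← barProj_D, hwz, hj]⟩

variable {P Ω : Type*} [AddCommGroup P] [Module S P] [AddCommGroup Ω] [Module S Ω]
  {GP : A.Grading P} {GΩ : A.Grading Ω}

theorem barMap_barProj {f : P →ₗ[S] N} (hf : ∀ n x, f (GP.p n x) = G.p n (f x)) (j : ℤ)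
    (u : List Q →₀ P) : barMap f (GP.barProj j u) = G.barProj j (barMap f u) := by
  ext c
  rw [barMap_apply, barProj_apply, barProj_apply, barMap_apply, hf]

/-- An arbitrary lift of a coefficient is made admissible by applying the source idempotent, which
does not change its image. -/
theorem exists_barMap_eq {f : P →ₗ[S] N} (hf : Function.Surjective f) {i : ℕ} {z : List Q →₀ N}
    (hz : z ∈ A.Bar N i) : ∃ y ∈ A.Bar P i, barMap f y = z := by
  refine map_mem_of_coeffIn (f := AddMonoidHom.id _) (H := (A.Bar P i).map (barMap f))
    (fun c n hn => ?_) hz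
  by_cases hv : A.Valid c ∧ c.length = i
  · obtain ⟨x, hx⟩ := hf n
    refine ⟨Finsupp.single c (A.headIdem c • x), single_mem_coeffIn ⟨?_, fun h => absurd hv h⟩, ?_⟩
    · rw [smul_smul, headIdem_mul_self]
    · rw [barMap_single, map_smul, hx, hn.1]; rfl
  · rw [hn.2 hv]; simp [zero_mem]

theorem barMap_injective {f : Ω →ₗ[S] P} (hf : Function.Injective f) :
    Function.Injective (barMap (Q := Q) f) :=
  Finsupp.mapRange_injective _ (map_zero _) hf

theorem exists_barMap_eq_of_exact {ι : Ω →ₗ[S] P} {π : P →ₗ[S] N} (hι : Function.Injective ι)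
    (hex : Function.Exact ι π) {i : ℕ} {u : List Q →₀ P} (hu : u ∈ A.Bar P i)
    (h : barMap π u = 0) : ∃ y ∈ A.Bar Ω i, barMap ι y = u := by
  have hu' : u ∈ coeffIn (fun c => A.barCoeff P i c ⊓ ι.toAddMonoidHom.range) := by
    refine fun c => ⟨hu c, (hex _).1 ?_⟩
    rw [← barMap_apply, h, Finsupp.zero_apply]
  refine map_mem_of_coeffIn (f := AddMonoidHom.id _) (H := (A.Bar Ω i).map (barMap ι))
    (fun c n hn => ?_) hu'
  obtain ⟨hn, n, rfl⟩ := hn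
  refine ⟨Finsupp.single c n, single_mem_coeffIn ⟨hι ?_, fun h => hι ?_⟩, by simp⟩
  · rw [map_smul]; exact hn.1
  · rw [map_zero]; exact hn.2 h

section shift

variable {ι : Ω →ₗ[S] P} {π : P →ₗ[S] N} (hι : Function.Injective ι)
  (hπ : Function.Surjective π) (hex : Function.Exact ι π)
  (hιp : ∀ n x, ι (GΩ.p n x) = GP.p n (ι x)) (hπp : ∀ n x, π (GP.p n x) = G.p n (π x))

include hι hπ hex hιp hπp

/-- In the long exact sequence of 0 → Ω → P → N → 0 the homology of `N` in degree `i + 1` embeds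
into that of `Ω` in degree `i`, since the projective `P` has no homology in positive degrees. The
proof is the diagram chase. -/
theorem BarExact.succ_of_syzygy [Module.Projective S P] {i : ℕ} {j : ℤ} (h : GΩ.BarExact i j) :
    G.BarExact (i + 1) j := by
  intro z hz hj hD
  obtain ⟨y, hy, hyz⟩ := exists_barMap_eq hπ hz
  have hy' : barMap π (GP.barProj j y) = z := by rw [barMap_barProj hπp, hyz, hj]
  replace hy := GP.barProj_mem_Bar j hy
  have hyj := GP.barProj_barProj j y
  generalize GP.barProj j y = y at hy hyj hy'
  obtain ⟨x, hx, hxy⟩ := exists_barMap_eq_of_exact hι hex (A.D_mem_Bar hy)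
    (by rw [← D_barMap, hy', hD])
  obtain ⟨w, hw, hwx⟩ := h x hx
    (barMap_injective hι (by rw [barMap_barProj hιp, hxy, barProj_D, hyj]))
    (barMap_injective hι (by rw [← D_barMap, hxy, D_D, map_zero]))
  obtain ⟨v, hv, hvy⟩ := A.exists_of_projective (z := y - barMap ι w)
    (sub_mem hy (A.barMap_mem_Bar ι hw)) (by rw [map_sub, D_barMap, hwx, hxy, sub_self])
  refine ⟨barMap π v, A.barMap_mem_Bar π hv, ?_⟩
  have h0 : barMap π (barMap ι w) = 0 := by
    ext c
    simp [hex.apply_apply_eq_zero]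
  rw [D_barMap, hvy, map_sub, hy', h0, sub_zero]

/-- The other half of dimension shifting: the homology of `Ω` in degree `i` lies between that of `N`
in degree `i + 1` and that of `P` in degree `i`, both zero in internal degree `j`. -/
theorem BarExact.syzygy_of_succ {i : ℕ} {j : ℤ} (hP : GP.BarExact i j)
    (h : G.BarExact (i + 1) j) : GΩ.BarExact i j := by
  intro z hz hj hD
  obtain ⟨w, hw, hwj, hwz⟩ := hP.exists_graded (A.barMap_mem_Bar ι hz)
    (by rw [← barMap_barProj hιp, hj]) (by rw [D_barMap, hD, map_zero])
  have h0 : barMap π (barMap ι z) = 0 := by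
    ext c
    simp [hex.apply_apply_eq_zero]
  obtain ⟨v, hv, hvw⟩ := h (barMap π w) (A.barMap_mem_Bar π hw)
    (by rw [← barMap_barProj hπp, hwj]) (by rw [D_barMap, hwz, h0])
  obtain ⟨y, hy, hyv⟩ := exists_barMap_eq hπ hv
  obtain ⟨x, hx, hxw⟩ := exists_barMap_eq_of_exact hι hex (u := w - A.D _ y)
    (sub_mem hw (A.D_mem_Bar hy)) (by rw [map_sub, ← D_barMap, hyv, hvw, sub_self])
  refine ⟨x, hx, barMap_injective hι ?_⟩
  rw [← D_barMap, hxw, map_sub, D_D, sub_zero, hwz]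

end shift

theorem barExact_of_projective [Module.Projective S N] (i : ℕ) (j : ℤ) : G.BarExact (i + 1) j :=
  fun _ hz _ hD => A.exists_of_projective hz hD

theorem mem_Bar_zero (n : N) : Finsupp.single [] n ∈ A.Bar N 0 :=
  single_mem_coeffIn ⟨by simp [headIdem], fun h => absurd ⟨A.valid_nil, rfl⟩ h⟩

theorem eq_single_of_mem_Bar_zero {z : List Q →₀ N} (hz : z ∈ A.Bar N 0) :
    z = Finsupp.single [] (z []) := by
  ext c
  cases c with
  | nil => simp
  | cons β c => rw [(hz _).2 (by simp)]; simp

/-- Bar homology in degree zero is the quotient of `N` by the action of positive degree elements.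
The idempotent at the source of `β` makes the coefficient admissible without changing its product
with `b β`. -/
theorem b_smul_mem (β : Q) (hβ : 0 < A.deg β) (x : N) :
    Finsupp.single [] (A.b β • x) ∈ (A.Bar N 1).map (A.D N) := by
  refine ⟨Finsupp.single [β] (A.b (A.idn (A.src β)) • x), single_mem_coeffIn ⟨?_, fun h => ?_⟩, ?_⟩
  · rw [headIdem, smul_smul, A.b_idn_mul_b (A.tgt_idn _)]
  · exact absurd ⟨A.valid_cons.2 ⟨hβ, A.valid_nil, by simp⟩, rfl⟩ h
  · rw [← consHom_single, D_consHom]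
    simp [smul_smul, A.b_mul_b_idn rfl]

variable (G)

/-- Away from degree `i₀`, the component of a multiple of a generator only involves monomials of
positive degree, and these give boundaries by `b_smul_mem`. -/
theorem barExact_zero_of_generated {i₀ : ℤ}
    (hG : Submodule.span S {x | G.p i₀ x = x} = ⊤) {j : ℤ} (hj : j ≠ i₀) : G.BarExact 0 j := by
  have key : ∀ x : N, Finsupp.single [] (G.p j x) ∈ (A.Bar N 1).map (A.D N) := by
    intro x
    have hx : x ∈ (Submodule.span S {x | G.p i₀ x = x}).toAddSubmonoid := by
      rw [hG]; exact Submodule.mem_top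
    rw [Submodule.span_eq_closure] at hx
    induction hx using AddSubmonoid.closure_induction with
    | zero => simp [zero_mem]
    | add x y _ _ hx hy => rw [map_add, Finsupp.single_add]; exact add_mem hx hy
    | mem x hx =>
      obtain ⟨s, -, x, hx, rfl⟩ := hx
      change Finsupp.single [] (G.p j (s • x)) ∈ _
      rw [← A.b.linearCombination_repr s, Finsupp.linearCombination_apply, Finsupp.sum,
        Finset.sum_smul, map_sum, ← Finsupp.singleAddHom_apply, map_sum]
      refine sum_mem fun β _ => ?_
      -- The scalar from `k` is moved past `b β` onto `x`, where it preserves the degree. The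
      -- component in degree `j` then survives only for `deg β = j - i₀`, which is nonzero.
      rw [Finsupp.singleAddHom_apply, ← mul_one (A.b β), ← mul_smul_comm, mul_smul,
        ← Algebra.algebraMap_eq_smul_one, p_b_smul', G.p_algebraMap_smul, G.p_of_eq hx]
      split_ifs with h
      · refine b_smul_mem β ?_ _
        by_contra h'
        exact hj (by rw [← h, show A.deg β = 0 by omega]; simp)
      · simp [zero_mem]
  intro z hz hzj _
  rw [eq_single_of_mem_Bar_zero hz]
  have h1 : G.p j (z []) = z [] := by
    have h := DFunLike.congr_fun hzj []
    simpa [barProj_apply] using h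
  rw [← h1]
  exact key _

/-- Graded Nakayama lemma: a homogeneous element above degree `i₀` is a boundary, hence a sum of
products of positive degree monomials with elements of smaller degree. Boundedness below makes the
induction work. -/
theorem generated_of_barExact_zero {i₀ : ℤ} (hb : ∀ n < i₀, ∀ x, G.p n x = 0)
    (h : ∀ j, j ≠ i₀ → G.BarExact 0 j) : Submodule.span S {x | G.p i₀ x = x} = ⊤ := by
  set V := Submodule.span S {x | G.p i₀ x = x}
  have key : ∀ m : ℕ, ∀ x, G.p (i₀ + m) x = x → x ∈ V := by
    intro m
    induction m using Nat.strong_induction_on with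
    | _ m ih =>
      intro x hx
      rcases Nat.eq_zero_or_pos m with rfl | hm
      · exact Submodule.subset_span (by simpa using hx)
      · obtain ⟨w, hw, hwj, hwx⟩ := (h (i₀ + m) (by omega)).exists_graded (mem_Bar_zero x)
          (by simp [hx]) (by simp)
        -- `W` records admissibility together with the degree: a coefficient at the list `[β]` has
        -- degree `i₀ + m - deg β`, which is smaller than `i₀ + m`.
        let W : List Q → AddSubgroup N := fun c => A.barCoeff N 1 c ⊓
          (G.p (i₀ + m - A.listDeg c) - AddMonoidHom.id N).ker
        have hw' : w ∈ coeffIn W := fun c => ⟨hw c, by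
          have := DFunLike.congr_fun hwj c
          rw [barProj_apply] at this
          simpa [AddMonoidHom.mem_ker, sub_eq_zero] using this⟩
        have hD : A.D N w ∈ coeffIn fun _ => V.toAddSubgroup := by
          refine map_mem_of_coeffIn (fun c n hn => ?_) hw'
          obtain ⟨⟨h1, h2⟩, h3⟩ := hn
          by_cases hv : A.Valid c ∧ c.length = 1
          swap
          · rw [h2 hv]; simp [zero_mem]
          obtain ⟨hv, hl⟩ := hv
          obtain ⟨β, rfl⟩ := List.length_eq_one_iff.1 hl
          have hβ := (A.valid_cons.1 hv).1
          have h3 : G.p (i₀ + m - A.deg β) n = n := by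
            simpa [AddMonoidHom.mem_ker, sub_eq_zero] using h3
          rw [← consHom_single, D_consHom]
          simp only [smulHom_single, mergeHom_single_nil, sub_zero, delHom_single_nil, map_zero,
            add_zero]
          refine single_mem_coeffIn (V.smul_mem _ ?_)
          by_cases hlt : i₀ + m - A.deg β < i₀
          · rw [← h3, hb _ hlt]; exact zero_mem _
          · exact ih (m - A.deg β) (by omega) n (by
              rw [← h3, Nat.cast_sub (by omega), ← add_sub_assoc, G.p_same])
        have := hD []
        rw [hwx, Finsupp.single_eq_same] at this
        exact this
  rw [eq_top_iff]
  intro x _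
  obtain ⟨s, hs⟩ := G.exists_sum x
  rw [← hs]
  refine sum_mem fun n _ => ?_
  by_cases hn : n < i₀
  · rw [hb n hn]; exact zero_mem _
  · refine key (n - i₀).toNat _ ?_
    rw [Int.toNat_of_nonneg (by omega), add_sub_cancel, G.p_same]

/-- The grading of a homogeneous submodule. -/
def restrict (K : Submodule S N) (hK : ∀ n, ∀ x ∈ K, G.p n x ∈ K) : A.Grading K where
  p n := ((G.p n).comp K.subtype.toAddMonoidHom).codRestrict K.toAddSubgroup
    fun x => hK n x x.2
  p_same n x := Subtype.ext (G.p_same n x)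
  p_ne m n x h := Subtype.ext (G.p_ne m n x h)
  exists_sum x := by
    obtain ⟨s, hs⟩ := G.exists_sum x
    refine ⟨s, Subtype.ext ?_⟩
    rw [AddSubmonoidClass.coe_finsetSum]
    exact hs
  p_b_smul α n x := Subtype.ext (G.p_b_smul α n x)
  p_algebraMap_smul t n x := Subtype.ext (G.p_algebraMap_smul t n x)

end Grading

/-- A module with a linear projective resolution has diagonal bar homology. -/
theorem barExact_of_resolution (i : ℕ) : ∀ (i₀ : ℤ) (P : ℕ → Type w) [∀ n, AddCommGroup (P n)]
    [∀ n, Module S (P n)] (GP : ∀ n, A.Grading (P n)) (_ : ∀ n, Module.Projective S (P n))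
    (_ : ∀ n, Submodule.span S {x | (GP n).p (n + i₀) x = x} = ⊤)
    (d : ∀ n, P (n + 1) →ₗ[S] P n) (_ : ∀ n m x, d n ((GP (n + 1)).p m x) = (GP n).p m (d n x))
    (_ : ∀ n, Function.Exact (d (n + 1)) (d n)) (N : Type w) [AddCommGroup N] [Module S N]
    (G : A.Grading N) (aug : P 0 →ₗ[S] N) (_ : ∀ m x, aug ((GP 0).p m x) = G.p m (aug x))
    (_ : Function.Surjective aug) (_ : Function.Exact (d 0) aug) (j : ℤ), j ≠ i + i₀ →
    G.BarExact i j := by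
  induction i with
  | zero =>
    intro i₀ P _ _ GP hproj hgen d hd hex N _ _ G aug haug hsurj hex0 j hj
    refine G.barExact_zero_of_generated (i₀ := i₀) ?_ (by simpa using hj)
    have h := congrArg (Submodule.map aug) (hgen 0)
    rw [Submodule.map_span, Submodule.map_top, LinearMap.range_eq_top.2 hsurj] at h
    rw [eq_top_iff, ← h]
    refine Submodule.span_mono ?_
    rintro _ ⟨x, hx, rfl⟩
    have hx : (GP 0).p i₀ x = x := by simpa using hx
    change G.p i₀ (aug x) = aug x
    rw [← haug, hx]
  | succ i ih =>
    intro i₀ P _ _ GP hproj hgen d hd hex N _ _ G aug haug hsurj hex0 j hj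
    have hK : ∀ n, ∀ x ∈ LinearMap.ker aug, (GP 0).p n x ∈ LinearMap.ker aug := by
      intro n x hx
      rw [LinearMap.mem_ker] at hx ⊢
      rw [haug, hx, map_zero]
    have := hproj 0
    -- The kernel of the augmentation is resolved by the truncated complex, whose `n`-th term is
    -- generated in degree `n + (i₀ + 1)`. The induction hypothesis therefore has to be general in
    -- `i₀`.
    refine Grading.BarExact.succ_of_syzygy (GP := GP 0)
      (GΩ := (GP 0).restrict (LinearMap.ker aug) hK) (ι := (LinearMap.ker aug).subtype)
      (π := aug) Subtype.val_injective hsurj ?_ (fun _ _ => rfl) haug ?_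
    · exact LinearMap.exact_subtype_ker_map aug
    · refine ih (i₀ + 1) (fun n => P (n + 1)) (fun n => GP (n + 1)) (fun n => hproj _) ?_
        (fun n => d (n + 1)) (fun n => hd _) (fun n => hex _) _ _
        ((d 0).codRestrict (LinearMap.ker aug) fun x => hex0.apply_apply_eq_zero x) ?_ ?_ ?_ j ?_
      · intro n
        rw [← hgen (n + 1)]
        congr! 6
        push_cast; ring
      · exact fun m x => Subtype.ext (hd 0 m x)
      · rintro ⟨x, hx⟩
        obtain ⟨y, rfl⟩ := (hex0 x).1 hx
        exact ⟨y, rfl⟩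
      · intro x
        rw [← hex 0 x]
        exact Subtype.ext_iff
      · push_cast at hj; omega

end MonomialAlgebra

end

/-! ### Projective covers of graded modules generated in one degree -/

noncomputable section

set_option linter.unusedSectionVars false

namespace MonomialAlgebra

section Cover

variable {k : Type*} {S : Type w} {Q : Type*} {O : Type w} [Field k] [Ring S] [Algebra k S]
  [Fintype O] {A : MonomialAlgebra k S Q O}

variable (A) in
/-- The projection of the algebra to a homogeneous component. -/
def degProj (n : ℤ) : S →ₗ[k] S :=
  A.b.constr k fun α => if (A.deg α : ℤ) = n then A.b α else 0

@[simp] theorem degProj_b (n : ℤ) (α : Q) :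
    A.degProj n (A.b α) = if (A.deg α : ℤ) = n then A.b α else 0 := by
  simp [degProj]

variable (A) in
/-- The projection of a free module, generated in degree `i₀`, to a homogeneous component. -/
def freeProj (X : Type*) (i₀ n : ℤ) : (X →₀ S) →+ (X →₀ S) :=
  Finsupp.mapRange.addMonoidHom (A.degProj (n - i₀)).toAddMonoidHom

theorem freeProj_single {X : Type*} (i₀ n : ℤ) (x : X) (t : k) (α : Q) :
    A.freeProj X i₀ n (Finsupp.single x (t • A.b α)) =
      if A.deg α + i₀ = n then Finsupp.single x (t • A.b α) else 0 := by
  have : ((A.deg α : ℤ) = n - i₀) ↔ A.deg α + i₀ = n := by omega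
  simp only [freeProj, Finsupp.mapRange.addMonoidHom_apply, Finsupp.mapRange_single,
    LinearMap.toAddMonoidHom_coe, map_smul, degProj_b, this]
  split_ifs <;> simp

variable (A) in
/-- The grading of a free module generated in degree `i₀`. -/
def freeGrading (X : Type*) (i₀ : ℤ) : A.Grading (X →₀ S) where
  p := A.freeProj X i₀
  p_same n x := by
    have : (A.freeProj X i₀ n).comp (A.freeProj X i₀ n) = A.freeProj X i₀ n :=
      A.free_hom_ext fun x t α => by
        rw [AddMonoidHom.comp_apply, freeProj_single]
        split_ifs with h
        · rw [freeProj_single, if_pos h]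
        · rw [map_zero]
    exact DFunLike.congr_fun this x
  p_ne m n x hmn := by
    have : (A.freeProj X i₀ m).comp (A.freeProj X i₀ n) = 0 :=
      A.free_hom_ext fun x t α => by
        rw [AddMonoidHom.comp_apply, freeProj_single]
        split_ifs with h
        · rw [freeProj_single, if_neg (by omega)]; rfl
        · rw [map_zero]; rfl
    exact DFunLike.congr_fun this x
  exists_sum u := by
    have h0 : ∀ m n x, A.freeProj X i₀ m (A.freeProj X i₀ n x) =
        if m = n then A.freeProj X i₀ n x else 0 := by
      intro m n x
      have : (A.freeProj X i₀ m).comp (A.freeProj X i₀ n) =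
          if m = n then A.freeProj X i₀ n else 0 :=
        A.free_hom_ext fun x t α => by
          rw [AddMonoidHom.comp_apply, freeProj_single]
          split_ifs with h h' h'
          · rw [freeProj_single, freeProj_single, if_pos h, if_pos (h.trans h'.symm)]
          · rw [freeProj_single, if_neg (by omega)]; rfl
          · rw [map_zero, freeProj_single, if_neg h]
          · rw [map_zero]; rfl
      have := DFunLike.congr_fun this x
      rw [AddMonoidHom.comp_apply] at this
      rw [this]
      split_ifs <;> rfl
    have add : ∀ x y : X →₀ S, (∃ s : Finset ℤ, ∑ n ∈ s, A.freeProj X i₀ n x = x) →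
        (∃ s : Finset ℤ, ∑ n ∈ s, A.freeProj X i₀ n y = y) →
        ∃ s : Finset ℤ, ∑ n ∈ s, A.freeProj X i₀ n (x + y) = x + y := by
      classical
      have sup : ∀ (x : X →₀ S) (s t : Finset ℤ), ∑ n ∈ s, A.freeProj X i₀ n x = x → s ⊆ t →
          ∑ n ∈ t, A.freeProj X i₀ n x = x := by
        intro x s t hs hst
        rw [← Finset.sum_subset hst, hs]
        intro n _ hn
        rw [← hs, map_sum]
        refine Finset.sum_eq_zero fun m hm => ?_
        rw [h0, if_neg]
        rintro rfl
        exact hn hm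
      rintro x y ⟨s, hs⟩ ⟨t, ht⟩
      refine ⟨s ∪ t, ?_⟩
      simp only [map_add, Finset.sum_add_distrib]
      rw [sup x s _ hs Finset.subset_union_left, sup y t _ ht Finset.subset_union_right]
    have hsum : ∀ (ι : Type _) (s : Finset ι) (f : ι → (X →₀ S)),
        (∀ i ∈ s, ∃ t : Finset ℤ, ∑ n ∈ t, A.freeProj X i₀ n (f i) = f i) →
        ∃ t : Finset ℤ, ∑ n ∈ t, A.freeProj X i₀ n (∑ i ∈ s, f i) = ∑ i ∈ s, f i := by
      classical
      intro ι s f hf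
      induction s using Finset.induction_on with
      | empty => exact ⟨∅, by simp⟩
      | insert a s ha ih =>
        rw [Finset.sum_insert ha]
        exact add _ _ (hf a (Finset.mem_insert_self a s))
          (ih fun i hi => hf i (Finset.mem_insert_of_mem hi))
    induction u using Finsupp.induction_linear with
    | zero => exact ⟨∅, by simp⟩
    | add x y hx hy => exact add x y hx hy
    | single x s =>
      rw [← A.b.linearCombination_repr s, Finsupp.linearCombination_apply, Finsupp.sum,
        ← Finsupp.singleAddHom_apply, map_sum]
      refine hsum _ _ _ fun α _ => ⟨{A.deg α + i₀}, ?_⟩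
      rw [Finset.sum_singleton, Finsupp.singleAddHom_apply, freeProj_single, if_pos rfl]
  p_b_smul α n x := by
    have : (A.freeProj X i₀ (A.deg α + n)).comp (DistribSMul.toAddMonoidHom _ (A.b α)) =
        (DistribSMul.toAddMonoidHom _ (A.b α)).comp (A.freeProj X i₀ n) :=
      A.free_hom_ext fun x t β => by
        simp only [AddMonoidHom.comp_apply, DistribSMul.toAddMonoidHom_apply]
        rw [freeProj_single, b_smul_single]
        cases h : A.mul β α with
        | none => split_ifs <;> simp [A.b_mul_b, h]
        | some γ =>
          simp only [Option.elim_some]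
          rw [freeProj_single]
          have : (A.deg γ + i₀ = A.deg α + n) ↔ (A.deg β + i₀ = n) := by
            rw [A.deg_mul h]; push_cast; omega
          simp only [this]
          split_ifs <;> simp [A.b_mul_b, h]
    exact DFunLike.congr_fun this x
  p_algebraMap_smul t n x := by
    have : (A.freeProj X i₀ n).comp (DistribSMul.toAddMonoidHom _ (algebraMap k S t)) =
        (DistribSMul.toAddMonoidHom _ (algebraMap k S t)).comp (A.freeProj X i₀ n) :=
      A.free_hom_ext fun x t' β => by
        simp only [AddMonoidHom.comp_apply, DistribSMul.toAddMonoidHom_apply]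
        have h : algebraMap k S t • Finsupp.single x (t' • A.b β) =
            Finsupp.single x ((t * t') • A.b β) := by
          rw [Finsupp.smul_single, smul_eq_mul, ← Algebra.smul_def, smul_smul]
        rw [freeProj_single, h, freeProj_single]
        split_ifs
        · rw [h]
        · rw [smul_zero]
    exact DFunLike.congr_fun this x

namespace Grading

variable {N : Type w} [AddCommGroup N] [Module S N] [Module k N] [IsScalarTower k S N]
  (G : A.Grading N)

theorem p_smul (t : k) (n : ℤ) (x : N) : G.p n (t • x) = t • G.p n x := by
  rw [← algebraMap_smul S t x, G.p_algebraMap_smul, algebraMap_smul]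

theorem b_smul_comm (t : k) (α : Q) (x : N) : A.b α • t • x = t • A.b α • x := by
  rw [← algebraMap_smul S t x, ← algebraMap_smul S t (A.b α • x), smul_smul, smul_smul,
    Algebra.commutes]

/-- The part of degree `i₀` of a graded module at an object `o`. -/
def component (i₀ : ℤ) (o : O) : Submodule k N where
  carrier := {x | G.p i₀ x = x ∧ A.b (A.idn o) • x = x}
  zero_mem' := by simp
  add_mem' := by
    rintro x y ⟨h1, h2⟩ ⟨h3, h4⟩
    exact ⟨by rw [map_add, h1, h3], by rw [smul_add, h2, h4]⟩
  smul_mem' := by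
    rintro t x ⟨h1, h2⟩
    exact ⟨by rw [p_smul, h1], by rw [b_smul_comm, h2]⟩

/-- The index set of a basis of the part of degree `i₀`. -/
abbrev CoverIndex (i₀ : ℤ) : Type w :=
  Σ o : O, Module.Basis.ofVectorSpaceIndex k (G.component i₀ o)

/-- The basis of the part of degree `i₀`. -/
def coverVec (i₀ : ℤ) (x : G.CoverIndex i₀) : N := (x.2.1 : N)

theorem p_coverVec (i₀ : ℤ) (x : G.CoverIndex i₀) :
    G.p i₀ (G.coverVec i₀ x) = G.coverVec i₀ x := x.2.1.2.1

theorem b_idn_smul_coverVec (i₀ : ℤ) (x : G.CoverIndex i₀) :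
    A.b (A.idn x.1) • G.coverVec i₀ x = G.coverVec i₀ x := x.2.1.2.2

theorem b_idn_mul_b_idn_of_ne {o o' : O} (h : o ≠ o') :
    A.b (A.idn o) * A.b (A.idn o') = 0 :=
  A.b_idn_mul_b_of_ne (by rw [A.tgt_idn]; exact h.symm)

/-- At a single object the vectors form a basis; different objects are separated by the orthogonal
idempotents. -/
theorem linearIndependent_coverVec (i₀ : ℤ) : LinearIndependent k (G.coverVec i₀) := by
  refine linearIndependent_iUnion_finite
    (f := fun (o : O) (x : Module.Basis.ofVectorSpaceIndex k (G.component i₀ o)) =>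
      ((x : G.component i₀ o) : N)) (fun o => ?_) fun o t _ ho => ?_
  · have h := (Module.Basis.ofVectorSpace k (G.component i₀ o)).linearIndependent
    have h' := h.map' (G.component i₀ o).subtype (Submodule.ker_subtype _)
    convert h' using 2 with x
    simp
  · rw [Submodule.disjoint_def]
    intro x hx hx'
    have h1 : x ∈ G.component i₀ o := by
      refine Submodule.span_le.2 ?_ hx
      rintro _ ⟨y, rfl⟩
      exact y.1.2
    let e : N →ₗ[k] N :=
      { toFun := fun x => A.b (A.idn o) • x
        map_add' := smul_add _
        map_smul' := fun t x => b_smul_comm t _ x }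
    have h2 : x ∈ LinearMap.ker e := by
      refine (iSup₂_le fun o' ho' => Submodule.span_le.2 ?_ :
        (⨆ i ∈ t, Submodule.span k _) ≤ LinearMap.ker e) hx'
      rintro _ ⟨y, rfl⟩
      have hne : o ≠ o' := by rintro rfl; exact ho ho'
      change A.b (A.idn o) • ((y : G.component i₀ o') : N) = 0
      rw [← y.1.2.2, smul_smul, b_idn_mul_b_idn_of_ne hne, zero_smul]
    rw [← h1.2]
    exact h2

/-- The projection of the free module onto the cover. -/
def coverRetract (i₀ : ℤ) : (G.CoverIndex i₀ →₀ S) →ₗ[S] (G.CoverIndex i₀ →₀ S) :=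
  Finsupp.linearCombination S fun x => Finsupp.single x (A.b (A.idn x.1))

theorem coverRetract_single (i₀ : ℤ) (x : G.CoverIndex i₀) (s : S) :
    G.coverRetract i₀ (Finsupp.single x s) = Finsupp.single x (s * A.b (A.idn x.1)) := by
  simp [coverRetract]

theorem coverRetract_apply (i₀ : ℤ) (f : G.CoverIndex i₀ →₀ S) (x : G.CoverIndex i₀) :
    G.coverRetract i₀ f x = f x * A.b (A.idn x.1) := by
  classical
  induction f using Finsupp.induction_linear with
  | zero => simp
  | add f g hf hg => simp only [map_add, Finsupp.add_apply, hf, hg, add_mul]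
  | single y s =>
    rw [coverRetract_single, Finsupp.single_apply, Finsupp.single_apply]
    split_ifs with h
    · rw [h]
    · rw [zero_mul]

theorem coverRetract_coverRetract (i₀ : ℤ) (f : G.CoverIndex i₀ →₀ S) :
    G.coverRetract i₀ (G.coverRetract i₀ f) = G.coverRetract i₀ f := by
  ext x
  rw [coverRetract_apply, coverRetract_apply, mul_assoc, A.b_idn_mul_b (A.tgt_idn _)]

theorem coverRetract_freeProj (i₀ n : ℤ) (f : G.CoverIndex i₀ →₀ S) :
    G.coverRetract i₀ (A.freeProj _ i₀ n f) = A.freeProj _ i₀ n (G.coverRetract i₀ f) := by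
  have : (G.coverRetract i₀).toAddMonoidHom.comp (A.freeProj _ i₀ n) =
      (A.freeProj _ i₀ n).comp (G.coverRetract i₀).toAddMonoidHom :=
    A.free_hom_ext fun x t β => by
      simp only [AddMonoidHom.comp_apply, LinearMap.toAddMonoidHom_coe]
      rw [freeProj_single, coverRetract_single, smul_mul_assoc]
      by_cases h : A.src β = x.1
      · rw [A.b_mul_b_idn h, freeProj_single]
        split_ifs
        · rw [coverRetract_single, smul_mul_assoc, A.b_mul_b_idn h]
        · rw [map_zero]
      · rw [A.b_mul_b_idn_of_ne h]
        split_ifs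
        · rw [coverRetract_single, smul_mul_assoc, A.b_mul_b_idn_of_ne h]
          simp
        · simp
  exact DFunLike.congr_fun this f

/-- The projective cover of a module generated in degree `i₀`. -/
def Cover (i₀ : ℤ) : Submodule S (G.CoverIndex i₀ →₀ S) := LinearMap.range (G.coverRetract i₀)

theorem mem_Cover {i₀ : ℤ} {f : G.CoverIndex i₀ →₀ S} :
    f ∈ G.Cover i₀ ↔ G.coverRetract i₀ f = f := by
  refine ⟨?_, fun h => ⟨f, h⟩⟩
  rintro ⟨f, rfl⟩
  exact G.coverRetract_coverRetract i₀ f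

theorem projective_Cover (i₀ : ℤ) : Module.Projective S (G.Cover i₀) :=
  Module.Projective.of_split (G.Cover i₀).subtype (G.coverRetract i₀).rangeRestrict
    (LinearMap.ext fun x => Subtype.ext (G.mem_Cover.1 x.2))

/-- The grading of the cover. -/
def coverGrading (i₀ : ℤ) : A.Grading (G.Cover i₀) :=
  (A.freeGrading (G.CoverIndex i₀) i₀).restrict (G.Cover i₀) fun n f hf => by
    rw [mem_Cover] at hf ⊢
    change G.coverRetract i₀ (A.freeProj _ i₀ n f) = A.freeProj _ i₀ n f
    rw [coverRetract_freeProj, hf]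

/-- The projection of the free module to the covered module. -/
def freeMap (i₀ : ℤ) : (G.CoverIndex i₀ →₀ S) →ₗ[S] N :=
  Finsupp.linearCombination S (G.coverVec i₀)

theorem freeMap_single (i₀ : ℤ) (x : G.CoverIndex i₀) (s : S) :
    G.freeMap i₀ (Finsupp.single x s) = s • G.coverVec i₀ x := by
  simp [freeMap]

theorem freeMap_freeProj (i₀ n : ℤ) (f : G.CoverIndex i₀ →₀ S) :
    G.freeMap i₀ (A.freeProj _ i₀ n f) = G.p n (G.freeMap i₀ f) := by
  have : (G.freeMap i₀).toAddMonoidHom.comp (A.freeProj _ i₀ n) =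
      (G.p n).comp (G.freeMap i₀).toAddMonoidHom :=
    A.free_hom_ext fun x t β => by
      simp only [AddMonoidHom.comp_apply, LinearMap.toAddMonoidHom_coe]
      rw [freeProj_single, freeMap_single, smul_assoc, p_smul, p_b_smul', 
        G.p_of_eq (G.p_coverVec i₀ x)]
      have h : (A.deg β + i₀ = n) ↔ (n - A.deg β = i₀) := by omega
      simp only [h]
      split_ifs
      · rw [freeMap_single, smul_assoc]
      · simp
  exact DFunLike.congr_fun this f

theorem single_mem_Cover {i₀ : ℤ} (x : G.CoverIndex i₀) :
    Finsupp.single x (A.b (A.idn x.1)) ∈ G.Cover i₀ := by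
  rw [mem_Cover, coverRetract_single, A.b_idn_mul_b (A.tgt_idn _)]

theorem freeProj_single_idn {i₀ : ℤ} (x : G.CoverIndex i₀) :
    A.freeProj _ i₀ i₀ (Finsupp.single x (A.b (A.idn x.1))) =
      Finsupp.single x (A.b (A.idn x.1)) := by
  have h := freeProj_single (A := A) i₀ i₀ x (1 : k) (A.idn x.1)
  rwa [one_smul, if_pos (by rw [A.deg_idn]; simp)] at h

theorem cover_generated (i₀ : ℤ) :
    Submodule.span S {x | (G.coverGrading i₀).p i₀ x = x} = ⊤ := by
  rw [eq_top_iff]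
  rintro ⟨f, hf⟩ _
  have h : f ∈ (Submodule.span S {x | (G.coverGrading i₀).p i₀ x = x}).map
      (G.Cover i₀).subtype := by
    rw [mem_Cover] at hf
    rw [← hf, coverRetract, Finsupp.linearCombination_apply, Finsupp.sum]
    refine sum_mem fun x _ => Submodule.smul_mem _ _ ?_
    exact ⟨⟨_, G.single_mem_Cover x⟩, Submodule.subset_span
      (Subtype.ext (G.freeProj_single_idn x)), rfl⟩
  obtain ⟨y, hy, hyf⟩ := h
  rwa [← (Subtype.ext hyf : y = ⟨f, hf⟩)]

/-- The idempotents sum to one, so an element of degree `i₀` is the sum of its parts at the various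
objects, and each part is a combination of the chosen basis there. -/
theorem cover_surjective {i₀ : ℤ} (hG : Submodule.span S {x | G.p i₀ x = x} = ⊤) :
    Function.Surjective ((G.freeMap i₀).domRestrict (G.Cover i₀)) := by
  rw [← LinearMap.range_eq_top, eq_top_iff, ← hG, Submodule.span_le]
  intro x hx
  set L := LinearMap.range ((G.freeMap i₀).domRestrict (G.Cover i₀))
  have hL : ∀ (o : O), G.component i₀ o ≤ L.restrictScalars k := by
    intro o y hy
    have h := (Module.Basis.ofVectorSpace k (G.component i₀ o)).linearCombination_repr ⟨y, hy⟩
    have h' := congrArg Subtype.val h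
    rw [Finsupp.linearCombination_apply, Finsupp.sum, AddSubmonoidClass.coe_finsetSum] at h'
    rw [← show _ = y from h']
    refine sum_mem fun z _ => Submodule.smul_mem _ _ ?_
    refine ⟨⟨_, G.single_mem_Cover ⟨o, z⟩⟩, ?_⟩
    rw [LinearMap.domRestrict_apply, freeMap_single, b_idn_smul_coverVec]
    simp [coverVec]
  have h1 : x = ∑ o, A.b (A.idn o) • x := by
    rw [← Finset.sum_smul, A.sum_idn, one_smul]
  rw [h1]
  refine sum_mem fun o _ => hL o ⟨?_, ?_⟩
  · rw [p_b_idn_smul, hx]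
  · rw [smul_smul, A.b_idn_mul_b (A.tgt_idn _)]

/-- The degree zero part of the algebra is spanned by orthogonal idempotents, so one of them cuts it
down to a line. This makes the degree `i₀` part of the cover a vector space on the generators. -/
theorem exists_eq_of_degProj (o : O) (s : S) :
    ∃ t : k, A.degProj 0 s * A.b (A.idn o) = t • A.b (A.idn o) := by
  rw [← A.b.linearCombination_repr s, Finsupp.linearCombination_apply, Finsupp.sum, map_sum,
    Finset.sum_mul]
  have h : ∀ β, ∃ t : k, A.degProj 0 (A.b.repr s β • A.b β) * A.b (A.idn o) =
      t • A.b (A.idn o) := by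
    intro β
    rw [map_smul, degProj_b]
    split_ifs with h
    · have hβ := A.eq_idn β (by exact_mod_cast h)
      by_cases ho : A.src β = o
      · rw [ho] at hβ
        refine ⟨A.b.repr s β, ?_⟩
        rw [smul_mul_assoc, A.b_mul_b_idn ho, ← hβ]
      · exact ⟨0, by rw [smul_mul_assoc, A.b_mul_b_idn_of_ne ho]; simp⟩
    · exact ⟨0, by simp⟩
  choose t ht using h
  exact ⟨∑ β ∈ (A.b.repr s).support, t β, by rw [Finset.sum_smul]; simp only [ht]⟩

theorem degProj_of_neg {n : ℤ} (hn : n < 0) : A.degProj n = 0 := by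
  refine A.b.ext fun β => ?_
  rw [degProj_b, if_neg (by omega), LinearMap.zero_apply]

/-- Below `i₀` the cover vanishes. In degree `i₀` an element is a combination of the generators with
coefficients in `k`, and its image is the same combination of linearly independent vectors. The
first syzygy thus starts one degree higher. -/
theorem cover_ker {i₀ n : ℤ} (hn : n < i₀ + 1) (x : G.Cover i₀)
    (hx : (G.freeMap i₀).domRestrict (G.Cover i₀) x = 0) : (G.coverGrading i₀).p n x = 0 := by
  suffices h : A.freeProj _ i₀ n (x : G.CoverIndex i₀ →₀ S) = 0 from Subtype.ext h
  obtain ⟨f, hf⟩ := x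
  rw [LinearMap.domRestrict_apply] at hx
  change A.freeProj (G.CoverIndex i₀) i₀ n f = 0
  rcases lt_or_eq_of_le (show n ≤ i₀ by omega) with h | rfl
  · rw [freeProj, degProj_of_neg (by omega)]
    ext x
    simp
  · have h1 : G.freeMap n (A.freeProj _ n n f) = 0 := by
      rw [freeMap_freeProj, hx, map_zero]
    have h2 : G.coverRetract n (A.freeProj _ n n f) = A.freeProj _ n n f := by
      rw [coverRetract_freeProj, G.mem_Cover.1 hf]
    have h3 : ∀ x, ∃ t : k, A.freeProj _ n n f x = t • A.b (A.idn x.1) := by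
      intro x
      rw [← h2, coverRetract_apply]
      have : A.freeProj _ n n f x = A.degProj 0 (f x) := by simp [freeProj]
      rw [this]
      exact exists_eq_of_degProj _ _
    choose t ht using h3
    generalize A.freeProj _ n n f = g at h1 ht
    have h4 : ∑ x ∈ g.support, t x • G.coverVec n x = 0 := by
      rw [← h1, freeMap, Finsupp.linearCombination_apply, Finsupp.sum]
      refine Finset.sum_congr rfl fun x _ => ?_
      rw [ht, smul_assoc, b_idn_smul_coverVec]
    have h5 := linearIndependent_iff'.1 (G.linearIndependent_coverVec n) _ _ h4
    ext x
    by_cases hx : x ∈ g.support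
    · rw [ht, h5 x hx]; simp
    · simpa using hx

end Grading

end Cover

end MonomialAlgebra

end

/-! ### Construction of a linear resolution from diagonal bar homology -/

noncomputable section

set_option linter.unusedSectionVars false

namespace MonomialAlgebra

variable {k : Type*} {S : Type w} {Q : Type*} {O : Type w} [Field k] [Ring S] [Algebra k S]
  [Fintype O] (A : MonomialAlgebra k S Q O)

/-- A graded module which vanishes below degree `i₀` and whose bar homology is concentrated in the
degrees `(i, i + i₀)`. -/
structure DiagonalModule (i₀ : ℤ) where
  /-- the module -/
  N : Type w
  [addCommGroup : AddCommGroup N]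
  [module : Module S N]
  /-- its grading -/
  G : A.Grading N
  bounded : ∀ n < i₀, ∀ x, G.p n x = 0
  exact : ∀ (i : ℕ) (j : ℤ), j ≠ i + i₀ → G.BarExact i j

attribute [instance] DiagonalModule.addCommGroup DiagonalModule.module

variable {A}

/-- A graded projective module generated in degree `i₀` that covers a graded module. -/
structure LinearCover {i₀ : ℤ} (M : A.DiagonalModule i₀) where
  /-- the covering module -/
  P : Type w
  [addCommGroup : AddCommGroup P]
  [module : Module S P]
  /-- its grading -/
  G : A.Grading P
  /-- the covering map -/
  π : P →ₗ[S] M.N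
  projective : Module.Projective S P
  generated : Submodule.span S {x | G.p i₀ x = x} = ⊤
  map_p : ∀ n x, π (G.p n x) = M.G.p n (π x)
  surjective : Function.Surjective π
  ker_bounded : ∀ n < i₀ + 1, ∀ x, π x = 0 → G.p n x = 0

attribute [instance] LinearCover.addCommGroup LinearCover.module

namespace DiagonalModule

theorem nonempty_linearCover {i₀ : ℤ} (M : A.DiagonalModule i₀) : Nonempty (LinearCover M) := by
  -- The cover uses bases over `k`; the vector space structure is the one restricted along the
  -- structure map of the algebra.
  let _ : Module k M.N := Module.compHom M.N (algebraMap k S)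
  have : IsScalarTower k S M.N := IsScalarTower.of_algebraMap_smul fun _ _ => rfl
  exact ⟨{
    P := M.G.Cover i₀
    G := M.G.coverGrading i₀
    π := (M.G.freeMap i₀).domRestrict (M.G.Cover i₀)
    projective := M.G.projective_Cover i₀
    generated := M.G.cover_generated i₀
    map_p := fun n x => M.G.freeMap_freeProj i₀ n x
    surjective := M.G.cover_surjective (M.G.generated_of_barExact_zero M.bounded
      fun j hj => M.exact 0 j (by simpa using hj))
    ker_bounded := fun n hn x hx => M.G.cover_ker hn x hx }⟩

/-- A chosen linear cover. -/
def cover {i₀ : ℤ} (M : A.DiagonalModule i₀) : LinearCover M := M.nonempty_linearCover.some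

theorem p_mem_ker {i₀ : ℤ} (M : A.DiagonalModule i₀) (n : ℤ) (x : M.cover.P)
    (hx : x ∈ LinearMap.ker M.cover.π) : M.cover.G.p n x ∈ LinearMap.ker M.cover.π := by
  rw [LinearMap.mem_ker] at hx ⊢
  rw [M.cover.map_p, hx, map_zero]

/-- The kernel of the linear cover. -/
def syzygy {i₀ : ℤ} (M : A.DiagonalModule i₀) : A.DiagonalModule (i₀ + 1) where
  N := LinearMap.ker M.cover.π
  G := M.cover.G.restrict (LinearMap.ker M.cover.π) M.p_mem_ker
  bounded n hn x := Subtype.ext (M.cover.ker_bounded n hn x x.2)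
  exact i j hj := by
    -- The cover has bar homology only at `(0, i₀)`. There the syzygy itself vanishes for degree
    -- reasons; everywhere else dimension shifting applies.
    by_cases h : i = 0 ∧ j = i₀
    · obtain ⟨rfl, rfl⟩ := h
      intro z hz hzj _
      refine ⟨0, zero_mem _, ?_⟩
      have h1 := DFunLike.congr_fun hzj []
      rw [Grading.barProj_apply, listDeg_nil, Nat.cast_zero, sub_zero] at h1
      have h2 : z [] = 0 :=
        h1.symm.trans (Subtype.ext (M.cover.ker_bounded j (by omega) _ (z []).2))
      rw [Grading.eq_single_of_mem_Bar_zero hz, h2, Finsupp.single_zero, map_zero]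
    have := M.cover.projective
    refine Grading.BarExact.syzygy_of_succ (GP := M.cover.G) (G := M.G)
      (ι := (LinearMap.ker M.cover.π).subtype) (π := M.cover.π) Subtype.val_injective
      M.cover.surjective (LinearMap.exact_subtype_ker_map M.cover.π) (fun _ _ => rfl)
      M.cover.map_p ?_ (M.exact (i + 1) j (by push_cast; omega))
    cases i with
    | succ i => exact Grading.barExact_of_projective i j
    | zero => exact M.cover.G.barExact_zero_of_generated M.cover.generated (by simpa using h)

/-- The iterated syzygies. -/
def syzygies (M : A.DiagonalModule 0) : (n : ℕ) → A.DiagonalModule (n : ℤ)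
  | 0 => M
  | n + 1 => (syzygies M n).syzygy

/-- The differential of the linear resolution. -/
def resolutionDiff (M : A.DiagonalModule 0) (n : ℕ) :
    (M.syzygies (n + 1)).cover.P →ₗ[S] (M.syzygies n).cover.P :=
  (LinearMap.ker (M.syzygies n).cover.π).subtype ∘ₗ (M.syzygies (n + 1)).cover.π

theorem resolutionDiff_p (M : A.DiagonalModule 0) (n : ℕ) (m : ℤ)
    (x : (M.syzygies (n + 1)).cover.P) :
    M.resolutionDiff n ((M.syzygies (n + 1)).cover.G.p m x) =
      (M.syzygies n).cover.G.p m (M.resolutionDiff n x) :=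
  congrArg Subtype.val ((M.syzygies (n + 1)).cover.map_p m x)

theorem range_resolutionDiff (M : A.DiagonalModule 0) (n : ℕ) :
    Set.range (M.resolutionDiff n) = LinearMap.ker (M.syzygies n).cover.π := by
  ext x
  constructor
  · rintro ⟨y, rfl⟩
    exact ((M.syzygies (n + 1)).cover.π y).2
  · intro hx
    obtain ⟨y, hy⟩ := (M.syzygies (n + 1)).cover.surjective ⟨x, hx⟩
    exact ⟨y, congrArg Subtype.val hy⟩

theorem exact_resolutionDiff_zero (M : A.DiagonalModule 0) :
    Function.Exact (M.resolutionDiff 0) (M.syzygies 0).cover.π := by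
  intro x
  rw [range_resolutionDiff]
  rfl

theorem exact_resolutionDiff (M : A.DiagonalModule 0) (n : ℕ) :
    Function.Exact (M.resolutionDiff (n + 1)) (M.resolutionDiff n) := by
  intro x
  rw [range_resolutionDiff]
  exact ⟨fun h => Subtype.ext h, fun h => congrArg Subtype.val h⟩

end DiagonalModule

end MonomialAlgebra

end

/-! ### Linear resolutions over a direct sum ring versus diagonal bar homology -/

noncomputable section

set_option linter.unusedSectionVars false

open scoped DirectSum

namespace MonomialAlgebra

section Conversion

variable {k : Type*} {R : ℕ → Type u} [∀ d, AddCommGroup (R d)] [DirectSum.GRing R]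
  {Q : Type*} {O : Type u} [Field k] [Algebra k (⨁ d, R d)] [Fintype O]
  {A : MonomialAlgebra k (⨁ d, R d) Q O}

variable (A) in
/-- The grading of a monomial algebra by degrees is the given one. -/
structure IsCompatible : Prop where
  b_eq : ∀ α, ∃ r : R (A.deg α), A.b α = DirectSum.of R (A.deg α) r
  degProj_of : ∀ (d : ℕ) (r : R d), A.degProj d (DirectSum.of R d r) = DirectSum.of R d r
  algebraMap_eq : ∀ t : k, ∃ r : R 0, algebraMap k (⨁ d, R d) t = DirectSum.of R 0 r

namespace Grading

variable {M : Type u} [AddCommGroup M] [Module (⨁ d, R d) M]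

/-- The homogeneous components of a grading. -/
def homog (G : A.Grading M) (n : ℤ) : AddSubgroup M := (G.p n).range

theorem mem_homog {G : A.Grading M} {n : ℤ} {x : M} : x ∈ G.homog n ↔ G.p n x = x := by
  refine ⟨?_, fun h => ⟨x, h⟩⟩
  rintro ⟨x, rfl⟩
  exact G.p_same n x

theorem isInternal_homog (G : A.Grading M) : DirectSum.IsInternal G.homog := by
  have key : ∀ (x : ⨁ n, G.homog n) (m : ℤ),
      G.p m (DirectSum.coeAddMonoidHom G.homog x) = x m := by
    intro x m
    induction x using DirectSum.induction_on with
    | zero => simp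
    | add x y hx hy => simp only [map_add, hx, hy, DirectSum.add_apply, AddSubgroup.coe_add]
    | of n x =>
      rw [DirectSum.coeAddMonoidHom_of, G.p_of_eq (mem_homog.1 x.2)]
      split_ifs with h
      · subst h; rw [DirectSum.of_eq_same]
      · rw [DirectSum.of_eq_of_ne _ _ _ h]; rfl
  constructor
  · rw [injective_iff_map_eq_zero]
    intro x hx
    refine DFinsupp.ext fun m => Subtype.ext ?_
    rw [← key, hx, map_zero]; rfl
  · intro x
    obtain ⟨s, hs⟩ := G.exists_sum x
    refine ⟨∑ n ∈ s, DirectSum.of (fun n => G.homog n) n ⟨G.p n x, x, rfl⟩, ?_⟩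
    rw [map_sum]
    simp only [DirectSum.coeAddMonoidHom_of, hs]

theorem p_degProj_smul (G : A.Grading M) (d n : ℤ) (s : ⨁ d, R d) {y : M} (hy : G.p n y = y) :
    G.p (d + n) (A.degProj d s • y) = A.degProj d s • y := by
  rw [← A.b.linearCombination_repr s, Finsupp.linearCombination_apply, Finsupp.sum, map_sum,
    Finset.sum_smul, map_sum]
  refine Finset.sum_congr rfl fun β _ => ?_
  rw [(A.degProj d).map_smul, degProj_b]
  split_ifs with h
  · rw [Algebra.smul_def, mul_smul, G.p_algebraMap_smul, ← h, G.p_b_smul, hy]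
  · simp

theorem isGradedModule_homog (hA : A.IsCompatible) (G : A.Grading M) :
    IsGradedModule R G.homog where
  isInternal := G.isInternal_homog
  smul_mem d r n m hm := by
    rw [mem_homog] at hm ⊢
    have h := G.p_degProj_smul d n (DirectSum.of R d r) hm
    rwa [hA.degProj_of] at h

/-- The projections of a graded module in the sense of `IsGradedModule`. -/
def ofIsGradedModule (hA : A.IsCompatible) {ℳ : ℤ → AddSubgroup M} (h : IsGradedModule R ℳ) :
    A.Grading M :=
  letI := h.isInternal.chooseDecomposition
  { p := fun n => {
      toFun := fun x => DirectSum.decompose ℳ x n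
      map_zero' := by simp
      map_add' := fun x y => by simp }
    p_same := fun n x => DirectSum.decompose_of_mem_same ℳ (SetLike.coe_mem _)
    p_ne := fun m n x hmn => DirectSum.decompose_of_mem_ne ℳ (SetLike.coe_mem _) hmn.symm
    exists_sum := fun x => by
      classical
      exact ⟨_, DirectSum.sum_support_decompose ℳ x⟩
    p_b_smul := fun α n x => by
      obtain ⟨r, hr⟩ := hA.b_eq α
      change (DirectSum.decompose ℳ (A.b α • x) (A.deg α + n) : M) =
        A.b α • (DirectSum.decompose ℳ x n : M)
      induction x using DirectSum.Decomposition.inductionOn ℳ with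
      | zero => simp
      | add x y hx hy => simp [hx, hy]
      | @homogeneous m x =>
        have hx : A.b α • (x : M) ∈ ℳ (A.deg α + m) := by
          rw [hr]; exact h.smul_mem _ r m x x.2
        by_cases hmn : m = n
        · subst hmn
          rw [DirectSum.decompose_of_mem_same ℳ hx, DirectSum.decompose_of_mem_same ℳ x.2]
        · rw [DirectSum.decompose_of_mem_ne ℳ hx (by omega),
            DirectSum.decompose_of_mem_ne ℳ x.2 hmn, smul_zero]
    p_algebraMap_smul := fun t n x => by
      obtain ⟨r, hr⟩ := hA.algebraMap_eq t
      change (DirectSum.decompose ℳ (algebraMap k (⨁ d, R d) t • x) n : M) =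
        algebraMap k (⨁ d, R d) t • (DirectSum.decompose ℳ x n : M)
      induction x using DirectSum.Decomposition.inductionOn ℳ with
      | zero => simp
      | add x y hx hy => simp [hx, hy]
      | @homogeneous m x =>
        have hx : algebraMap k (⨁ d, R d) t • (x : M) ∈ ℳ m := by
          rw [hr]; simpa using h.smul_mem 0 r m x x.2
        by_cases hmn : m = n
        · subst hmn
          rw [DirectSum.decompose_of_mem_same ℳ hx, DirectSum.decompose_of_mem_same ℳ x.2]
        · rw [DirectSum.decompose_of_mem_ne ℳ hx hmn,
            DirectSum.decompose_of_mem_ne ℳ x.2 hmn, smul_zero] }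

theorem ofIsGradedModule_p_eq (hA : A.IsCompatible) {ℳ : ℤ → AddSubgroup M}
    (h : IsGradedModule R ℳ) (n : ℤ) (x : M) :
    (ofIsGradedModule hA h).p n x = x ↔ x ∈ ℳ n := by
  let _ := h.isInternal.chooseDecomposition
  change (DirectSum.decompose ℳ x n : M) = x ↔ x ∈ ℳ n
  refine ⟨fun h => h ▸ SetLike.coe_mem _, DirectSum.decompose_of_mem_same ℳ⟩

/-- A linear map preserving homogeneous elements commutes with the projections. -/
theorem map_p_of_mem {M' : Type u} [AddCommGroup M'] [Module (⨁ d, R d) M'] {G : A.Grading M}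
    {G' : A.Grading M'} {f : M →ₗ[⨁ d, R d] M'}
    (h : ∀ n x, G.p n x = x → G'.p n (f x) = f x) (n : ℤ) (x : M) :
    f (G.p n x) = G'.p n (f x) := by
  obtain ⟨s, hs⟩ := G.exists_sum x
  conv_lhs => rw [← hs]
  conv_rhs => rw [← hs]
  simp only [map_sum]
  refine Finset.sum_congr rfl fun m _ => ?_
  rw [p_p, G'.p_of_eq (h m _ (G.p_same m x))]
  split_ifs <;> simp

end Grading

/-- A graded module which vanishes in negative degrees has a linear resolution if and only if its
bar homology is diagonal. -/
theorem nonempty_linearResolution_iff (hA : A.IsCompatible) {M : Type u} [AddCommGroup M]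
    [Module (⨁ d, R d) M] {ℳ : ℤ → AddSubgroup M} (G : A.Grading M)
    (hG : ∀ n x, G.p n x = x ↔ x ∈ ℳ n) (hb : ∀ n < 0, ∀ x, G.p n x = 0) :
    Nonempty (LinearResolution R ℳ) ↔ ∀ (i : ℕ) (j : ℤ), j ≠ i → G.BarExact i j := by
  constructor
  · rintro ⟨L⟩ i j hj
    let _ := L.addCommGroup
    let _ := L.module
    let GP : ∀ n, A.Grading (L.P n) := fun n => Grading.ofIsGradedModule hA (L.isGraded n)
    have hGP : ∀ n m x, (GP n).p m x = x ↔ x ∈ L.grading n m := fun n m x =>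
      Grading.ofIsGradedModule_p_eq hA (L.isGraded n) m x
    refine barExact_of_resolution i 0 L.P GP L.projective (fun n => ?_) L.diff (fun n => ?_)
      L.exact_diff M G L.aug ?_ L.aug_surjective L.exact_aug j (by simpa using hj)
    · rw [← L.generated n]
      congr 1
      ext x
      rw [Set.mem_ofPred_eq, hGP, add_zero]; rfl
    · exact Grading.map_p_of_mem fun m x hx =>
        (hGP _ _ _).2 (L.diff_mem n m x ((hGP _ _ _).1 hx))
    · exact Grading.map_p_of_mem fun m x hx =>
        (hG _ _).2 (L.aug_mem m x ((hGP _ _ _).1 hx))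
  · intro h
    let M₀ : A.DiagonalModule 0 :=
      { N := M, G := G, bounded := hb, exact := fun i j hj => h i j (by simpa using hj) }
    exact ⟨{
      P := fun n => (M₀.syzygies n).cover.P
      grading := fun n => (M₀.syzygies n).cover.G.homog
      isGraded := fun n => Grading.isGradedModule_homog hA _
      projective := fun n => (M₀.syzygies n).cover.projective
      generated := fun n => by
        rw [← (M₀.syzygies n).cover.generated]
        congr 1
        ext x
        exact Grading.mem_homog
      diff := M₀.resolutionDiff
      aug := (M₀.syzygies 0).cover.π
      diff_mem := fun n m x hx => by
        rw [Grading.mem_homog] at hx ⊢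
        rw [← M₀.resolutionDiff_p, hx]
      aug_mem := fun m x hx => by
        rw [Grading.mem_homog] at hx
        rw [← hG, ← hx]
        exact (congrArg (G.p m) ((M₀.syzygies 0).cover.map_p m x)).trans
          ((G.p_same _ _).trans ((M₀.syzygies 0).cover.map_p m x).symm)
      aug_surjective := (M₀.syzygies 0).cover.surjective
      exact_aug := M₀.exact_resolutionDiff_zero
      exact_diff := M₀.exact_resolutionDiff }⟩

end Conversion

end MonomialAlgebra

end

noncomputable section

set_option linter.unusedSectionVars false

/-! ## Sequential acyclicity in terms of relative chain complexes -/

namespace OrdComplex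

variable {V : Type u} [PartialOrder V]

open Classical in
/-- Induction on finite chains, adding new least elements. -/
theorem chain_induction {motive : Finset V → Prop} (empty : motive ∅)
    (insert : ∀ (a : V) (F : Finset V), (∀ b ∈ F, a < b) → IsChain (· ≤ ·) (F : Set V) →
      motive F → motive (insert a F)) (F : Finset V) (hF : IsChain (· ≤ ·) (F : Set V)) :
    motive F := by
  induction F using Finset.strongInduction with
  | H F ih =>
    rcases F.eq_empty_or_nonempty with rfl | hne
    · exact empty
    · obtain ⟨a, ha⟩ := F.exists_minimal hne
      have hlt : ∀ b ∈ F.erase a, a < b := by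
        intro b hb
        rw [Finset.mem_erase] at hb
        rcases hF ha.prop hb.2 hb.1.symm with h | h
        · exact lt_of_le_of_ne h hb.1.symm
        · exact absurd (le_antisymm h (ha.le_of_le hb.2 h)) hb.1
      have hc : IsChain (· ≤ ·) (F.erase a : Set V) :=
        hF.mono (Finset.coe_subset.2 (F.erase_subset a))
      rw [← Finset.insert_erase ha.prop]
      exact insert a _ hlt hc (ih _ (Finset.erase_ssubset ha.prop) hc)

section Boundary

variable (k : Type v) [Field k]

open Classical in
theorem boundary_single (F : Finset V) (t : k) :
    boundary k V (Finsupp.single F t) =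
      t • ∑ w ∈ F, Finsupp.single (F.erase w) ((-1 : k) ^ (F.filter (· < w)).card) := by
  rw [boundary, Finsupp.linearCombination_single]

open Classical in
/-- The cone operator on simplicial chains. -/
def cone (a : V) : (Finset V →₀ k) →ₗ[k] (Finset V →₀ k) := Finsupp.lmapDomain k k (insert a)

open Classical in
@[simp] theorem cone_single (a : V) (F : Finset V) (t : k) :
    cone k a (Finsupp.single F t) = Finsupp.single (insert a F) t := by
  simp [cone]

-- A new least vertex is omitted with sign `+1` and adds one to the number of vertices below each of
-- the others, hence the minus sign. This recursion matches the one of the bar differential along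
-- the first letter.
open Classical in
theorem boundary_single_insert {a : V} {F : Finset V} (h : ∀ b ∈ F, a < b) (t : k) :
    boundary k V (Finsupp.single (insert a F) t) =
      Finsupp.single F t - cone k a (boundary k V (Finsupp.single F t)) := by
  have ha : a ∉ F := fun h' => lt_irrefl a (h a h')
  rw [boundary_single, boundary_single, Finset.sum_insert ha, Finset.erase_insert ha, map_smul,
    map_sum, smul_add, sub_eq_add_neg]
  congr 1
  · have : (insert a F).filter (· < a) = ∅ := by
      rw [Finset.filter_eq_empty_iff]
      intro b hb
      rcases Finset.mem_insert.1 hb with rfl | hb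
      · exact lt_irrefl _
      · exact (h b hb).asymm
    rw [this]; simp
  · rw [← smul_neg, ← Finset.sum_neg_distrib]
    congr 1
    refine Finset.sum_congr rfl fun w hw => ?_
    have hne : a ≠ w := (h w hw).ne
    rw [cone_single, Finset.erase_insert_of_ne hne, Finset.filter_insert, if_pos (h w hw),
      Finset.card_insert_of_notMem (by simp [ha]), pow_succ, mul_neg_one, Finsupp.single_neg]

variable {k}

theorem boundary_cone {a : V} {u : Finset V →₀ k}
    (hu : u ∈ Finsupp.supported k k {F : Finset V | ∀ b ∈ F, a < b}) :
    boundary k V (cone k a u) = u - cone k a (boundary k V u) := by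
  rw [Finsupp.mem_supported] at hu
  rw [← Finsupp.sum_single u, Finsupp.sum]
  simp only [map_sum]
  rw [← Finset.sum_sub_distrib]
  refine Finset.sum_congr rfl fun F hF => ?_
  rw [cone_single, boundary_single_insert k (hu hF)]

open Classical in
theorem boundary_mem_supported {s t : Set (Finset V)} (h : ∀ F ∈ s, ∀ w ∈ F, F.erase w ∈ t)
    {u : Finset V →₀ k} (hu : u ∈ Finsupp.supported k k s) :
    boundary k V u ∈ Finsupp.supported k k t := by
  rw [Finsupp.mem_supported] at hu
  rw [← Finsupp.sum_single u, Finsupp.sum, map_sum]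
  refine sum_mem fun F hF => ?_
  rw [boundary_single]
  exact Submodule.smul_mem _ _ (sum_mem fun w hw =>
    Finsupp.single_mem_supported k _ (h F (hu hF) w hw))

theorem boundary_boundary_single (F : Finset V) (hF : IsChain (· ≤ ·) (F : Set V)) (t : k) :
    boundary k V (boundary k V (Finsupp.single F t)) = 0 := by
  classical
  refine chain_induction (motive := fun F => boundary k V (boundary k V (Finsupp.single F t)) = 0)
    (by simp [boundary_single]) (fun a F h hF ih => ?_) F hF
  · rw [boundary_single_insert k h, map_sub, boundary_cone, ih, map_zero, sub_zero, sub_self]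
    refine boundary_mem_supported (s := {F | ∀ b ∈ F, a < b}) ?_
      (Finsupp.single_mem_supported k _ h)
    exact fun F hF w _ b hb => hF b (Finset.mem_of_mem_erase hb)

theorem boundary_boundary {u : Finset V →₀ k}
    (hu : u ∈ Finsupp.supported k k {F : Finset V | IsChain (· ≤ ·) (F : Set V)}) :
    boundary k V (boundary k V u) = 0 := by
  rw [Finsupp.mem_supported] at hu
  rw [← Finsupp.sum_single u, Finsupp.sum, map_sum, map_sum]
  exact Finset.sum_eq_zero fun F hF => boundary_boundary_single F (hu hF) _

end Boundary

section Weight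

variable (k : Type v) [Field k] (Δ : OrdComplex V) (wt : Finset V → ℕ)

/-- The faces of weight `j` with `i` elements. -/
def weightFaces (i j : ℕ) : Set (Finset V) := {F | F ∈ Δ.faces ∧ F.card = i ∧ wt F = j}

/-- The faces of weight at least `j` with `i` elements. -/
def layerFaces (i j : ℕ) : Set (Finset V) := {F | F ∈ Δ.faces ∧ F.card = i ∧ j ≤ wt F}

/-- The part of weight `j` of a simplicial chain. -/
def weightPart (j : ℕ) : (Finset V →₀ k) →ₗ[k] (Finset V →₀ k) :=
  (Finsupp.supported k k {F | wt F = j}).subtype ∘ₗ Finsupp.restrictDom k k {F | wt F = j}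

theorem weightPart_apply (j : ℕ) (u : Finset V →₀ k) (F : Finset V) :
    weightPart k wt j u F = if wt F = j then u F else 0 := by
  classical
  simp [weightPart, Finsupp.restrictDom_apply, Finsupp.filter_apply]

/-- Vanishing of the homology of the complex of faces of weight exactly `j`, at the faces with `i`
elements. -/
def RelExact (i j : ℕ) : Prop :=
  ∀ z ∈ Finsupp.supported k k (weightFaces Δ wt i j), weightPart k wt j (boundary k V z) = 0 →
    ∃ w ∈ Finsupp.supported k k (weightFaces Δ wt (i + 1) j),
      weightPart k wt j (boundary k V w) = z

/-- Vanishing of the homology of the complex of faces of weight at least `j`, at the faces with `i`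
elements. -/
def LayerExact (i j : ℕ) : Prop :=
  ∀ z ∈ Finsupp.supported k k (layerFaces Δ wt i j), boundary k V z = 0 →
    ∃ w ∈ Finsupp.supported k k (layerFaces Δ wt (i + 1) j), boundary k V w = z

variable {k Δ wt}
variable (hwt : ∀ F ∈ Δ.faces, ∀ j : ℕ, (∃ G ∈ Δ.faces, F ⊆ G ∧ j ≤ G.card) ↔ j ≤ wt F)

theorem mem_supported_weightPart {i j : ℕ} {u : Finset V →₀ k}
    (hu : u ∈ Finsupp.supported k k (layerFaces Δ wt i j)) :
    weightPart k wt j u ∈ Finsupp.supported k k (weightFaces Δ wt i j) := by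
  rw [Finsupp.mem_supported'] at hu ⊢
  intro F hF
  rw [weightPart_apply]
  split_ifs with h
  · exact hu F fun h' => hF ⟨h'.1, h'.2.1, h⟩
  · rfl

theorem sub_weightPart_mem_supported {i j : ℕ} {u : Finset V →₀ k}
    (hu : u ∈ Finsupp.supported k k (layerFaces Δ wt i j)) :
    u - weightPart k wt j u ∈ Finsupp.supported k k (layerFaces Δ wt i (j + 1)) := by
  rw [Finsupp.mem_supported'] at hu ⊢
  intro F hF
  rw [Finsupp.sub_apply, weightPart_apply]
  split_ifs with h
  · exact sub_self _
  · rw [sub_zero]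
    exact hu F fun h' => hF ⟨h'.1, h'.2.1, lt_of_le_of_ne h'.2.2 (Ne.symm h)⟩

theorem weightPart_eq_zero {i j : ℕ} {u : Finset V →₀ k}
    (hu : u ∈ Finsupp.supported k k (layerFaces Δ wt i (j + 1))) : weightPart k wt j u = 0 := by
  rw [Finsupp.mem_supported'] at hu
  ext F
  rw [weightPart_apply, Finsupp.zero_apply]
  split_ifs with h
  · refine hu F fun h' => ?_
    have := h'.2.2
    omega
  · rfl

theorem weightPart_eq_self {i j : ℕ} {u : Finset V →₀ k}
    (hu : u ∈ Finsupp.supported k k (weightFaces Δ wt i j)) : weightPart k wt j u = u := by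
  rw [Finsupp.mem_supported'] at hu
  ext F
  rw [weightPart_apply]
  split_ifs with h
  · rfl
  · exact (hu F fun h' => h h'.2.2).symm

theorem weightFaces_subset_layerFaces (i j : ℕ) : weightFaces Δ wt i j ⊆ layerFaces Δ wt i j :=
  fun _ h => ⟨h.1, h.2.1, h.2.2.ge⟩

theorem layerFaces_succ_subset (i j : ℕ) : layerFaces Δ wt i (j + 1) ⊆ layerFaces Δ wt i j :=
  fun _ h => ⟨h.1, h.2.1, (Nat.le_succ j).trans h.2.2⟩

theorem boundary_boundary_of_layer {i j : ℕ} {u : Finset V →₀ k}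
    (hu : u ∈ Finsupp.supported k k (layerFaces Δ wt i j)) :
    boundary k V (boundary k V u) = 0 :=
  boundary_boundary (Finsupp.supported_mono (fun F hF => Δ.isChain F hF.1) hu)

include hwt

theorem wt_mono {F G : Finset V} (hG : G ∈ Δ.faces) (h : F ⊆ G) : wt G ≤ wt F := by
  obtain ⟨H, h1, h2, h3⟩ := (hwt G hG _).2 le_rfl
  exact (hwt F (Δ.down_closed G hG F h) _).1 ⟨H, h1, h.trans h2, h3⟩

theorem boundary_mem_layer {i j : ℕ} {u : Finset V →₀ k}
    (hu : u ∈ Finsupp.supported k k (layerFaces Δ wt (i + 1) j)) :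
    boundary k V u ∈ Finsupp.supported k k (layerFaces Δ wt i j) := by
  classical
  refine boundary_mem_supported (fun F hF w hw => ?_) hu
  obtain ⟨h1, h2, h3⟩ := hF
  refine ⟨Δ.down_closed F h1 _ (F.erase_subset w), ?_, h3.trans (wt_mono hwt h1 (F.erase_subset w))⟩
  rw [Finset.card_erase_of_mem hw, h2, Nat.add_sub_cancel]

/-- Exact sequence of the pair of layers: the boundary of a relative cycle `z` is a cycle of layer
`j + 1` on faces with one vertex less, so it is also the boundary of some `u` in that layer. Then `z
- u` is a cycle of layer `j`, and the weight `j` part of a filling fills `z`. -/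
theorem relExact_of_layerExact (h : ∀ i j : ℕ, i < j → LayerExact k Δ wt i j) {i j : ℕ}
    (hij : i < j) : RelExact k Δ wt i j := by
  intro z hz hz'
  have hzl := Finsupp.supported_mono (R := k) (weightFaces_subset_layerFaces i j) hz
  obtain ⟨u, hu, huz⟩ : ∃ u ∈ Finsupp.supported k k (layerFaces Δ wt i (j + 1)),
      boundary k V u = boundary k V z := by
    cases i with
    | zero =>
      refine ⟨0, zero_mem _, ?_⟩
      rw [map_zero, ← Finsupp.sum_single z, Finsupp.sum, map_sum]
      refine (Finset.sum_eq_zero fun F hF => ?_).symm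
      have := ((Finsupp.mem_supported k z).1 hz hF).2.1
      rw [Finset.card_eq_zero.1 this]
      simp [boundary_single]
    | succ i =>
      refine h i (j + 1) (by omega) _ ?_ (boundary_boundary_of_layer hzl)
      have := sub_weightPart_mem_supported (boundary_mem_layer hwt hzl)
      rwa [hz', sub_zero] at this
  obtain ⟨w, hw, hwz⟩ := h i j hij (z - u)
    (sub_mem hzl (Finsupp.supported_mono (layerFaces_succ_subset i j) hu))
    (by rw [map_sub, huz, sub_self])
  refine ⟨weightPart k wt j w, mem_supported_weightPart hw, ?_⟩
  have h1 := weightPart_eq_zero (boundary_mem_layer hwt (sub_weightPart_mem_supported hw))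
  rw [map_sub, map_sub, sub_eq_zero] at h1
  rw [← h1, hwz, map_sub, weightPart_eq_zero hu, sub_zero, weightPart_eq_self hz]

/-- Descending induction on `j`, starting above `B` where the layer is empty. The weight `j` part of
a cycle is a relative cycle; subtracting the boundary of a relative filling pushes the cycle into
layer `j + 1`. -/
theorem layerExact_of_relExact {B : ℕ} (hB : ∀ F ∈ Δ.faces, wt F ≤ B)
    (h : ∀ i j : ℕ, i < j → RelExact k Δ wt i j) {i j : ℕ} (hij : i < j) :
    LayerExact k Δ wt i j := by
  obtain ⟨m, hm⟩ : ∃ m, B + 1 ≤ j + m := ⟨B + 1, by omega⟩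
  induction m generalizing j with
  | zero =>
    intro z hz _
    refine ⟨0, zero_mem _, ?_⟩
    rw [map_zero]
    refine (Finsupp.mem_supported' k z |>.1 hz |> fun h => Finsupp.ext fun F => ?_)
    refine (h F fun hF => ?_).symm
    have h1 := hB F hF.1
    have h2 := hF.2.2
    omega
  | succ m ih =>
    intro z hz hz0
    have hzj := mem_supported_weightPart hz
    have hz' := sub_weightPart_mem_supported hz
    obtain ⟨w₁, hw₁, hwz₁⟩ := h i j hij (weightPart k wt j z) hzj (by
      cases i with
      | zero =>
        rw [← Finsupp.sum_single (weightPart k wt j z), Finsupp.sum, map_sum, map_sum]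
        refine Finset.sum_eq_zero fun F hF => ?_
        have := ((Finsupp.mem_supported k _).1 hzj hF).2.1
        rw [Finset.card_eq_zero.1 this]
        simp [boundary_single]
      | succ i =>
        have h1 := weightPart_eq_zero (boundary_mem_layer hwt hz')
        rw [map_sub, hz0, zero_sub, map_neg, neg_eq_zero] at h1
        exact h1)
    have hwl := Finsupp.supported_mono (R := k) (weightFaces_subset_layerFaces (i + 1) j) hw₁
    have h2 : z - boundary k V w₁ ∈ Finsupp.supported k k (layerFaces Δ wt i (j + 1)) := by
      have h3 := sub_weightPart_mem_supported (boundary_mem_layer hwt hwl)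
      rw [hwz₁] at h3
      have := sub_mem hz' h3
      rwa [sub_sub_sub_cancel_right] at this
    obtain ⟨w₂, hw₂, hwz₂⟩ := ih (j := j + 1) (by omega) (by omega) _ h2
      (by rw [map_sub, hz0, boundary_boundary_of_layer hwl, sub_zero])
    refine ⟨w₁ + w₂, add_mem hwl (Finsupp.supported_mono (layerFaces_succ_subset _ j) hw₂), ?_⟩
    rw [map_add, hwz₂, add_sub_cancel]

/-- Numbers of vertices replace dimensions, so both indices are one larger than in the definition,
and the layers become the faces of large weight by `hwt`. Beyond the dimension of `Δ` the layer has
no faces and exactness is automatic, which allows all `i < j` on the right. -/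
theorem isSequentiallyAcyclic_iff_layerExact :
    Δ.IsSequentiallyAcyclic k ↔ ∀ i j : ℕ, i < j → LayerExact k Δ wt i j := by
  have hchains : ∀ i j : ℕ, chains k (Δ.layer ((j : ℤ) - 1)) ((i : ℤ) - 1) =
      Finsupp.supported k k (layerFaces Δ wt i j) := by
    intro i j
    unfold chains
    congr 1
    ext F
    simp only [Set.mem_ofPred_eq, layer, layerFaces, faceDim]
    constructor
    · rintro ⟨⟨G, hG, hFG, hj⟩, hi⟩
      have hF := Δ.down_closed G hG F hFG
      exact ⟨hF, by omega, (hwt F hF j).1 ⟨G, hG, hFG, by omega⟩⟩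
    · rintro ⟨hF, hi, hj⟩
      obtain ⟨G, hG, hFG, hj⟩ := (hwt F hF j).2 hj
      exact ⟨⟨G, hG, hFG, by omega⟩, by omega⟩
  have key : ∀ i j : ℕ, Subsingleton (ReducedHomology k (Δ.layer ((j : ℤ) - 1)) ((i : ℤ) - 1)) ↔
      LayerExact k Δ wt i j := by
    intro i j
    have h1 : ((i : ℤ) - 1 + 1) = ((i + 1 : ℕ) : ℤ) - 1 := by push_cast; ring
    refine Submodule.Quotient.subsingleton_iff.trans ?_
    rw [Submodule.submoduleOf_eq_top, cycles, boundaries, h1, hchains, hchains]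
    constructor
    · intro h z hz hz0
      exact h ⟨hz, hz0⟩
    · rintro h z ⟨hz, hz0⟩
      exact h z hz hz0
  constructor
  · intro h i j hij
    by_cases hj : ∃ F ∈ Δ.faces, (j : ℤ) - 1 ≤ faceDim F
    · exact (key i j).1 (h _ _ (by omega) (by omega) hj)
    · intro z hz _
      refine ⟨0, zero_mem _, ?_⟩
      rw [map_zero]
      ext F
      refine ((Finsupp.mem_supported' k z).1 hz F fun hF => hj ?_).symm
      obtain ⟨G, hG, -, hjG⟩ := (hwt F hF.1 j).2 hF.2.2
      exact ⟨G, hG, by unfold faceDim; omega⟩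
  · intro h i j hi hij _
    have h1 := (key (i + 1).toNat (j + 1).toNat).2 (h _ _ (by omega))
    rwa [Int.toNat_of_nonneg (by omega), Int.toNat_of_nonneg (by omega), add_sub_cancel_right,
      add_sub_cancel_right] at h1

/-- Sequential acyclicity in terms of the faces of a given weight, the weight of a face being the
maximal number of elements of a face containing it. -/
theorem isSequentiallyAcyclic_iff_relExact {B : ℕ} (hB : ∀ F ∈ Δ.faces, wt F ≤ B) :
    Δ.IsSequentiallyAcyclic k ↔ ∀ i j : ℕ, i < j → RelExact k Δ wt i j := by
  rw [isSequentiallyAcyclic_iff_layerExact hwt]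
  exact ⟨fun h _ _ hij => relExact_of_layerExact hwt h hij,
    fun h _ _ hij => layerExact_of_relExact hwt hB h hij⟩

end Weight

end OrdComplex

end

noncomputable section

set_option linter.unusedSectionVars false

open scoped DirectSum

/-! ## The category of interval classes -/

namespace RedIncAlg

section Category

variable {P : Type u} [PartialOrder P] {s : Setoid (NonemptyInterval P)}

open Classical in
/-- The composite of two classes of intervals. -/
def comp (α β : Quotient s) : Option (Quotient s) :=
  if h : ∃ γ : Quotient s, ∃ (x y z : P) (hxy : x ≤ y) (hyz : y ≤ z),
      cls s hxy = α ∧ cls s hyz = β ∧ cls s (hxy.trans hyz) = γ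
  then some h.choose else none

theorem exists_cls (α : Quotient s) : ∃ (x y : P) (h : x ≤ y), cls s h = α := by
  obtain ⟨⟨⟨x, y⟩, h⟩, rfl⟩ := Quotient.exists_rep α
  exact ⟨x, y, h, rfl⟩

/-- A class of intervals with more than one point. -/
def Nonid (α : Quotient s) : Prop := ∀ x : P, α ≠ cls s (le_refl x)

variable [IntervalAxioms s]

theorem comp_cls {x y z : P} (hxy : x ≤ y) (hyz : y ≤ z) :
    comp (cls s hxy) (cls s hyz) = some (cls s (hxy.trans hyz)) := by
  have h : ∃ γ : Quotient s, ∃ (x' y' z' : P) (hxy' : x' ≤ y') (hyz' : y' ≤ z'),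
      cls s hxy' = cls s hxy ∧ cls s hyz' = cls s hyz ∧ cls s (hxy'.trans hyz') = γ :=
    ⟨_, x, y, z, hxy, hyz, rfl, rfl, rfl⟩
  rw [comp, dif_pos h]
  obtain ⟨x', y', z', hxy', hyz', h₁', h₂', h₃'⟩ := h.choose_spec
  rw [← h₃']
  exact congrArg some (Quotient.sound (IntervalAxioms.order_compatible _ _ _ _
    (Quotient.exact h₁') (Quotient.exact h₂')))

theorem comp_eq_some {α β γ : Quotient s} : comp α β = some γ ↔
    ∃ (x y z : P) (hxy : x ≤ y) (hyz : y ≤ z),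
      cls s hxy = α ∧ cls s hyz = β ∧ cls s (hxy.trans hyz) = γ := by
  constructor
  · intro h
    by_cases h' : ∃ γ : Quotient s, ∃ (x y z : P) (hxy : x ≤ y) (hyz : y ≤ z),
      cls s hxy = α ∧ cls s hyz = β ∧ cls s (hxy.trans hyz) = γ
    · rw [comp, dif_pos h', Option.some.injEq] at h
      rw [← h]
      exact h'.choose_spec
    · rw [comp, dif_neg h'] at h
      cases h
  · rintro ⟨x, y, z, hxy, hyz, rfl, rfl, rfl⟩
    exact comp_cls hxy hyz

theorem xiMul_eq_elim (k : Type v) [Field k] (α β : Quotient s) :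
    xiMul k α β = (comp α β).elim 0 (xi k) := by
  cases h : comp α β with
  | some γ =>
    obtain ⟨x, y, z, hxy, hyz, rfl, rfl, rfl⟩ := comp_eq_some.1 h
    exact xiMul_eq hxy hyz rfl rfl
  | none =>
    refine xiMul_eq_zero ?_
    rintro ⟨x, y, z, hxy, hyz, rfl, rfl⟩
    rw [comp_cls] at h
    cases h

/-- A factorization of the class of an interval is realized by a point of the interval. -/
theorem exists_mem_of_comp {α β : Quotient s} {x z : P} {h : x ≤ z}
    (e : comp α β = some (cls s h)) : ∃ (y : P) (hxy : x ≤ y) (hyz : y ≤ z),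
      cls s hxy = α ∧ cls s hyz = β := by
  obtain ⟨x', y', z', hxy, hyz, rfl, rfl, e'⟩ := comp_eq_some.1 e
  exact exists_transport hxy hyz h e'

/-- A point of an interval is determined by the classes of its two parts. -/
theorem eq_of_cls_eq {x y y' z : P} (hxy : x ≤ y) (hyz : y ≤ z) (hxy' : x ≤ y') (hyz' : y' ≤ z)
    (h₁ : cls s hxy = cls s hxy') (h₂ : cls s hyz = cls s hyz') : y = y' := by
  classical
  obtain ⟨σ, -, hσ⟩ := IntervalAxioms.invariance (hxy.trans hyz) (hxy.trans hyz) (s.refl _)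
  have h3 : (fun w => w) = σ := hσ _ fun w => ⟨s.refl _, s.refl _⟩
  -- Sending `y` to `y'` and fixing every other point also satisfies the condition in the invariance
  -- axiom, so uniqueness makes this map the identity.
  have h4 : (fun w : Set.Icc x z => if (w : P) = y then (⟨y', hxy', hyz'⟩ : Set.Icc x z) else w) =
      σ := by
    refine hσ _ fun w => ?_
    obtain ⟨w, hw1, hw2⟩ := w
    by_cases h : w = y
    · subst h
      simp only [if_true]
      exact ⟨Quotient.exact h₁, Quotient.exact h₂⟩
    · simp only [if_neg h]
      exact ⟨s.refl _, s.refl _⟩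
  have h5 := congrFun (h3.trans h4.symm) ⟨y, hxy, hyz⟩
  simpa using congrArg Subtype.val h5

theorem nonid_cls {x y : P} (h : x ≤ y) : Nonid (cls s h) ↔ x < y := by
  constructor
  · intro h'
    refine lt_of_le_of_ne h ?_
    rintro rfl
    exact h' x rfl
  · intro h' z hz
    exact h'.ne (eq_of_cls_eq_refl h hz)

/-- The source of a class of intervals. -/
def srcCls : Quotient s → Quotient s :=
  Quotient.lift (fun i : NonemptyInterval P => cls s (le_refl i.fst)) fun i j h =>
    cls_left_eq (s := s) i.fst_le_snd j.fst_le_snd (Quotient.sound h)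

/-- The target of a class of intervals. -/
def tgtCls : Quotient s → Quotient s :=
  Quotient.lift (fun i : NonemptyInterval P => cls s (le_refl i.snd)) fun i j h =>
    cls_right_eq (s := s) i.fst_le_snd j.fst_le_snd (Quotient.sound h)

@[simp] theorem srcCls_cls {x y : P} (h : x ≤ y) : srcCls (cls s h) = cls s (le_refl x) := rfl

@[simp] theorem tgtCls_cls {x y : P} (h : x ≤ y) : tgtCls (cls s h) = cls s (le_refl y) := rfl

/-- The concatenation axiom realizes two classes with matching ends by consecutive intervals, so
mismatched ends are the only obstruction to composing. -/
theorem comp_eq_none {α β : Quotient s} : comp α β = none ↔ tgtCls α ≠ srcCls β := by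
  obtain ⟨x, y, hxy, rfl⟩ := exists_cls α
  obtain ⟨y', z, hyz, rfl⟩ := exists_cls β
  constructor
  · intro h e
    obtain ⟨x₁, y₁, z₁, h₁, h₂, h₃, h₄⟩ :=
      IntervalAxioms.concatenation hxy hyz (Quotient.exact e)
    have h₃ : cls s h₁ = cls s hxy := Quotient.sound h₃
    have h₄ : cls s h₂ = cls s hyz := Quotient.sound h₄
    rw [← h₃, ← h₄, comp_cls] at h
    cases h
  · intro h
    by_contra h'
    obtain ⟨γ, hγ⟩ := Option.ne_none_iff_exists'.1 h'
    obtain ⟨x₁, y₁, z₁, h₁, h₂, h₃, h₄, -⟩ := comp_eq_some.1 hγ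
    rw [← h₃, ← h₄] at h
    exact h rfl

theorem srcCls_comp {α β γ : Quotient s} (h : comp α β = some γ) : srcCls γ = srcCls α := by
  obtain ⟨x, y, z, hxy, hyz, rfl, rfl, rfl⟩ := comp_eq_some.1 h
  rfl

theorem tgtCls_comp {α β γ : Quotient s} (h : comp α β = some γ) : tgtCls γ = tgtCls β := by
  obtain ⟨x, y, z, hxy, hyz, rfl, rfl, rfl⟩ := comp_eq_some.1 h
  rfl

theorem tgtCls_eq_srcCls {α β γ : Quotient s} (h : comp α β = some γ) : tgtCls α = srcCls β := by
  obtain ⟨x, y, z, hxy, hyz, rfl, rfl, rfl⟩ := comp_eq_some.1 h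
  rfl

theorem srcCls_comp_self (α : Quotient s) : comp (srcCls α) α = some α := by
  obtain ⟨x, y, hxy, rfl⟩ := exists_cls α
  exact comp_cls (le_refl x) hxy

theorem comp_tgtCls_self (α : Quotient s) : comp α (tgtCls α) = some α := by
  obtain ⟨x, y, hxy, rfl⟩ := exists_cls α
  exact comp_cls hxy (le_refl y)

theorem eq_srcCls_of_not_nonid {α : Quotient s} (h : ¬ Nonid α) : α = srcCls α := by
  simp only [Nonid, not_forall, not_not] at h
  obtain ⟨x, rfl⟩ := h
  rfl

end Category

/-! ## Monomial modules and their associated graded modules -/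

section Monomial

variable {P : Type u} [PartialOrder P] (s : Setoid (NonemptyInterval P)) [IntervalAxioms s]
  (k : Type v) [Field k]

/-- A right module over the reduced incidence algebra with a `k`-basis indexed by some of the
classes of intervals, on which the monomials act by composition. -/
structure MonomialModule (X N : Type*) [AddCommGroup N] [Module (RedIncAlg k s)ᵐᵒᵖ N] [Module k N]
    where
  /-- the basis -/
  b : Module.Basis X k N
  /-- the class of intervals corresponding to a basis element -/
  cl : X → Quotient s
  /-- the action of the monomials on the basis -/
  act : X → Quotient s → Option X
  xi_smul : ∀ x β, MulOpposite.op (xi k β) • b x = (act x β).elim 0 b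
  comp_cl : ∀ x β, comp (cl x) β = (act x β).map cl

variable {s k}

theorem mem_positiveIdeal {a : RedIncAlg k s} :
    a ∈ positiveIdeal k s ↔ a ∈ Submodule.span k (xi k '' {β : Quotient s | Nonid β}) := by
  have h : xi k '' {β : Quotient s | Nonid β} =
      {a | ∃ (x y : P) (h : x < y), a = xi k (cls s h.le)} := by
    ext a
    constructor
    · rintro ⟨β, hβ, rfl⟩
      obtain ⟨x, y, hxy, rfl⟩ := exists_cls β
      exact ⟨x, y, (nonid_cls hxy).1 hβ, rfl⟩
    · rintro ⟨x, y, hxy, rfl⟩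
      exact ⟨_, (nonid_cls hxy.le).2 hxy, rfl⟩
  rw [h]
  exact TwoSidedIdeal.mem_mk' _ _ _ _ _ _ a

variable (k s) in
/-- The ideal `I` in the opposite ring. -/
abbrev opIdeal : Ideal (RedIncAlg k s)ᵐᵒᵖ := TwoSidedIdeal.asIdealOpposite (positiveIdeal k s)

theorem op_mem_opIdeal {a : RedIncAlg k s} :
    MulOpposite.op a ∈ opIdeal s k ↔ a ∈ positiveIdeal k s := by
  rw [opIdeal, TwoSidedIdeal.mem_asIdealOpposite, MulOpposite.unop_op]

namespace MonomialModule

variable {X N : Type*} [AddCommGroup N] [Module (RedIncAlg k s)ᵐᵒᵖ N] [Module k N]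
  [IsScalarTower k (RedIncAlg k s)ᵐᵒᵖ N] (m : MonomialModule s k X N)

/-- The basis elements in the `d`-th step of the `I`-adic filtration. -/
def level : ℕ → Set X
  | 0 => Set.univ
  | d + 1 => {x | ∃ x' ∈ level d, ∃ β, Nonid β ∧ m.act x' β = some x}

theorem level_succ_subset (d : ℕ) : m.level (d + 1) ⊆ m.level d := by
  induction d with
  | zero => exact Set.subset_univ _
  | succ d ih =>
    rintro x ⟨x', hx', β, hβ, h⟩
    exact ⟨x', ih hx', β, hβ, h⟩

theorem level_antitone : Antitone m.level := antitone_nat_of_succ_le m.level_succ_subset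

/-- The ideal is spanned by non-identity monomials, and these send basis elements to basis elements
or to zero. The filtration is therefore spanned by basis elements at every step. -/
theorem mem_adicFiltration (d : ℕ) (n : N) :
    n ∈ adicFiltration (opIdeal s k) N d ↔ n ∈ Submodule.span k (m.b '' m.level d) := by
  induction d generalizing n with
  | zero =>
    simp [adicFiltration, level, Submodule.pow_zero, m.b.span_eq]
  | succ d ih =>
    have h0 : adicFiltration (opIdeal s k) N (d + 1) =
        opIdeal s k • adicFiltration (opIdeal s k) N d := by
      rw [adicFiltration, adicFiltration, Nat.add_comm, Ideal.IsTwoSided.pow_add, Submodule.mul_smul,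
        Submodule.pow_one]
    rw [h0]
    constructor
    · intro hn
      refine Submodule.smul_induction_on hn (fun r hr n hn => ?_) fun _ _ => add_mem
      rw [ih] at hn
      obtain ⟨a, rfl⟩ := MulOpposite.op_surjective r
      rw [op_mem_opIdeal, mem_positiveIdeal] at hr
      induction hr using Submodule.span_induction with
      | zero => simp
      | add a a' _ _ h h' => rw [MulOpposite.op_add, add_smul]; exact add_mem h h'
      | smul t a _ h => rw [MulOpposite.op_smul, smul_assoc]; exact Submodule.smul_mem _ t h
      | mem a ha =>
        obtain ⟨β, hβ, rfl⟩ := ha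
        induction hn using Submodule.span_induction with
        | zero => simp
        | add n n' _ _ h h' => rw [smul_add]; exact add_mem h h'
        | smul t n _ h => rw [smul_comm]; exact Submodule.smul_mem _ t h
        | mem n hn =>
          obtain ⟨x, hx, rfl⟩ := hn
          rw [m.xi_smul]
          cases h : m.act x β with
          | none => exact zero_mem _
          | some y => exact Submodule.subset_span ⟨y, ⟨x, hx, β, hβ, h⟩, rfl⟩
    · intro hn
      induction hn using Submodule.span_induction with
      | zero => exact zero_mem _
      | add n n' _ _ h h' => exact add_mem h h'
      | smul t n _ h =>
        rw [← algebraMap_smul (RedIncAlg k s)ᵐᵒᵖ t n]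
        exact Submodule.smul_mem _ _ h
      | mem n hn =>
        obtain ⟨x, ⟨x', hx', β, hβ, h⟩, rfl⟩ := hn
        have h1 : m.b x = MulOpposite.op (xi k β) • m.b x' := by rw [m.xi_smul, h]; rfl
        rw [h1]
        refine Submodule.smul_mem_smul ?_ ((ih _).2 (Submodule.subset_span ⟨x', hx', rfl⟩))
        rw [op_mem_opIdeal, mem_positiveIdeal]
        exact Submodule.subset_span ⟨β, hβ, rfl⟩

section Finite

/-- Each step of the filtration splits off a non-identity factor on the right, which strictly
shrinks the interval. Local finiteness then bounds the number of steps, so every basis element has a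
finite rank. -/
theorem level_lt_ncard (hfin : ∀ x y : P, (Set.Icc x y).Finite) (d : ℕ) {x : X}
    (hx : x ∈ m.level d) {u v : P} (huv : u ≤ v) (h : cls s huv = m.cl x) :
    d < (Set.Icc u v).ncard := by
  induction d generalizing x u v with
  | zero => exact (Set.ncard_pos (hfin u v)).2 ⟨u, le_rfl, huv⟩
  | succ d ih =>
    obtain ⟨x', hx', β, hβ, hact⟩ := hx
    have hc := m.comp_cl x' β
    rw [hact, Option.map_some, ← h] at hc
    obtain ⟨w, huw, hwv, h1, h2⟩ := exists_mem_of_comp hc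
    have hlt : w < v := (nonid_cls hwv).1 (h2 ▸ hβ)
    refine lt_of_le_of_lt (ih hx' huw h1) (Set.ncard_lt_ncard ⟨?_, fun h => ?_⟩ (hfin u v))
    · exact Set.Icc_subset_Icc_right hwv
    · exact hlt.not_ge (h ⟨huv, le_rfl⟩).2

theorem exists_notMem_level (hfin : ∀ x y : P, (Set.Icc x y).Finite) (x : X) :
    ∃ d, x ∉ m.level (d + 1) := by
  obtain ⟨u, v, huv, h⟩ := exists_cls (m.cl x)
  refine ⟨(Set.Icc u v).ncard, fun hx => ?_⟩
  have := m.level_lt_ncard hfin _ hx huv h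
  omega

open Classical in
/-- The step of the `I`-adic filtration at which a basis element disappears. -/
def rk (hfin : ∀ x y : P, (Set.Icc x y).Finite) (x : X) : ℕ := Nat.find (m.exists_notMem_level hfin x)

variable (hfin : ∀ x y : P, (Set.Icc x y).Finite)

theorem mem_level_iff (d : ℕ) (x : X) : x ∈ m.level d ↔ d ≤ m.rk hfin x := by
  classical
  constructor
  · intro hx
    by_contra h
    exact Nat.find_spec (m.exists_notMem_level hfin x) (m.level_antitone (by
      rw [not_le] at h; exact h) hx)
  · intro h
    cases d with
    | zero => trivial
    | succ d => exact not_not.1 (Nat.find_min (m.exists_notMem_level hfin x) h)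

theorem b_mem_adicFiltration {d : ℕ} {x : X} (h : d ≤ m.rk hfin x) :
    m.b x ∈ adicFiltration (opIdeal s k) N d :=
  (m.mem_adicFiltration d _).2 (Submodule.subset_span ⟨x, (m.mem_level_iff hfin d x).2 h, rfl⟩)

theorem le_rk_of_mem {d : ℕ} {x : X} (h : m.b x ∈ adicFiltration (opIdeal s k) N d) :
    d ≤ m.rk hfin x := by
  rw [mem_adicFiltration, m.b.mem_span_image] at h
  have hx : x ∈ (m.b.repr (m.b x)).support := by simp
  exact (m.mem_level_iff hfin d x).1 (h hx)

end Finite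

end MonomialModule

end Monomial

end RedIncAlg

/-! ## The vector space structure on associated graded modules -/

section GrModule

variable {k : Type*} [Field k] {B : Type u} [Ring B] [Algebra k B] (I : Ideal B)

instance grPieceModule (M : Type v) [AddCommGroup M] [Module B M] [Module k M]
    [IsScalarTower k B M] (d : ℕ) : Module k (GrPiece I M d) :=
  inferInstanceAs (Module k
    (adicFiltration I M d ⧸ (adicFiltration I M (d + 1)).submoduleOf (adicFiltration I M d)))

section

variable {M : Type v} [AddCommGroup M] [Module B M] [Module k M] [IsScalarTower k B M]

theorem grMk_smul (d : ℕ) (t : k) (a : adicFiltration I M d) :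
    grMk I d (t • a) = t • grMk I d a := rfl

variable [I.IsTwoSided]

theorem smul_grSMul {i j : ℕ} (t : k) (a : GrPiece I B i) (m : GrPiece I M j) :
    grSMul I (t • a) m = t • grSMul I a m := by
  obtain ⟨a, rfl⟩ := grMk_surjective I i a
  obtain ⟨m, rfl⟩ := grMk_surjective I j m
  rw [← grMk_smul, grSMul_mk, grSMul_mk, ← grMk_smul]
  exact congrArg _ (Subtype.ext (smul_assoc t (a : B) (m : M)))

theorem grSMul_smul {i j : ℕ} (t : k) (a : GrPiece I B i) (m : GrPiece I M j) :
    grSMul I a (t • m) = t • grSMul I a m := by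
  obtain ⟨a, rfl⟩ := grMk_surjective I i a
  obtain ⟨m, rfl⟩ := grMk_surjective I j m
  rw [← grMk_smul, grSMul_mk, grSMul_mk, ← grMk_smul]
  exact congrArg _ (Subtype.ext (smul_comm (a : B) t (m : M)))

theorem of_smul_of_gr {i j : ℕ} (a : GrPiece I B i) (m : GrPiece I M j) :
    DirectSum.of (GrPiece I B) i a • DirectSum.of (GrPiece I M) j m =
      DirectSum.of (GrPiece I M) (i + j) (grSMul I a m) :=
  DirectSum.Gmodule.of_smul_of (A := GrPiece I B) (M := GrPiece I M) a m

theorem smul_of_gr {d : ℕ} (t : k) (m : GrPiece I M d) :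
    t • DirectSum.of (GrPiece I M) d m = DirectSum.of (GrPiece I M) d (t • m) :=
  (DirectSum.of_smul k (M := GrPiece I M) d t m).symm

end

end GrModule

end

/-! ### Bases and products in the associated graded algebra and modules -/

noncomputable section

set_option linter.unusedSectionVars false

open scoped DirectSum

section GrAlgebra

variable {k : Type*} [Field k] {B : Type u} [Ring B] [Algebra k B] (I : Ideal B) [I.IsTwoSided]
  {M : Type v} [AddCommGroup M] [Module B M] [Module k M] [IsScalarTower k B M]

theorem gr_smul_assoc (t : k) (a : ⨁ d, GrPiece I B d) (m : ⨁ d, GrPiece I M d) :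
    (t • a) • m = t • a • m := by
  induction a using DirectSum.induction_on with
  | zero => simp
  | add a a' h h' => rw [smul_add, add_smul, h, h', add_smul, smul_add]
  | of i a =>
    induction m using DirectSum.induction_on with
    | zero => simp
    | add m m' h h' => rw [smul_add, h, h', smul_add, smul_add]
    | of j m => rw [smul_of_gr, of_smul_of_gr, of_smul_of_gr, smul_of_gr, smul_grSMul]

theorem of_gr_mul_of_gr {i j : ℕ} (a : GrPiece I B i) (b : GrPiece I B j) :
    DirectSum.of (GrPiece I B) i a * DirectSum.of (GrPiece I B) j b =
      DirectSum.of (GrPiece I B) (i + j) (grSMul I a b) :=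
  DirectSum.of_mul_of a b

theorem gr_smul_mul_assoc (t : k) (a b : ⨁ d, GrPiece I B d) : (t • a) * b = t • (a * b) := by
  induction a using DirectSum.induction_on with
  | zero => simp
  | add a a' h h' => rw [smul_add, add_mul, h, h', add_mul, smul_add]
  | of i a =>
    induction b using DirectSum.induction_on with
    | zero => simp
    | add m m' h h' => rw [mul_add, h, h', mul_add, smul_add]
    | of j m => rw [smul_of_gr, of_gr_mul_of_gr, of_gr_mul_of_gr, smul_of_gr, smul_grSMul]

theorem gr_mul_smul_comm (t : k) (a b : ⨁ d, GrPiece I B d) : a * (t • b) = t • (a * b) := by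
  induction a using DirectSum.induction_on with
  | zero => simp
  | add a a' h h' => rw [add_mul, h, h', add_mul, smul_add]
  | of i a =>
    induction b using DirectSum.induction_on with
    | zero => simp
    | add m m' h h' => rw [smul_add, mul_add, h, h', mul_add, smul_add]
    | of j m => rw [smul_of_gr, of_gr_mul_of_gr, of_gr_mul_of_gr, smul_of_gr, grSMul_smul]

instance grAlgebra : Algebra k (⨁ d, GrPiece I B d) :=
  Algebra.ofModule (gr_smul_mul_assoc I) (gr_mul_smul_comm I)

instance gr_isScalarTower : IsScalarTower k (⨁ d, GrPiece I B d) (⨁ d, GrPiece I M d) :=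
  ⟨gr_smul_assoc I⟩

variable {I} in
theorem of_grMk_congr {d e : ℕ} (h : d = e) {x : M} (hd : x ∈ adicFiltration I M d)
    (he : x ∈ adicFiltration I M e) :
    DirectSum.of (GrPiece I M) d (grMk I d ⟨x, hd⟩) =
      DirectSum.of (GrPiece I M) e (grMk I e ⟨x, he⟩) := by
  subst h; rfl

variable {I} in
theorem of_grMk_eq_zero {d : ℕ} {x : M} (hd : x ∈ adicFiltration I M d)
    (h : x ∈ adicFiltration I M (d + 1)) :
    DirectSum.of (GrPiece I M) d (grMk I d ⟨x, hd⟩) = 0 := by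
  rw [(grMk_eq_zero I _).2 h, map_zero]

variable {I} in
theorem of_grMk_smul_of_grMk {d e : ℕ} {a : B} {x : M} (ha : a ∈ adicFiltration I B d)
    (hx : x ∈ adicFiltration I M e) :
    DirectSum.of (GrPiece I B) d (grMk I d ⟨a, ha⟩) •
      DirectSum.of (GrPiece I M) e (grMk I e ⟨x, hx⟩) =
      DirectSum.of (GrPiece I M) (d + e) (grMk I (d + e) ⟨a • x, smul_mem_adicFiltration I ha hx⟩) := by
  rw [of_smul_of_gr, grSMul_mk]

variable {I} in
theorem of_grMk_mul_of_grMk {d e : ℕ} {a b : B} (ha : a ∈ adicFiltration I B d)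
    (hb : b ∈ adicFiltration I B e) :
    DirectSum.of (GrPiece I B) d (grMk I d ⟨a, ha⟩) *
      DirectSum.of (GrPiece I B) e (grMk I e ⟨b, hb⟩) =
      DirectSum.of (GrPiece I B) (d + e) (grMk I (d + e) ⟨a * b, smul_mem_adicFiltration I ha hb⟩) := by
  rw [of_gr_mul_of_gr, grSMul_mk]
  rfl

end GrAlgebra

namespace RedIncAlg

namespace MonomialModule

variable {P : Type u} [PartialOrder P] {s : Setoid (NonemptyInterval P)} [IntervalAxioms s]
  {k : Type v} [Field k]
  {X : Type*} {N : Type w} [AddCommGroup N] [Module (RedIncAlg k s)ᵐᵒᵖ N] [Module k N]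
  [IsScalarTower k (RedIncAlg k s)ᵐᵒᵖ N] (m : MonomialModule s k X N)
  (hfin : ∀ x y : P, (Set.Icc x y).Finite)

/-- The class of a basis element in the associated graded module. -/
def grVec (x : X) : ⨁ d, GrPiece (opIdeal s k) N d :=
  DirectSum.of (GrPiece (opIdeal s k) N) (m.rk hfin x)
    (grMk _ _ ⟨m.b x, m.b_mem_adicFiltration hfin le_rfl⟩)

/-- Basis elements in the `d`-th step have rank at least `d`; those of larger rank vanish in the
quotient. -/
theorem of_grMk_mem_span (d : ℕ) (n : adicFiltration (opIdeal s k) N d) :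
    DirectSum.of (GrPiece (opIdeal s k) N) d (grMk _ d n) ∈
      Submodule.span k (m.grVec hfin '' {x | m.rk hfin x = d}) := by
  obtain ⟨n, hn⟩ := n
  have hn' := (m.mem_adicFiltration d n).1 hn
  induction hn' using Submodule.span_induction with
  | zero =>
    have : (⟨0, hn⟩ : adicFiltration (opIdeal s k) N d) = 0 := rfl
    rw [this, map_zero, map_zero]; exact zero_mem _
  | add x y hx hy h h' =>
    have hx' := (m.mem_adicFiltration d x).2 hx
    have hy' := (m.mem_adicFiltration d y).2 hy
    have : (⟨x + y, hn⟩ : adicFiltration (opIdeal s k) N d) = ⟨x, hx'⟩ + ⟨y, hy'⟩ := rfl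
    rw [this, map_add, map_add]
    exact add_mem (h hx') (h' hy')
  | smul t x hx h =>
    have hx' := (m.mem_adicFiltration d x).2 hx
    have : (⟨t • x, hn⟩ : adicFiltration (opIdeal s k) N d) = t • ⟨x, hx'⟩ := rfl
    rw [this, grMk_smul, ← smul_of_gr]
    exact Submodule.smul_mem _ t (h hx')
  | mem n h =>
    obtain ⟨x, hx, rfl⟩ := h
    rw [m.mem_level_iff hfin] at hx
    rcases hx.eq_or_lt with h | h
    · exact Submodule.subset_span ⟨x, h.symm, of_grMk_congr h.symm _ _⟩
    · rw [of_grMk_eq_zero hn (m.b_mem_adicFiltration hfin h)]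
      exact zero_mem _

theorem span_grVec : Submodule.span k (Set.range (m.grVec hfin)) = ⊤ := by
  rw [eq_top_iff]
  rintro x -
  induction x using DirectSum.induction_on with
  | zero => exact zero_mem _
  | add x y hx hy => exact add_mem hx hy
  | of d x =>
    obtain ⟨n, rfl⟩ := grMk_surjective _ d x
    exact Submodule.span_mono (Set.image_subset_range _ _) (m.of_grMk_mem_span hfin d n)

open Classical in
/-- The coefficients of the basis elements of rank `d`. -/
def coeffHom (d : ℕ) : adicFiltration (opIdeal s k) N d →+ (X →₀ k) :=
  ((Finsupp.filterAddHom fun x => m.rk hfin x = d).comp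
    m.b.repr.toLinearMap.toAddMonoidHom).comp (adicFiltration (opIdeal s k) N d).subtype.toAddMonoidHom

theorem coeffHom_apply (d : ℕ) (n : adicFiltration (opIdeal s k) N d) (x : X) :
    m.coeffHom hfin d n x = if m.rk hfin x = d then m.b.repr n x else 0 := by
  classical
  exact Finsupp.filter_apply _ _ _

/-- The coordinates on the associated graded module. -/
def grCoord : (⨁ d, GrPiece (opIdeal s k) N d) →+ (X →₀ k) :=
  DirectSum.toAddMonoid fun d =>
    AddMonoidHom.liftOfSurjective (grMk (opIdeal s k) d) (grMk_surjective _ d)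
      -- An element of the next filtration step only involves basis elements of rank at least `d +
      -- 1`, so the coordinates of rank `d` are well defined on the quotient.
      ⟨m.coeffHom hfin d, fun n hn => by
        rw [AddMonoidHom.mem_ker, grMk_eq_zero, mem_adicFiltration] at hn
        rw [AddMonoidHom.mem_ker]
        ext x
        rw [coeffHom_apply, Finsupp.zero_apply]
        split_ifs with h
        · rw [m.b.mem_span_image] at hn
          by_contra h'
          have := (m.mem_level_iff hfin _ _).1 (hn (Finsupp.mem_support_iff.2 h'))
          omega
        · rfl⟩

theorem grCoord_of (d : ℕ) (n : adicFiltration (opIdeal s k) N d) :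
    m.grCoord hfin (DirectSum.of (GrPiece (opIdeal s k) N) d (grMk _ d n)) = m.coeffHom hfin d n := by
  rw [grCoord, DirectSum.toAddMonoid_of]
  exact AddMonoidHom.liftOfRightInverse_comp_apply _ _ _ _ n

theorem linearIndependent_grVec : LinearIndependent k (m.grVec hfin) := by
  classical
  rw [linearIndependent_iff']
  intro S t h x hx
  -- The coordinate map sends the classes of basis elements to unit vectors, which forces
  -- independence.
  have h1 : ∀ x, m.grCoord hfin (t x • m.grVec hfin x) = Finsupp.single x (t x) := by
    intro x
    rw [grVec, smul_of_gr, ← grMk_smul, grCoord_of]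
    ext y
    rw [coeffHom_apply, Submodule.coe_smul_of_tower, map_smul, m.b.repr_self, Finsupp.smul_single,
      smul_eq_mul, mul_one, Finsupp.single_apply]
    by_cases hxy : x = y
    · subst hxy; simp
    · simp [hxy]
  have h2 := congrArg (m.grCoord hfin) h
  rw [map_sum, map_zero] at h2
  simp only [h1] at h2
  have h3 := DFunLike.congr_fun h2 x
  rw [Finsupp.finsetSum_apply, Finset.sum_eq_single x] at h3
  · simpa using h3
  · intro y _ hy
    exact Finsupp.single_eq_of_ne hy.symm
  · exact fun h => absurd hx h

/-- The basis of the associated graded module. -/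
def grBasis : Module.Basis X k (⨁ d, GrPiece (opIdeal s k) N d) :=
  Module.Basis.mk (m.linearIndependent_grVec hfin) (m.span_grVec hfin).ge

@[simp] theorem grBasis_apply (x : X) : m.grBasis hfin x = m.grVec hfin x := by
  simp [grBasis]

end MonomialModule

/-! ### The associated graded algebra -/

section Regular

variable {P : Type u} [PartialOrder P] (s : Setoid (NonemptyInterval P)) [IntervalAxioms s]
  (k : Type v) [Field k]

/-- The basis of the opposite of the reduced incidence algebra. -/
def opBasis : Module.Basis (Quotient s) k (RedIncAlg k s)ᵐᵒᵖ :=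
  Module.Basis.ofRepr ((MulOpposite.opLinearEquiv k).symm.trans
    (LinearEquiv.refl k (RedIncAlg k s) : RedIncAlg k s ≃ₗ[k] (Quotient s →₀ k)))

theorem opBasis_apply (α : Quotient s) : opBasis s k α = MulOpposite.op (xi k α) := by
  rw [Module.Basis.apply_eq_iff]
  rfl

/-- The reduced incidence algebra as a right module over itself. -/
def regular : MonomialModule s k (Quotient s) (RedIncAlg k s)ᵐᵒᵖ where
  b := opBasis s k
  cl := id
  act := comp
  xi_smul α β := by
    rw [opBasis_apply, smul_eq_mul, ← MulOpposite.op_mul, xi_mul_xi, xiMul_eq_elim]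
    cases comp α β with
    | none => rfl
    | some γ => exact (opBasis_apply s k γ).symm
  comp_cl α β := by simp

variable {s k} (hfin : ∀ x y : P, (Set.Icc x y).Finite)

variable (s k) in
/-- The degree of a class of intervals: the maximal length of a chain. -/
def degree : Quotient s → ℕ := (regular s k).rk hfin

theorem op_xi_mem {β : Quotient s} {d : ℕ} (h : d ≤ degree s k hfin β) :
    MulOpposite.op (xi k β) ∈ adicFiltration (opIdeal s k) (RedIncAlg k s)ᵐᵒᵖ d := by
  rw [← opBasis_apply]
  exact (regular s k).b_mem_adicFiltration hfin h

theorem regular_grVec (β : Quotient s) : (regular s k).grVec hfin β =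
    DirectSum.of (GrPiece (opIdeal s k) (RedIncAlg k s)ᵐᵒᵖ) (degree s k hfin β)
      (grMk _ _ ⟨MulOpposite.op (xi k β), op_xi_mem hfin le_rfl⟩) := by
  unfold MonomialModule.grVec
  congr 3

section

variable {X : Type*} {N : Type w} [AddCommGroup N] [Module (RedIncAlg k s)ᵐᵒᵖ N] [Module k N]
  [IsScalarTower k (RedIncAlg k s)ᵐᵒᵖ N] (m : MonomialModule s k X N)

/-- Filtration steps multiply into the step with the summed index, so ranks are superadditive. The
inequality can be strict. -/
theorem rk_act {x y : X} {β : Quotient s} (h : m.act x β = some y) :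
    degree s k hfin β + m.rk hfin x ≤ m.rk hfin y := by
  refine m.le_rk_of_mem hfin ?_
  have h1 : m.b y = MulOpposite.op (xi k β) • m.b x := by rw [m.xi_smul, h]; rfl
  rw [h1]
  exact smul_mem_adicFiltration _ (op_xi_mem hfin le_rfl) (m.b_mem_adicFiltration hfin le_rfl)

/-- The product is the class of the composite in the graded piece indexed by the sum of the two
ranks. It vanishes there exactly when the composite has larger rank or does not exist. -/
theorem grVec_smul_grVec (β : Quotient s) (x : X) :
    (regular s k).grVec hfin β • m.grVec hfin x =
      (m.act x β).elim 0 fun y =>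
        if m.rk hfin y = degree s k hfin β + m.rk hfin x then m.grVec hfin y else 0 := by
  rw [regular_grVec, MonomialModule.grVec, of_grMk_smul_of_grMk]
  cases h : m.act x β with
  | none =>
    have h1 : MulOpposite.op (xi k β) • m.b x = 0 := by rw [m.xi_smul, h]; rfl
    refine of_grMk_eq_zero _ ?_
    rw [h1]; exact zero_mem _
  | some y =>
    have h1 : MulOpposite.op (xi k β) • m.b x = m.b y := by rw [m.xi_smul, h]; rfl
    have h2 := rk_act hfin m h
    simp only [h1, Option.elim_some]
    split_ifs with h3
    · exact of_grMk_congr h3.symm _ _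
    · exact of_grMk_eq_zero _ (m.b_mem_adicFiltration hfin (by omega))

end

theorem grVec_mul_grVec (α β : Quotient s) :
    (regular s k).grVec hfin β * (regular s k).grVec hfin α =
      (comp α β).elim 0 fun γ =>
        if degree s k hfin γ = degree s k hfin β + degree s k hfin α
          then (regular s k).grVec hfin γ else 0 := by
  rw [regular_grVec, regular_grVec, of_grMk_mul_of_grMk]
  cases h : comp α β with
  | none =>
    have h1 : MulOpposite.op (xi k β) * MulOpposite.op (xi k α) = 0 := by
      rw [← MulOpposite.op_mul, xi_mul_xi, xiMul_eq_elim, h]; rfl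
    refine of_grMk_eq_zero _ ?_
    rw [h1]; exact zero_mem _
  | some γ =>
    have h1 : MulOpposite.op (xi k β) * MulOpposite.op (xi k α) = MulOpposite.op (xi k γ) := by
      rw [← MulOpposite.op_mul, xi_mul_xi, xiMul_eq_elim, h]; rfl
    have h2 : degree s k hfin β + degree s k hfin α ≤ degree s k hfin γ :=
      rk_act hfin (regular s k) (x := α) h
    simp only [h1, Option.elim_some]
    split_ifs with h3
    · rw [regular_grVec]
      exact of_grMk_congr h3.symm _ _
    · exact of_grMk_eq_zero _ (op_xi_mem hfin (by omega))

theorem degree_pos_iff {β : Quotient s} : 0 < degree s k hfin β ↔ Nonid β := by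
  rw [← Nat.succ_le_iff, degree, ← MonomialModule.mem_level_iff]
  constructor
  · rintro ⟨α, -, β', hβ', h⟩
    obtain ⟨x, y, z, hxy, hyz, -, rfl, rfl⟩ := comp_eq_some.1 h
    rw [nonid_cls] at hβ' ⊢
    exact hxy.trans_lt hβ'
  · intro h
    exact ⟨srcCls β, trivial, β, h, srcCls_comp_self β⟩

variable (s) in
/-- The finitely many objects: the classes of one-point intervals. -/
abbrev Obj : Type (max u v) := ULift.{v} (Set.range fun x : P => cls s (le_refl x))

instance : Fintype (Obj.{u, v} s) :=
  haveI := (finite_range_refl s).to_subtype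
  Fintype.ofFinite _

theorem srcCls_mem (α : Quotient s) : srcCls α ∈ Set.range fun x : P => cls s (le_refl x) := by
  obtain ⟨x, y, hxy, rfl⟩ := exists_cls α
  exact ⟨x, rfl⟩

theorem tgtCls_mem (α : Quotient s) : tgtCls α ∈ Set.range fun x : P => cls s (le_refl x) := by
  obtain ⟨x, y, hxy, rfl⟩ := exists_cls α
  exact ⟨y, rfl⟩

theorem srcCls_obj (o : Obj.{u, v} s) : srcCls o.down.1 = o.down.1 := by
  obtain ⟨⟨_, x, rfl⟩⟩ := o
  rfl

theorem tgtCls_obj (o : Obj.{u, v} s) : tgtCls o.down.1 = o.down.1 := by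
  obtain ⟨⟨_, x, rfl⟩⟩ := o
  rfl

theorem not_nonid_obj (o : Obj.{u, v} s) : ¬ Nonid o.down.1 := by
  obtain ⟨⟨_, x, rfl⟩⟩ := o
  exact fun h => h x rfl

theorem degree_eq_zero {β : Quotient s} (h : ¬ Nonid β) : degree s k hfin β = 0 := by
  have := (degree_pos_iff (k := k) hfin (β := β)).not.2 h
  omega

/-- The product in the associated graded algebra. -/
def grMul (α β : Quotient s) : Option (Quotient s) :=
  (comp α β).filter fun γ => degree s k hfin γ = degree s k hfin α + degree s k hfin β

theorem grMul_eq_some {α β γ : Quotient s} : grMul (k := k) hfin α β = some γ ↔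
    comp α β = some γ ∧ degree s k hfin γ = degree s k hfin α + degree s k hfin β := by
  simp [grMul, Option.filter_eq_some_iff]

variable (s k) in
theorem sum_xi_obj : ∑ o : Obj.{u, v} s, xi k o.down.1 = 1 := by
  rw [one_def]
  refine (Finset.sum_bij' (fun α h => ⟨⟨α, (Set.Finite.mem_toFinset _).1 h⟩⟩)
    (fun o _ => o.down.1) ?_ ?_ ?_ ?_ ?_).symm
  · intros; simp
  · intro o _; rw [Set.Finite.mem_toFinset]; exact o.down.2
  · intros; rfl
  · intros; rfl
  · intros; rfl

theorem sum_regular_grVec : ∑ o : Obj.{u, v} s, (regular s k).grVec hfin o.down.1 = 1 := by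
  have h1 : ∀ o : Obj.{u, v} s, (regular s k).grVec hfin o.down.1 =
      DirectSum.of (GrPiece (opIdeal s k) (RedIncAlg k s)ᵐᵒᵖ) 0
        (grMk _ 0 ⟨MulOpposite.op (xi k o.down.1), op_xi_mem hfin (Nat.zero_le _)⟩) := by
    intro o
    rw [regular_grVec]
    exact of_grMk_congr (degree_eq_zero hfin (not_nonid_obj o)) _ _
  simp only [h1]
  rw [← map_sum, ← map_sum]
  refine congrArg (DirectSum.of _ 0) (congrArg (grMk _ 0) (Subtype.ext ?_))
  rw [AddSubmonoidClass.coe_finsetSum]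
  change ∑ o : Obj.{u, v} s, MulOpposite.op (xi k o.down.1) = 1
  rw [← MulOpposite.op_one, ← sum_xi_obj s k]
  exact (map_sum (MulOpposite.opAddEquiv (α := RedIncAlg k s)) _ _).symm

variable (s k) in
/-- The associated graded algebra of the reduced incidence algebra as a monomial algebra. -/
def grMonomialAlgebra :
    MonomialAlgebra k (⨁ d, GrPiece (opIdeal s k) (RedIncAlg k s)ᵐᵒᵖ d) (Quotient s)
      (Obj.{u, v} s) where
  b := (regular s k).grBasis hfin
  src α := ULift.up.{v} ⟨srcCls α, srcCls_mem α⟩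
  tgt α := ULift.up.{v} ⟨tgtCls α, tgtCls_mem α⟩
  deg := degree s k hfin
  idn o := o.down.1
  mul := grMul (k := k) hfin
  b_mul_b α β := by
    rw [MonomialModule.grBasis_apply, MonomialModule.grBasis_apply, grVec_mul_grVec]
    change _ = (Option.filter _ (comp α β)).elim 0 _
    cases h : comp α β with
    | none => rfl
    | some γ =>
      rw [Option.filter_some]
      simp only [Option.elim_some, decide_eq_true_eq]
      rw [add_comm]
      split_ifs
      · simp
      · rfl
  src_mul h := by
    have := srcCls_comp ((grMul_eq_some hfin).1 h).1
    simp [this]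
  tgt_mul h := by
    have := tgtCls_comp ((grMul_eq_some hfin).1 h).1
    simp [this]
  deg_mul h := ((grMul_eq_some hfin).1 h).2
  comp_mul h := by
    have := tgtCls_eq_srcCls ((grMul_eq_some hfin).1 h).1
    simp [this]
  src_idn o := by simp [srcCls_obj]
  tgt_idn o := by simp [tgtCls_obj]
  deg_idn o := degree_eq_zero hfin (not_nonid_obj o)
  eq_idn α h := eq_srcCls_of_not_nonid fun h' => by
    have := (degree_pos_iff (k := k) hfin).2 h'
    omega
  idn_mul α := (grMul_eq_some hfin).2 ⟨srcCls_comp_self α, by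
    rw [degree_eq_zero hfin (not_nonid_obj (ULift.up.{v} ⟨srcCls α, srcCls_mem α⟩)), zero_add]⟩
  mul_idn α := (grMul_eq_some hfin).2 ⟨comp_tgtCls_self α, by
    rw [degree_eq_zero hfin (not_nonid_obj (ULift.up.{v} ⟨tgtCls α, tgtCls_mem α⟩)), add_zero]⟩
  sum_idn := by
    simp only [MonomialModule.grBasis_apply]
    exact sum_regular_grVec hfin

theorem isCompatible_grMonomialAlgebra : (grMonomialAlgebra s k hfin).IsCompatible where
  b_eq α := ⟨_, (MonomialModule.grBasis_apply _ hfin α).trans (regular_grVec hfin α)⟩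
  degProj_of d r := by
    obtain ⟨n, rfl⟩ := grMk_surjective _ d r
    have h := (regular s k).of_grMk_mem_span hfin d n
    generalize DirectSum.of _ d (grMk _ d n) = y at h ⊢
    induction h using Submodule.span_induction with
    | zero => simp
    | add x y _ _ hx hy => rw [map_add, hx, hy]
    | smul t x _ hx => rw [map_smul, hx]
    | mem x hx =>
      obtain ⟨α, hα, rfl⟩ := hx
      have h1 : (regular s k).grVec hfin α = (grMonomialAlgebra s k hfin).b α :=
        (MonomialModule.grBasis_apply _ hfin α).symm
      rw [h1, MonomialAlgebra.degProj_b, if_pos]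
      exact congrArg _ hα
  algebraMap_eq t := by
    refine ⟨t • grOne _, ?_⟩
    rw [Algebra.algebraMap_eq_smul_one, ← smul_of_gr]
    rfl

end Regular

end RedIncAlg

end

noncomputable section

set_option linter.unusedSectionVars false

/-! ## Chains and lists of classes -/

namespace RedIncAlg

section Paths

variable {P : Type u} [PartialOrder P] (s : Setoid (NonemptyInterval P))

open Classical in
/-- The class of the interval between two points (a junk value if they are not comparable). -/
def between (a b : P) : Quotient s := if h : a ≤ b then cls s h else cls s (le_refl a)

variable {s} in
theorem between_eq {a b : P} (h : a ≤ b) : between s a b = cls s h := dif_pos h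

/-- The list of the classes of the consecutive intervals in a chain from `a` through `l` to `y`. -/
def gaps (y : P) : P → List P → List (Quotient s)
  | a, [] => [between s a y]
  | a, b :: l => between s a b :: gaps y b l

/-- The condition that `a`, `l` and `y` form a chain. -/
def IsPath (y : P) : P → List P → Prop
  | a, [] => a < y
  | a, b :: l => a < b ∧ IsPath y b l

/-- The composite of a class and a list of classes. -/
def compList : Quotient s → List (Quotient s) → Option (Quotient s)
  | α, [] => some α
  | α, β :: c => (comp α β).bind fun γ => compList γ c

/-- The weight of a list of classes, where the head is counted with a different weight. -/
def headWeight (ρ deg : Quotient s → ℕ) : List (Quotient s) → ℕ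
  | [] => 0
  | α :: c => ρ α + (c.map deg).sum

variable {s}

theorem gaps_length (y a : P) (l : List P) : (gaps s y a l).length = l.length + 1 := by
  induction l generalizing a with
  | nil => rfl
  | cons b l ih => rw [gaps, List.length_cons, ih, List.length_cons]

theorem headWeight_self (deg : Quotient s → ℕ) (c : List (Quotient s)) :
    headWeight s deg deg c = (c.map deg).sum := by
  cases c <;> simp [headWeight]

theorem isPath_iff {y a : P} {l : List P} :
    IsPath y a l ↔ a < y ∧ l.Pairwise (· < ·) ∧ ∀ b ∈ l, a < b ∧ b < y := by
  induction l generalizing a with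
  | nil => simp [IsPath]
  | cons b l ih =>
    rw [IsPath, ih, List.pairwise_cons]
    constructor
    · rintro ⟨h1, h2, h3, h4⟩
      refine ⟨h1.trans h2, ⟨fun c hc => (h4 c hc).1, h3⟩, ?_⟩
      intro c hc
      rcases List.mem_cons.1 hc with rfl | hc
      · exact ⟨h1, h2⟩
      · exact ⟨h1.trans (h4 c hc).1, (h4 c hc).2⟩
    · rintro ⟨h1, ⟨h2, h3⟩, h4⟩
      exact ⟨(h4 b (by simp)).1, (h4 b (by simp)).2, h3,
        fun c hc => ⟨h2 c hc, (h4 c (by simp [hc])).2⟩⟩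

theorem IsPath.sublist {y a : P} {l l' : List P} (h : IsPath y a l') (hl : l.Sublist l') :
    IsPath y a l := by
  rw [isPath_iff] at h ⊢
  exact ⟨h.1, h.2.1.sublist hl, fun b hb => h.2.2 b (hl.subset hb)⟩

theorem IsPath.append {y a b : P} {l l' : List P} (h : IsPath b a l) (h' : IsPath y b l') :
    IsPath y a (l ++ b :: l') := by
  induction l generalizing a with
  | nil => exact ⟨h, h'⟩
  | cons c l ih => exact ⟨h.1, ih h.2⟩

variable [IntervalAxioms s]

theorem comp_between {a b c : P} (h : a ≤ b) (h' : b ≤ c) :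
    comp (between s a b) (between s b c) = some (between s a c) := by
  rw [between_eq h, between_eq h', between_eq (h.trans h'), comp_cls]

theorem nonid_between {a b : P} (h : a < b) : Nonid (between s a b) := by
  rw [between_eq h.le, nonid_cls]; exact h

/-- Read off from associativity in the incidence algebra over ℚ. Any field would serve, since
monomials are nonzero and distinct. -/
theorem comp_assoc (α β γ : Quotient s) :
    (comp α β).bind (fun δ => comp δ γ) = (comp β γ).bind fun δ => comp α δ := by
  have h := xi_mul_assoc (k := ℚ) α β γ
  have key : ∀ o o' : Option (Quotient s), o.elim 0 (xi ℚ) = o'.elim 0 (xi ℚ) → o = o' := by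
    have h0 : ∀ a : Quotient s, (0 : RedIncAlg ℚ s) ≠ xi ℚ a := fun a h =>
      one_ne_zero (Finsupp.single_eq_zero.1 h.symm)
    rintro (_ | a) (_ | a') h
    · rfl
    · exact absurd h (h0 a')
    · exact absurd h.symm (h0 a)
    · exact congrArg some ((Finsupp.single_left_inj one_ne_zero).1 h)
  apply key
  have h1 : ((comp α β).bind (fun δ => comp δ γ)).elim 0 (xi ℚ) = xi ℚ α * xi ℚ β * xi ℚ γ := by
    rw [xi_mul_xi, xiMul_eq_elim]
    cases comp α β with
    | none => simp
    | some δ => simp [xi_mul_xi, xiMul_eq_elim]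
  have h2 : ((comp β γ).bind (fun δ => comp α δ)).elim 0 (xi ℚ) = xi ℚ α * (xi ℚ β * xi ℚ γ) := by
    rw [xi_mul_xi β, xiMul_eq_elim]
    cases comp β γ with
    | none => simp
    | some δ => simp [xi_mul_xi, xiMul_eq_elim]
  rw [h1, h2, h]

theorem compList_cons_cons (α β γ : Quotient s) (c : List (Quotient s)) :
    compList s α (β :: γ :: c) = (comp β γ).bind fun δ => compList s α (δ :: c) := by
  have h := congrArg (fun o => o.bind fun δ => compList s δ c) (comp_assoc α β γ)
  simp only [Option.bind_assoc] at h
  exact h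

theorem compList_gaps {u y a : P} {l : List P} (hu : u ≤ a) (h : IsPath y a l) :
    compList s (between s u a) (gaps s y a l) = some (between s u y) := by
  induction l generalizing a with
  | nil => simp [gaps, compList, comp_between hu (le_of_lt h)]
  | cons b l ih =>
    rw [gaps, compList, comp_between hu h.1.le, Option.bind_some, ih (hu.trans h.1.le) h.2]

theorem nonid_of_mem_gaps {y a : P} {l : List P} (h : IsPath y a l) :
    ∀ α ∈ gaps s y a l, Nonid α := by
  induction l generalizing a with
  | nil =>
    intro α hα
    rw [gaps, List.mem_singleton] at hα
    exact hα ▸ nonid_between h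
  | cons b l ih =>
    intro α hα
    rw [gaps, List.mem_cons] at hα
    rcases hα with rfl | hα
    · exact nonid_between h.1
    · exact ih h.2 α hα

theorem head_gaps {y a : P} {l : List P} (h : IsPath y a l) :
    ∀ α ∈ (gaps s y a l).head?, srcCls α = cls s (le_refl a) := by
  cases l with
  | nil =>
    intro α hα
    obtain rfl : between s a y = α := by simpa [gaps] using hα
    rw [between_eq (le_of_lt h)]; rfl
  | cons b l =>
    intro α hα
    obtain rfl : between s a b = α := by simpa [gaps] using hα
    rw [between_eq h.1.le]; rfl

theorem isChain_gaps {y a : P} {l : List P} (h : IsPath y a l) :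
    (gaps s y a l).IsChain fun α β => tgtCls α = srcCls β := by
  induction l generalizing a with
  | nil => simp [gaps]
  | cons b l ih =>
    rw [gaps, List.isChain_cons]
    refine ⟨fun β hβ => ?_, ih h.2⟩
    rw [head_gaps h.2 β hβ, between_eq h.1.le]; rfl

/-- A factorization of the class of an interval is realized by a chain in the interval. -/
theorem exists_path_of_compList {x y : P} {h : x ≤ y} {α : Quotient s} {c : List (Quotient s)}
    (hc : ∀ β ∈ c, Nonid β) (e : compList s α c = some (cls s h)) :
    ∃ (z : P) (hxz : x ≤ z), cls s hxz = α ∧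
      (c = [] ∧ z = y ∨ ∃ l, IsPath y z l ∧ gaps s y z l = c) := by
  induction c generalizing α with
  | nil =>
    rw [compList, Option.some.injEq] at e
    exact ⟨y, h, e.symm, Or.inl ⟨rfl, rfl⟩⟩
  | cons β c ih =>
    rw [compList, Option.bind_eq_some_iff] at e
    obtain ⟨γ, hγ, e⟩ := e
    -- The induction hypothesis, applied to the composite of `α` and `β`, gives the point `w` from
    -- which the remaining chain starts. The factorization of `[x, w]` then provides the cut point
    -- `z`.
    obtain ⟨w, hxw, rfl, hw⟩ := ih (fun β' h' => hc β' (List.mem_cons_of_mem _ h')) e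
    obtain ⟨z, hxz, hzw, rfl, rfl⟩ := exists_mem_of_comp hγ
    have hlt : z < w := (nonid_cls hzw).1 (hc _ List.mem_cons_self)
    refine ⟨z, hxz, rfl, Or.inr ?_⟩
    rcases hw with ⟨rfl, rfl⟩ | ⟨l, hl, rfl⟩
    · exact ⟨[], hlt, by rw [gaps, between_eq hzw]⟩
    · exact ⟨w :: l, ⟨hlt, hl⟩, by rw [gaps, between_eq hzw]⟩

/-- Later points are recovered first: the classes of `[x, b]` and `[x, b']` agree, so induction
gives `b = b'`. The preceding point is then determined inside `[x, b]` by its two parts. -/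
theorem eq_of_gaps_eq {x y a a' : P} {l l' : List P} (ha : x ≤ a) (ha' : x ≤ a')
    (h : IsPath y a l) (h' : IsPath y a' l') (e : between s x a = between s x a')
    (hg : gaps s y a l = gaps s y a' l') : a = a' ∧ l = l' := by
  induction l generalizing a a' l' with
  | nil =>
    cases l' with
    | cons b' l' =>
      have := congrArg List.length hg
      rw [gaps_length, gaps_length] at this
      simp at this
    | nil =>
      rw [gaps, gaps, List.cons.injEq, between_eq (le_of_lt h), between_eq (le_of_lt h')] at hg
      rw [between_eq ha, between_eq ha'] at e
      exact ⟨eq_of_cls_eq ha (le_of_lt h) ha' (le_of_lt h') e hg.1, rfl⟩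
  | cons b l ih =>
    cases l' with
    | nil =>
      have := congrArg List.length hg
      rw [gaps_length, gaps_length] at this
      simp at this
    | cons b' l' =>
      rw [gaps, gaps, List.cons.injEq] at hg
      have e1 : between s x b = between s x b' := by
        have h1 := comp_between (s := s) ha h.1.le
        have h2 := comp_between (s := s) ha' h'.1.le
        rw [e, hg.1, h2, Option.some.injEq] at h1
        exact h1.symm
      obtain ⟨rfl, rfl⟩ := ih (ha.trans h.1.le) (ha'.trans h'.1.le) h.2 h'.2 e1 hg.2
      have h3 := hg.1
      rw [between_eq h.1.le, between_eq h'.1.le] at h3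
      rw [between_eq ha, between_eq ha'] at e
      exact ⟨eq_of_cls_eq ha h.1.le ha' h'.1.le e h3, rfl⟩

section Weight

variable {deg ρ : Quotient s → ℕ} {T : Set (Quotient s)}
  (hdeg : ∀ {α β γ}, comp α β = some γ → deg α + deg β ≤ deg γ)
  (hρ : ∀ {α β γ}, α ∈ T → comp α β = some γ → ρ α + deg β ≤ ρ γ)

include hρ in
/-- Omitting the first point of a chain does not decrease the weight. -/
theorem headWeight_gaps_cons_le {y a b : P} {l : List P} (h : IsPath y a (b :: l))
    (hT : between s a b ∈ T) :
    headWeight s ρ deg (gaps s y a (b :: l)) ≤ headWeight s ρ deg (gaps s y a l) := by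
  cases l with
  | nil =>
    have := hρ hT (comp_between h.1.le (le_of_lt h.2))
    simpa [gaps, headWeight] using this
  | cons c l =>
    have := hρ hT (comp_between h.1.le h.2.1.le)
    simp only [gaps, headWeight, List.map_cons, List.sum_cons]
    omega

include hdeg in
theorem sum_gaps_sublist {y a : P} {l l' : List P} (h : IsPath y a l') (hl : l.Sublist l') :
    ((gaps s y a l').map deg).sum ≤ ((gaps s y a l).map deg).sum := by
  induction hl generalizing a with
  | slnil => exact le_rfl
  | @cons l l' b hl ih =>
    -- Counting the head by `deg` like all other gaps removes the distinction between head and tail.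
    have h1 := headWeight_gaps_cons_le (deg := deg) (ρ := deg) (T := Set.univ)
      (fun _ => hdeg) (h.sublist (hl.cons_cons b)) trivial
    rw [headWeight_self, headWeight_self] at h1
    refine le_trans ?_ h1
    simp only [gaps, List.map_cons, List.sum_cons]
    exact Nat.add_le_add_left (ih h.2) _
  | @cons_cons l l' b hl ih =>
    simp only [gaps, List.map_cons, List.sum_cons]
    exact Nat.add_le_add_left (ih h.2) _

-- Deleting points merges gaps, and superadditivity makes the weight grow or stay. The head is
-- treated separately because `ρ` is superadditive only on `T`.
include hdeg hρ in
theorem headWeight_gaps_sublist {y a : P} {l l' : List P} (h : IsPath y a l')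
    (hT : ∀ b ∈ l', between s a b ∈ T) (hl : l.Sublist l') :
    headWeight s ρ deg (gaps s y a l') ≤ headWeight s ρ deg (gaps s y a l) := by
  cases hl with
  | slnil => exact le_rfl
  | @cons l l' b hl =>
    refine le_trans ?_ (headWeight_gaps_cons_le hρ (h.sublist (hl.cons_cons b)) (hT b (by simp)))
    simp only [gaps, headWeight]
    exact Nat.add_le_add_left (sum_gaps_sublist hdeg h.2 hl) _
  | @cons_cons l l' b hl =>
    simp only [gaps, headWeight]
    exact Nat.add_le_add_left (sum_gaps_sublist hdeg h.2 hl) _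

/-- There is one gap after each point of the chain and each has positive degree; the head gap may
have weight zero. -/
theorem length_le_headWeight {y a : P} {l : List P} (hpos : ∀ α, Nonid α → 0 < deg α)
    (h : IsPath y a l) : l.length ≤ headWeight s ρ deg (gaps s y a l) := by
  cases l with
  | nil => exact Nat.zero_le _
  | cons b l =>
    simp only [gaps, headWeight]
    have h1 : (gaps s y b l).length ≤ ((gaps s y b l).map deg).sum := by
      rw [← List.length_map (f := deg)]
      refine List.length_le_sum_of_one_le _ fun d hd => ?_
      obtain ⟨α, hα, rfl⟩ := List.mem_map.1 hd
      exact hpos α (nonid_of_mem_gaps h.2 α hα)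
    rw [gaps_length] at h1
    rw [List.length_cons]
    omega

variable
  (hdeg' : ∀ a b : P, a < b → ∃ l, IsPath b a l ∧ deg (between s a b) ≤ l.length + 1)
  (hρ' : ∀ a b : P, a < b → between s a b ∈ T →
    ∃ l, IsPath b a l ∧ (∀ c ∈ l, between s a c ∈ T) ∧ ρ (between s a b) ≤ l.length)

-- Each gap of degree d has room for at least d - 1 intermediate points. A chain has one gap more
-- than points, which accounts for the `+ 1`.
include hdeg' in
theorem exists_refinement_sum {y a : P} {l : List P} (h : IsPath y a l) :
    ∃ l', l.Sublist l' ∧ IsPath y a l' ∧ ((gaps s y a l).map deg).sum ≤ l'.length + 1 := by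
  induction l generalizing a with
  | nil =>
    obtain ⟨l', h1, h2⟩ := hdeg' a y h
    exact ⟨l', List.nil_sublist _, h1, by simpa [gaps] using h2⟩
  | cons b l ih =>
    obtain ⟨l₁, h1, h2⟩ := hdeg' a b h.1
    obtain ⟨l₂, h3, h4, h5⟩ := ih h.2
    refine ⟨l₁ ++ b :: l₂, (h3.cons_cons b).trans (List.sublist_append_right _ _), h1.append h4, ?_⟩
    simp only [gaps, List.map_cons, List.sum_cons, List.length_append, List.length_cons]
    omega

-- Filling all gaps as far as possible realizes the weight. The head gap contributes `ρ` many points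
-- of `T`; points inserted in later gaps lie in `T` because `T` is closed under composition on the
-- right.
include hdeg' hρ' in
theorem exists_refinement {y a : P} {l : List P} (h : IsPath y a l) (hy : between s a y ∈ T)
    (hT : ∀ b ∈ l, between s a b ∈ T)
    (hmul : ∀ {α β γ}, α ∈ T → comp α β = some γ → γ ∈ T) :
    ∃ l', l.Sublist l' ∧ IsPath y a l' ∧ (∀ b ∈ l', between s a b ∈ T) ∧
      headWeight s ρ deg (gaps s y a l) ≤ l'.length := by
  cases l with
  | nil =>
    obtain ⟨l', h1, h2, h3⟩ := hρ' a y h hy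
    exact ⟨l', List.nil_sublist _, h1, h2, by simpa [gaps, headWeight] using h3⟩
  | cons b l =>
    have hb := hT b (by simp)
    obtain ⟨l₁, h1, h2, h3⟩ := hρ' a b h.1 hb
    obtain ⟨l₂, h4, h5, h6⟩ := exists_refinement_sum hdeg' h.2
    refine ⟨l₁ ++ b :: l₂, (h4.cons_cons b).trans (List.sublist_append_right _ _), h1.append h5,
      ?_, ?_⟩
    · intro c hc
      rcases List.mem_append.1 hc with hc | hc
      · exact h2 c hc
      rcases List.mem_cons.1 hc with rfl | hc
      · exact hb
      · exact hmul hb (comp_between h.1.le ((isPath_iff.1 h5).2.2 c hc).1.le)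
    · simp only [gaps, headWeight, List.length_append, List.length_cons]
      omega

end Weight

section Level

variable {k : Type v} [Field k] {X N : Type*} [AddCommGroup N] [Module (RedIncAlg k s)ᵐᵒᵖ N]
  [Module k N] (m : MonomialModule s k X N)

/-- Each step of the filtration cuts the interval at a point whose lower part still belongs to the
module. Unwinding `d` steps gives `d` such points. -/
theorem exists_chain_of_mem_level {d : ℕ} {x : X} (hx : x ∈ m.level d) {a b : P} (hab : a ≤ b)
    (e : cls s hab = m.cl x) : ∃ l : List P, l.length = d ∧ l.Pairwise (· < ·) ∧
      ∀ c ∈ l, ∃ h : a ≤ c, c < b ∧ cls s h ∈ Set.range m.cl := by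
  induction d generalizing x b with
  | zero => exact ⟨[], rfl, .nil, by simp⟩
  | succ d ih =>
    obtain ⟨x', hx', β, hβ, hact⟩ := hx
    have hc := m.comp_cl x' β
    rw [hact, Option.map_some, ← e] at hc
    obtain ⟨z, haz, hzb, h1, h2⟩ := exists_mem_of_comp hc
    have hlt : z < b := (nonid_cls hzb).1 (h2 ▸ hβ)
    obtain ⟨l, h3, h4, h5⟩ := ih hx' haz h1
    refine ⟨l ++ [z], by simp [h3], ?_, ?_⟩
    · rw [List.pairwise_append]
      refine ⟨h4, List.pairwise_singleton _ _, fun c hc w hw => ?_⟩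
      rw [List.mem_singleton.1 hw]
      exact (h5 c hc).2.1
    · intro c hc
      rcases List.mem_append.1 hc with hc | hc
      · obtain ⟨h6, h7, h8⟩ := h5 c hc
        exact ⟨h6, h7.trans hlt, h8⟩
      · rw [List.mem_singleton.1 hc]
        exact ⟨haz, hlt, x', h1.symm⟩

variable [IsScalarTower k (RedIncAlg k s)ᵐᵒᵖ N] (hfin : ∀ x y : P, (Set.Icc x y).Finite)

theorem exists_path_degree {a b : P} (h : a < b) :
    ∃ l, IsPath b a l ∧ degree s k hfin (between s a b) ≤ l.length + 1 := by
  rw [between_eq h.le]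
  obtain ⟨l, h1, h2, h3⟩ := exists_chain_of_mem_level (regular s k) (x := cls s h.le)
    (((regular s k).mem_level_iff hfin _ _).2 le_rfl) h.le rfl
  -- For the regular module the first cut point may be `a` itself. Discarding the first point
  -- guarantees that the others are interior, so degree d yields d - 1 points.
  cases l with
  | nil => exact ⟨[], h, by rw [degree, ← h1]; simp⟩
  | cons c l =>
    refine ⟨l, isPath_iff.2 ⟨h, (List.pairwise_cons.1 h2).2, fun c' hc' => ⟨?_, ?_⟩⟩, ?_⟩
    · obtain ⟨h4, -⟩ := h3 c (by simp)
      exact h4.trans_lt ((List.pairwise_cons.1 h2).1 c' hc')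
    · exact (h3 c' (by simp [hc'])).2.1
    · rw [degree, ← h1]; simp

/-- In contrast to the regular module, no identity class occurs, so all cut points are strictly
above `a` and none is lost. -/
theorem exists_path_rk (hm : ∀ x, Nonid (m.cl x)) {a b : P} (h : a < b) {x : X}
    (e : m.cl x = between s a b) : ∃ l, IsPath b a l ∧
      (∀ c ∈ l, between s a c ∈ Set.range m.cl) ∧ m.rk hfin x ≤ l.length := by
  rw [between_eq h.le] at e
  obtain ⟨l, h1, h2, h3⟩ := exists_chain_of_mem_level m
    ((m.mem_level_iff hfin _ _).2 le_rfl) h.le e.symm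
  refine ⟨l, isPath_iff.2 ⟨h, h2, fun c hc => ?_⟩, fun c hc => ?_, h1.ge⟩
  · obtain ⟨h4, h5, x', h6⟩ := h3 c hc
    exact ⟨(nonid_cls h4).1 (h6 ▸ hm x'), h5⟩
  · obtain ⟨h4, h5, h6⟩ := h3 c hc
    rwa [between_eq h4]

end Level

end Paths

end RedIncAlg

end

noncomputable section

set_option linter.unusedSectionVars false

/-! ## Sorting finite chains -/

namespace RedIncAlg

section Chains

variable {P : Type u} [PartialOrder P]

/-- A linear order extending the given partial order. -/
def LinExt (a b : P) : Prop := toLinearExtension a ≤ toLinearExtension b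

instance : IsTrans P LinExt := ⟨fun _ _ _ h h' => le_trans (α := LinearExtension P) h h'⟩

instance : Std.Antisymm (LinExt (P := P)) :=
  ⟨fun _ _ h h' => le_antisymm (α := LinearExtension P) h h'⟩

instance : Std.Total (LinExt (P := P)) := ⟨fun a b => le_total (α := LinearExtension P) a b⟩

theorem linExt_of_le {a b : P} (h : a ≤ b) : LinExt a b := toLinearExtension.monotone h

open Classical in
/-- The elements of a finite chain in increasing order. -/
def sortChain (F : Finset P) : List P := F.sort LinExt

@[simp] theorem mem_sortChain {F : Finset P} {a : P} : a ∈ sortChain F ↔ a ∈ F := by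
  classical
  exact Finset.mem_sort _

@[simp] theorem length_sortChain (F : Finset P) : (sortChain F).length = F.card := by
  classical
  exact Finset.length_sort _

open Classical in
@[simp] theorem toFinset_sortChain (F : Finset P) : (sortChain F).toFinset = F :=
  Finset.sort_toFinset _ _

@[simp] theorem sortChain_empty : sortChain (∅ : Finset P) = [] := by
  rw [← List.length_eq_zero_iff]; simp

open Classical in
theorem sortChain_insert {a : P} {F : Finset P} (h : ∀ b ∈ F, a < b) :
    sortChain (insert a F) = a :: sortChain F :=
  Finset.sort_insert _ (fun b hb => linExt_of_le (h b hb).le) fun ha => lt_irrefl a (h a ha)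

open Classical in
theorem sortChain_toFinset {l : List P} (h : l.Pairwise (· < ·)) : sortChain l.toFinset = l :=
  (List.toFinset_sort _ (h.imp fun h => ne_of_lt h)).2 (h.imp fun h => linExt_of_le h.le)

theorem pairwise_sortChain {F : Finset P} (hF : IsChain (· ≤ ·) (F : Set P)) :
    (sortChain F).Pairwise (· < ·) := by
  classical
  refine OrdComplex.chain_induction (motive := fun F => (sortChain F).Pairwise (· < ·))
    (by simp) (fun a F h _ ih => ?_) F hF
  convert_to (sortChain (insert a F)).Pairwise (· < ·)
  rw [sortChain_insert h, List.pairwise_cons]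
  exact ⟨fun b hb => h b (mem_sortChain.1 hb), ih⟩

theorem isChain_of_pairwise {l : List P} (h : l.Pairwise (· < ·)) :
    IsChain (· ≤ ·) {a | a ∈ l} := by
  intro a ha b hb hab
  have : Std.Symm fun x y : P => x ≤ y ∨ y ≤ x := ⟨fun _ _ h => h.symm⟩
  exact List.Pairwise.forall_of_forall (R := fun x y => x ≤ y ∨ y ≤ x)
    (fun x _ => Or.inl le_rfl) (h.imp fun h => Or.inl h.le) ha hb

open Classical in
theorem sublist_sortChain {F G : Finset P} (hG : IsChain (· ≤ ·) (G : Set P)) (h : F ⊆ G) :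
    (sortChain F).Sublist (sortChain G) := by
  have hF : IsChain (· ≤ ·) (F : Set P) := hG.mono (Finset.coe_subset.2 h)
  refine List.sublist_of_subperm_of_pairwise (r := LinExt) ?_
    ((pairwise_sortChain hF).imp fun h => linExt_of_le h.le)
    ((pairwise_sortChain hG).imp fun h => linExt_of_le h.le)
  refine List.subperm_of_subset ((pairwise_sortChain hF).imp fun h => ne_of_lt h) fun a ha => ?_
  rw [mem_sortChain] at ha ⊢
  exact h ha

end Chains

end RedIncAlg

/-! ## Exactness and bases -/

section LinearAlgebra

variable {k V ι : Type*} [Field k] [AddCommGroup V] [Module k V] (B : Module.Basis ι k V)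

open Classical in
/-- The projection to the span of some elements of a basis. -/
def basisProj (S : Set ι) : V →ₗ[k] V := B.constr k fun i => if i ∈ S then B i else 0

open Classical in
theorem basisProj_apply (S : Set ι) (i : ι) : basisProj B S (B i) = if i ∈ S then B i else 0 := by
  rw [basisProj, B.constr_basis]

theorem basisProj_of_mem {S I : Set ι} {z : V} (hz : z ∈ Submodule.span k (B '' I)) (h : I ⊆ S) :
    basisProj B S z = z := by
  induction hz using Submodule.span_induction with
  | zero => simp
  | add x y _ _ hx hy => rw [map_add, hx, hy]
  | smul t x _ hx => rw [map_smul, hx]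
  | mem x hx =>
    obtain ⟨i, hi, rfl⟩ := hx
    rw [basisProj_apply, if_pos (h hi)]

theorem basisProj_of_disjoint {S I : Set ι} {z : V} (hz : z ∈ Submodule.span k (B '' I))
    (h : ∀ i ∈ I, i ∉ S) : basisProj B S z = 0 := by
  induction hz using Submodule.span_induction with
  | zero => simp
  | add x y _ _ hx hy => rw [map_add, hx, hy, add_zero]
  | smul t x _ hx => rw [map_smul, hx, smul_zero]
  | mem x hx =>
    obtain ⟨i, hi, rfl⟩ := hx
    rw [basisProj_apply, if_neg (h i hi)]

theorem basisProj_mem {S I : Set ι} {z : V} (hz : z ∈ Submodule.span k (B '' I)) :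
    basisProj B S z ∈ Submodule.span k (B '' (I ∩ S)) := by
  induction hz using Submodule.span_induction with
  | zero => simp
  | add x y _ _ hx hy => rw [map_add]; exact add_mem hx hy
  | smul t x _ hx => rw [map_smul]; exact Submodule.smul_mem _ t hx
  | mem x hx =>
    obtain ⟨i, hi, rfl⟩ := hx
    rw [basisProj_apply]
    split_ifs with h
    · exact Submodule.subset_span ⟨i, ⟨hi, h⟩, rfl⟩
    · exact zero_mem _

theorem exists_sum_basisProj {Γ : Type*} (ℓ : ι → Γ) (z : V) :
    ∃ S : Finset Γ, ∑ g ∈ S, basisProj B (ℓ ⁻¹' {g}) z = z := by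
  classical
  refine ⟨(B.repr z).support.image ℓ, ?_⟩
  conv_rhs => rw [← B.linearCombination_repr z, Finsupp.linearCombination_apply, Finsupp.sum]
  have h : ∀ g, basisProj B (ℓ ⁻¹' {g}) z = ∑ i ∈ (B.repr z).support,
      if ℓ i = g then (B.repr z) i • B i else 0 := by
    intro g
    conv_lhs => rw [← B.linearCombination_repr z, Finsupp.linearCombination_apply, Finsupp.sum]
    rw [map_sum]
    refine Finset.sum_congr rfl fun i _ => ?_
    rw [map_smul, basisProj_apply]
    simp only [Set.mem_preimage, Set.mem_singleton_iff]
    split_ifs <;> simp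
  simp only [h]
  rw [Finset.sum_comm]
  refine Finset.sum_congr rfl fun i hi => ?_
  rw [Finset.sum_ite_eq, if_pos (Finset.mem_image_of_mem _ hi)]

/-- If a differential preserves the labels of the elements of a basis, exactness can be tested
label by label. -/
theorem exact_iff_forall_label {Γ : Type*} (D : V →ₗ[k] V) (ℓ : ι → Γ)
    (hD : ∀ i, D (B i) ∈ Submodule.span k (B '' {i' | ℓ i' = ℓ i})) (I I' : Set ι) :
    (∀ z ∈ Submodule.span k (B '' I), D z = 0 → ∃ w ∈ Submodule.span k (B '' I'), D w = z) ↔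
      ∀ g, ∀ z ∈ Submodule.span k (B '' (I ∩ ℓ ⁻¹' {g})), D z = 0 →
        ∃ w ∈ Submodule.span k (B '' (I' ∩ ℓ ⁻¹' {g})), D w = z := by
  -- Preservation of labels means that `D` commutes with the projections to the labels, so cycles
  -- and fillings decompose.
  have hcomm : ∀ g z, basisProj B (ℓ ⁻¹' {g}) (D z) = D (basisProj B (ℓ ⁻¹' {g}) z) := by
    intro g z
    refine LinearMap.congr_fun (f := (basisProj B (ℓ ⁻¹' {g})).comp D)
      (g := D.comp (basisProj B (ℓ ⁻¹' {g}))) (B.ext fun i => ?_) z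
    rw [LinearMap.comp_apply, LinearMap.comp_apply, basisProj_apply]
    split_ifs with h
    · exact basisProj_of_mem B (hD i) fun i' hi' => hi'.trans h
    · rw [map_zero]
      exact basisProj_of_disjoint B (hD i) fun i' hi' h' => h (hi'.symm.trans h')
  constructor
  · intro h g z hz hDz
    obtain ⟨w, hw, rfl⟩ := h z (Submodule.span_mono (Set.image_mono Set.inter_subset_left) hz) hDz
    exact ⟨_, basisProj_mem B hw, by
      rw [← hcomm, basisProj_of_mem B hz Set.inter_subset_right]⟩
  · intro h z hz hDz
    choose w hw hDw using fun g => h g _ (basisProj_mem B (S := ℓ ⁻¹' {g}) hz)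
      (by rw [← hcomm, hDz, map_zero])
    obtain ⟨S, hS⟩ := exists_sum_basisProj B ℓ z
    refine ⟨∑ g ∈ S, w g, sum_mem fun g _ =>
      Submodule.span_mono (Set.image_mono Set.inter_subset_left) (hw g), ?_⟩
    rw [map_sum, ← hS]
    exact Finset.sum_congr rfl fun g _ => hDw g

/-- Transfer of exactness along a chain map which sends a basis to a basis. -/
theorem exact_transfer {κ : Type*} (D : V →ₗ[k] V) (d : (κ →₀ k) →ₗ[k] (κ →₀ k))
    (Φ : (κ →₀ k) →ₗ[k] V) (f : κ → ι) {W W₀ W₁ : Set κ} {I₀ I₁ : Set ι}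
    (hf : Set.InjOn f W) (hΦ : ∀ F ∈ W, Φ (Finsupp.single F 1) = B (f F))
    (h₀ : W₀ ⊆ W) (h₁ : W₁ ⊆ W) (hI₀ : f '' W₀ = I₀) (hI₁ : f '' W₁ = I₁)
    (hd : ∀ u ∈ Finsupp.supported k k W, d u ∈ Finsupp.supported k k W)
    (hD : ∀ u ∈ Finsupp.supported k k W, D (Φ u) = Φ (d u)) :
    (∀ z ∈ Submodule.span k (B '' I₀), D z = 0 → ∃ w ∈ Submodule.span k (B '' I₁), D w = z) ↔
      ∀ z ∈ Finsupp.supported k k W₀, d z = 0 → ∃ w ∈ Finsupp.supported k k W₁, d w = z := by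
  -- In coordinates `Φ` is a relabelling along `f`, hence injective on what is supported in `W`.
  have hmap : ∀ u ∈ Finsupp.supported k k W, B.repr (Φ u) = Finsupp.mapDomain f u := by
    intro u hu
    rw [Finsupp.mem_supported] at hu
    conv_lhs => rw [← Finsupp.sum_single u, Finsupp.sum]
    rw [map_sum, map_sum, Finsupp.mapDomain, Finsupp.sum]
    refine Finset.sum_congr rfl fun F hF => ?_
    rw [← Finsupp.smul_single_one, map_smul, map_smul, hΦ F (hu hF), B.repr_self,
      Finsupp.smul_single_one]
  have hinj : ∀ u ∈ Finsupp.supported k k W, ∀ u' ∈ Finsupp.supported k k W, Φ u = Φ u' →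
      u = u' := by
    intro u hu u' hu' h
    refine Finsupp.mapDomain_injOn W hf ((Finsupp.mem_supported _ _).1 hu)
      ((Finsupp.mem_supported _ _).1 hu') ?_
    rw [← hmap u hu, ← hmap u' hu', h]
  have himg : ∀ {W' : Set κ}, W' ⊆ W → (Finsupp.supported k k W').map Φ =
      Submodule.span k (B '' (f '' W')) := by
    intro W' hW'
    rw [Finsupp.supported_eq_span_single, Submodule.map_span, Set.image_image, Set.image_image]
    congr 1
    exact Set.image_congr fun F hF => hΦ F (hW' hF)
  rw [← hI₀, ← hI₁, ← himg h₀, ← himg h₁]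
  have hm₀ := Finsupp.supported_mono (R := k) (M := k) h₀
  have hm₁ := Finsupp.supported_mono (R := k) (M := k) h₁
  constructor
  · intro h z hz hdz
    obtain ⟨_, ⟨w, hw, rfl⟩, hDw⟩ := h (Φ z) ⟨z, hz, rfl⟩ (by rw [hD z (hm₀ hz), hdz, map_zero])
    refine ⟨w, hw, hinj _ (hd w (hm₁ hw)) _ (hm₀ hz) ?_⟩
    rw [← hD w (hm₁ hw), hDw]
  · rintro h _ ⟨z, hz, rfl⟩ hDz
    obtain ⟨w, hw, rfl⟩ := h z hz (hinj _ (hd z (hm₀ hz)) _ (zero_mem _) (by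
      rw [← hD z (hm₀ hz), hDz, map_zero]))
    exact ⟨Φ w, ⟨w, hw, rfl⟩, hD w (hm₁ hw)⟩

end LinearAlgebra

end

noncomputable section

set_option linter.unusedSectionVars false

/-! ## The bar complex of a module with a basis of interval classes -/

namespace RedIncAlg

variable {P : Type u} [PartialOrder P] {s : Setoid (NonemptyInterval P)} [IntervalAxioms s]
  {k S O : Type*} [Field k] [Ring S] [Algebra k S] [Fintype O]

/-- A module over the associated graded algebra with a basis indexed by a set of classes of
intervals which is closed under composition from the right. -/
structure PathModule (A : MonomialAlgebra k S (Quotient s) O) (N : Type*) [AddCommGroup N]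
    [Module S N] [Module k N] where
  /-- the classes that index the basis -/
  T : Set (Quotient s)
  /-- the basis -/
  e : Module.Basis T k N
  /-- the basis elements, with junk values outside of `T` -/
  vec : Quotient s → N
  /-- the degrees of the basis elements -/
  r : Quotient s → ℕ
  vec_coe : ∀ α : T, vec α = e α
  nonid_of_mem : ∀ {α}, α ∈ T → Nonid α
  mul_eq_some : ∀ {α β γ}, A.mul α β = some γ ↔ comp α β = some γ ∧ A.deg γ = A.deg α + A.deg β
  deg_add_le : ∀ {α β γ}, comp α β = some γ → A.deg α + A.deg β ≤ A.deg γ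
  deg_pos_iff : ∀ {α}, 0 < A.deg α ↔ Nonid α
  tgt_eq_src_iff : ∀ {α β}, A.tgt α = A.src β ↔ tgtCls α = srcCls β
  mem_of_comp : ∀ {α β γ}, α ∈ T → comp α β = some γ → γ ∈ T
  r_add_le : ∀ {α β γ}, α ∈ T → comp α β = some γ → r α + A.deg β ≤ r γ
  b_smul_vec : ∀ {α β γ}, α ∈ T → comp α β = some γ →
    A.b β • vec α = if r γ = r α + A.deg β then vec γ else 0
  b_smul_vec_of_none : ∀ {α β}, α ∈ T → comp α β = none → A.b β • vec α = 0
  exists_path_deg : ∀ a b : P, a < b → ∃ l, IsPath b a l ∧ A.deg (between s a b) ≤ l.length + 1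
  exists_path_r : ∀ a b : P, a < b → between s a b ∈ T →
    ∃ l, IsPath b a l ∧ (∀ c ∈ l, between s a c ∈ T) ∧ r (between s a b) ≤ l.length

namespace PathModule

variable {A : MonomialAlgebra k S (Quotient s) O} {N : Type*} [AddCommGroup N]
  [Module S N] [Module k N] (M : PathModule A N)

/-- The points of an open interval which lie in the module. -/
def interval (x y : P) : Set P := {z | x < z ∧ z < y ∧ between s x z ∈ M.T}

/-- The weight of a chain in an interval. -/
def wt (y x : P) (F : Finset P) : ℕ := headWeight s M.r A.deg (gaps s y x (sortChain F))

/-- Only the first gap depends on the starting point. Here `w` is the first point of `l`, or `y` if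
there is none. -/
theorem exists_gaps_eq (y : P) (l : List P) : ∃ w c, (∀ a, gaps s y a l = between s a w :: c) ∧
    ∀ a, IsPath y a l → a < w := by
  cases l with
  | nil => exact ⟨y, [], fun _ => rfl, fun _ h => h⟩
  | cons b l => exact ⟨b, gaps s y b l, fun _ => rfl, fun _ h => h.1⟩

section Faces

variable {x y : P}

theorem isPath_of_face (hxy : x < y) {F : Finset P}
    (hF : F ∈ (OrdComplex.orderComplex (M.interval x y)).faces) : IsPath y x (sortChain F) := by
  rw [isPath_iff]
  refine ⟨hxy, pairwise_sortChain hF.2, fun b hb => ?_⟩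
  have := hF.1 (mem_sortChain.1 hb)
  exact ⟨this.1, this.2.1⟩

theorem mem_T_of_face {F : Finset P}
    (hF : F ∈ (OrdComplex.orderComplex (M.interval x y)).faces) :
    ∀ b ∈ sortChain F, between s x b ∈ M.T := fun _ hb => (hF.1 (mem_sortChain.1 hb)).2.2

open Classical in
theorem toFinset_mem_faces {l : List P} (h : IsPath y x l) (hT : ∀ b ∈ l, between s x b ∈ M.T) :
    l.toFinset ∈ (OrdComplex.orderComplex (M.interval x y)).faces := by
  rw [isPath_iff] at h
  constructor
  · intro b hb
    have hb : b ∈ l := by simpa using hb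
    exact ⟨(h.2.2 b hb).1, (h.2.2 b hb).2, hT b hb⟩
  · have := isChain_of_pairwise h.2.1
    simpa using this

/-- The weight of a face is the largest size of a face containing it. A larger face has size at most
its own weight, which is at most that of `F` by superadditivity; conversely `F` is refined until the
weight is attained. Through this the internal degree sees the sequential layers. -/
theorem wt_spec (hxy : x < y) (hT : between s x y ∈ M.T) :
    ∀ F ∈ (OrdComplex.orderComplex (M.interval x y)).faces, ∀ j : ℕ,
      (∃ G ∈ (OrdComplex.orderComplex (M.interval x y)).faces, F ⊆ G ∧ j ≤ G.card) ↔
        j ≤ M.wt y x F := by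
  classical
  intro F hF j
  constructor
  · rintro ⟨G, hG, hFG, hj⟩
    have h1 := M.isPath_of_face hxy hG
    have h2 := length_le_headWeight (ρ := M.r) (deg := A.deg)
      (fun α hα => M.deg_pos_iff.2 hα) h1
    have h3 := headWeight_gaps_sublist (deg := A.deg) (ρ := M.r) (T := M.T) M.deg_add_le M.r_add_le h1
      (M.mem_T_of_face hG) (sublist_sortChain hG.2 hFG)
    rw [length_sortChain] at h2
    exact (hj.trans h2).trans h3
  · intro hj
    obtain ⟨l, h1, h2, h3, h4⟩ := exists_refinement (deg := A.deg) (ρ := M.r) (T := M.T)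
      M.exists_path_deg M.exists_path_r (M.isPath_of_face hxy hF) hT (M.mem_T_of_face hF) M.mem_of_comp
    refine ⟨l.toFinset, M.toFinset_mem_faces h2 h3, fun a ha => ?_, ?_⟩
    · rw [List.mem_toFinset]
      exact h1.subset (mem_sortChain.2 ha)
    · rw [List.toFinset_card_of_nodup ((isPath_iff.1 h2).2.1.imp fun h => ne_of_lt h)]
      exact hj.trans h4

theorem wt_le (hxy : x < y) :
    ∀ F ∈ (OrdComplex.orderComplex (M.interval x y)).faces, M.wt y x F ≤ M.r (between s x y) := by
  intro F hF
  have := headWeight_gaps_sublist (deg := A.deg) (ρ := M.r) (T := M.T) M.deg_add_le M.r_add_le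
    (M.isPath_of_face hxy hF) (M.mem_T_of_face hF) (List.nil_sublist _)
  simpa [gaps, headWeight, wt] using this

end Faces

section Differential

variable (n : N) (y : P)

/-- The element of the bar complex corresponding to a list of classes whose head is in the
module. -/
def codeVec : List (Quotient s) → (List (Quotient s) →₀ N)
  | [] => 0
  | α :: c => Finsupp.single c (M.vec α)

/-- The map from simplicial chains to the bar complex, in a given weight. -/
def chainMap (x : P) (j : ℕ) : (Finset P →₀ k) →ₗ[k] (List (Quotient s) →₀ N) :=
  Finsupp.linearCombination k fun F =>
    if M.wt y x F = j then M.codeVec (gaps s y x (sortChain F)) else 0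

variable (k A) in
/-- The map from simplicial chains to lists of classes with a fixed coefficient, in a given
weight. -/
def gapMap (a : P) (j : ℕ) : (Finset P →₀ k) →ₗ[k] (List (Quotient s) →₀ N) :=
  Finsupp.linearCombination k fun F =>
    if ((gaps s y a (sortChain F)).map A.deg).sum = j
      then Finsupp.single (gaps s y a (sortChain F)) n else 0

theorem chainMap_single (x : P) (j : ℕ) (F : Finset P) (t : k) :
    M.chainMap y x j (Finsupp.single F t) =
      if M.wt y x F = j then t • M.codeVec (gaps s y x (sortChain F)) else 0 := by
  rw [chainMap, Finsupp.linearCombination_single, smul_ite, smul_zero]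

theorem gapMap_single (a : P) (j : ℕ) (F : Finset P) (t : k) :
    gapMap k A n y a j (Finsupp.single F t) =
      if ((gaps s y a (sortChain F)).map A.deg).sum = j
        then Finsupp.single (gaps s y a (sortChain F)) (t • n) else 0 := by
  rw [gapMap, Finsupp.linearCombination_single, smul_ite, smul_zero, Finsupp.smul_single]

theorem hom_ext_supported {κ X : Type*} [AddCommGroup X] {W : Set κ} {f g : (κ →₀ k) →+ X}
    (h : ∀ F ∈ W, ∀ t : k, f (Finsupp.single F t) = g (Finsupp.single F t)) {u : κ →₀ k}
    (hu : u ∈ Finsupp.supported k k W) : f u = g u := by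
  rw [Finsupp.mem_supported] at hu
  rw [← Finsupp.sum_single u, Finsupp.sum, map_sum, map_sum]
  exact Finset.sum_congr rfl fun F hF => h F (hu hF) _

theorem boundary_mem_above {b : P} {F : Finset P} (h : ∀ c ∈ F, b < c) (t : k) :
    OrdComplex.boundary k P (Finsupp.single F t) ∈
      Finsupp.supported k k {F : Finset P | ∀ c ∈ F, b < c} := by
  classical
  refine OrdComplex.boundary_mem_supported (s := {F | ∀ c ∈ F, b < c})
    (t := {F | ∀ c ∈ F, b < c}) (fun F hF w _ c hc => hF c (Finset.mem_of_mem_erase hc)) ?_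
  exact Finsupp.single_mem_supported k t h

/-- Prepending the letter of `[a, b]` corresponds to adding the least vertex `b`, and shifts the
prescribed weight by the degree of that letter. -/
theorem consHom_gapMap {a b : P} (j : ℕ) {u : Finset P →₀ k}
    (hu : u ∈ Finsupp.supported k k {F : Finset P | ∀ c ∈ F, b < c}) :
    MonomialAlgebra.consHom N (between s a b) (gapMap k A n y b j u) =
      gapMap k A n y a (A.deg (between s a b) + j) (OrdComplex.cone k b u) := by
  refine hom_ext_supported (f := (MonomialAlgebra.consHom N (between s a b)).comp
    (gapMap k A n y b j).toAddMonoidHom) (g := ((gapMap k A n y a (A.deg (between s a b) + j)).comp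
      (OrdComplex.cone k b)).toAddMonoidHom) (fun F hF t => ?_) hu
  simp only [AddMonoidHom.comp_apply, LinearMap.toAddMonoidHom_coe, LinearMap.comp_apply,
    OrdComplex.cone_single]
  rw [gapMap_single, gapMap_single, sortChain_insert hF, gaps, List.map_cons, List.sum_cons]
  simp only [Nat.add_left_cancel_iff]
  split_ifs <;> simp

/-- If `b` is the first vertex of a face, the class of `[x, b]` is the module coefficient and not a
letter, so the shift is by its rank `r`. -/
theorem codeVec_cons_chainMap {x b : P} (j : ℕ) {u : Finset P →₀ k}
    (hu : u ∈ Finsupp.supported k k {F : Finset P | ∀ c ∈ F, b < c}) :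
    gapMap k A (M.vec (between s x b)) y b j u =
      M.chainMap y x (M.r (between s x b) + j) (OrdComplex.cone k b u) := by
  refine hom_ext_supported (f := (gapMap k A (M.vec (between s x b)) y b j).toAddMonoidHom)
    (g := ((M.chainMap y x (M.r (between s x b) + j)).comp
      (OrdComplex.cone k b)).toAddMonoidHom) (fun F hF t => ?_) hu
  simp only [LinearMap.toAddMonoidHom_coe, LinearMap.comp_apply, OrdComplex.cone_single]
  rw [gapMap_single, chainMap_single, wt, sortChain_insert hF, gaps, headWeight, codeVec]
  simp only [Nat.add_left_cancel_iff, Finsupp.smul_single]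

-- Merging the gaps on both sides of `b` omits `b`. The graded product keeps the result only if the
-- degrees add up, that is, if the total degree of the list is unchanged.
include M in
theorem mergeHom_gaps {a b : P} {l : List P} (hab : a < b) (h : IsPath y b l) :
    A.mergeHom N (between s a b) (Finsupp.single (gaps s y b l) n) =
      if ((gaps s y a l).map A.deg).sum =
          A.deg (between s a b) + ((gaps s y b l).map A.deg).sum
        then Finsupp.single (gaps s y a l) n else 0 := by
  obtain ⟨w, c, hw, hlt⟩ := exists_gaps_eq (s := s) y l
  have hc := comp_between (s := s) hab.le (hlt b h).le
  rw [hw, hw, MonomialAlgebra.mergeHom_single_cons, List.map_cons, List.map_cons, List.sum_cons,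
    List.sum_cons, ← add_assoc]
  simp only [Nat.add_right_cancel_iff]
  cases hm : A.mul (between s a b) (between s b w) with
  | none =>
    rw [if_neg, Option.elim_none]
    intro h'
    rw [M.mul_eq_some.2 ⟨hc, h'⟩] at hm
    cases hm
  | some γ =>
    rw [M.mul_eq_some, hc, Option.some.injEq] at hm
    obtain ⟨rfl, hm⟩ := hm
    rw [if_pos hm, Option.elim_some]

-- Induction on the least vertex: merging along the first letter follows the same recursion as the
-- simplicial boundary of a cone. Faces whose weight jumps are discarded by `gapMap`, just as the
-- corresponding products vanish in the graded algebra.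
include M in
theorem delHom_gaps {F : Finset P} (hF : IsChain (· ≤ ·) (F : Set P)) :
    ∀ a : P, IsPath y a (sortChain F) →
      A.delHom N (Finsupp.single (gaps s y a (sortChain F)) n) =
        gapMap k A n y a ((gaps s y a (sortChain F)).map A.deg).sum
          (OrdComplex.boundary k P (Finsupp.single F 1)) := by
  classical
  refine OrdComplex.chain_induction (motive := fun F => ∀ a : P, IsPath y a (sortChain F) →
      A.delHom N (Finsupp.single (gaps s y a (sortChain F)) n) =
        gapMap k A n y a ((gaps s y a (sortChain F)).map A.deg).sum
          (OrdComplex.boundary k P (Finsupp.single F 1))) ?_ ?_ F hF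
  · intro a _
    rw [OrdComplex.boundary_single]
    simp only [sortChain_empty, gaps, Finset.sum_empty, smul_zero, map_zero]
    rw [← MonomialAlgebra.consHom_single, MonomialAlgebra.delHom_consHom]
    simp
  · intro b F hb _ ih a ha
    have hs : sortChain (insert b F) = b :: sortChain F := sortChain_insert hb
    have hs' : ∀ [DecidableEq P], sortChain (insert b F) = b :: sortChain F := by
      intro; convert hs
    rw [hs'] at ha ⊢
    rw [gaps, ← MonomialAlgebra.consHom_single, MonomialAlgebra.delHom_consHom, ih b ha.2,
      M.mergeHom_gaps n y ha.1 ha.2, consHom_gapMap n y _ (boundary_mem_above hb _)]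
    have hb' := OrdComplex.boundary_single_insert k hb 1
    rw [show OrdComplex.boundary k P (Finsupp.single (insert b F) 1) = _ from hb', map_sub,
      gapMap_single, List.map_cons, List.sum_cons, one_smul]

/-- The bar differential is the weight-preserving part of the simplicial boundary. Omitting the
first vertex lets the first letter act on the coefficient, and omitting a later one merges two
letters. -/
theorem D_codeVec {x : P} (hxy : x < y) {F : Finset P}
    (hF : F ∈ (OrdComplex.orderComplex (M.interval x y)).faces) :
    A.D N (M.codeVec (gaps s y x (sortChain F))) =
      M.chainMap y x (M.wt y x F) (OrdComplex.boundary k P (Finsupp.single F 1)) := by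
  classical
  have key : ∀ F : Finset P, IsChain (· ≤ ·) (F : Set P) → IsPath y x (sortChain F) →
      (∀ b ∈ sortChain F, between s x b ∈ M.T) →
      A.D N (M.codeVec (gaps s y x (sortChain F))) =
        M.chainMap y x (M.wt y x F) (OrdComplex.boundary k P (Finsupp.single F 1)) := by
    intro F hF
    refine OrdComplex.chain_induction (motive := fun F => IsPath y x (sortChain F) →
      (∀ b ∈ sortChain F, between s x b ∈ M.T) →
      A.D N (M.codeVec (gaps s y x (sortChain F))) =
        M.chainMap y x (M.wt y x F) (OrdComplex.boundary k P (Finsupp.single F 1))) ?_ ?_ F hF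
    · intro _ _
      rw [OrdComplex.boundary_single]
      simp [gaps, codeVec]
    · intro b F hb hF _ ha hT
      have hs' : ∀ [DecidableEq P], sortChain (insert b F) = b :: sortChain F := by
        intro; convert sortChain_insert hb
      have hb' : OrdComplex.boundary k P (Finsupp.single (insert b F) 1) = _ :=
        OrdComplex.boundary_single_insert k hb 1
      rw [hb', wt, hs'] at *
      obtain ⟨w, c, hw, hlt⟩ := exists_gaps_eq (s := s) y (sortChain F)
      have hc := comp_between (s := s) ha.1.le (hlt b ha.2).le
      have hbT : between s x b ∈ M.T := hT b (by simp)
      rw [gaps, codeVec, MonomialAlgebra.D, AddMonoidHom.sub_apply,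
        M.delHom_gaps _ y hF b ha.2, M.codeVec_cons_chainMap y _ (boundary_mem_above hb _), map_sub]
      congr 1
      rw [chainMap_single, one_smul, wt, hw, hw, ← MonomialAlgebra.consHom_single,
        MonomialAlgebra.actHom_consHom, MonomialAlgebra.smulHom_single, M.b_smul_vec hbT hc]
      simp only [headWeight, codeVec, List.map_cons, List.sum_cons, ← add_assoc,
        Nat.add_right_cancel_iff]
      split_ifs <;> simp
  exact key F hF.2 (M.isPath_of_face hxy hF) (M.mem_T_of_face hF)

theorem chainMap_weightPart (x : P) (j : ℕ) (u : Finset P →₀ k) :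
    M.chainMap y x j (OrdComplex.weightPart k (M.wt y x) j u) = M.chainMap y x j u := by
  classical
  rw [← Finsupp.sum_single u, Finsupp.sum]
  simp only [map_sum]
  refine Finset.sum_congr rfl fun F _ => ?_
  have h : OrdComplex.weightPart k (M.wt y x) j (Finsupp.single F (u F)) =
      if M.wt y x F = j then Finsupp.single F (u F) else 0 := by
    ext G
    rw [OrdComplex.weightPart_apply]
    by_cases hFG : F = G
    · subst hFG; split_ifs <;> rfl
    · rw [Finsupp.single_eq_of_ne (Ne.symm hFG)]
      split_ifs <;> simp [Finsupp.single_eq_of_ne (Ne.symm hFG)]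
  rw [h]
  split_ifs with h'
  · rfl
  · rw [map_zero, chainMap_single, if_neg h']

end Differential

end PathModule

end RedIncAlg

end

/-! ### Splitting the bar complex by composites and comparing it with relative simplicial chains -/

noncomputable section

set_option linter.unusedSectionVars false

namespace RedIncAlg

variable {P : Type u} [PartialOrder P] {s : Setoid (NonemptyInterval P)} [IntervalAxioms s]
  {k S O : Type*} [Field k] [Ring S] [Algebra k S] [Fintype O]

namespace PathModule

variable {A : MonomialAlgebra k S (Quotient s) O} {N : Type*} [AddCommGroup N]
  [Module S N] [Module k N] (M : PathModule A N)

section Basis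

/-- The basis of the bar complex. -/
def barBasis : Module.Basis (Σ _ : List (Quotient s), M.T) k (List (Quotient s) →₀ N) :=
  Finsupp.basis fun _ => M.e

theorem barBasis_apply (ix : Σ _ : List (Quotient s), M.T) :
    M.barBasis ix = Finsupp.single ix.1 (M.vec ix.2) := by
  rw [barBasis, Finsupp.coe_basis, vec_coe]

/-- The index set of the basis of the bar complex in given homological and internal degrees. -/
def barIndex (i : ℕ) (j : ℤ) : Set (Σ _ : List (Quotient s), M.T) :=
  {ix | A.Valid ix.1 ∧ ix.1.length = i ∧ (∀ β ∈ ix.1.head?, A.tgt ix.2 = A.src β) ∧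
    (M.r ix.2 : ℤ) + A.listDeg ix.1 = j}

/-- The composite of all classes. -/
def label (ix : Σ _ : List (Quotient s), M.T) : Option (Quotient s) := compList s ix.2 ix.1

-- By associativity, merging neighbouring letters does not affect the composite. It is stated for
-- all starting classes at once so that the induction survives prepending a letter.
include M in
theorem delHom_single_mem (n : N) (c : List (Quotient s)) :
    A.delHom N (Finsupp.single c n) ∈ AddSubgroup.closure
      ((fun c' => Finsupp.single c' n) '' {c' | ∀ α, compList s α c' = compList s α c}) := by
  induction c with
  | nil => simp
  | cons β c ih =>
    rw [← MonomialAlgebra.consHom_single, MonomialAlgebra.delHom_consHom]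
    refine sub_mem ?_ ?_
    · cases c with
      | nil => simp
      | cons β' c =>
        rw [MonomialAlgebra.mergeHom_single_cons]
        cases h : A.mul β β' with
        | none => exact zero_mem _
        | some γ =>
          refine AddSubgroup.subset_closure ⟨γ :: c, fun α => ?_, rfl⟩
          rw [compList_cons_cons, (M.mul_eq_some.1 h).1, Option.bind_some]
    · generalize A.delHom N (Finsupp.single c n) = z at ih ⊢
      induction ih using AddSubgroup.closure_induction with
      | zero => simp
      | add x y _ _ hx hy => rw [map_add]; exact add_mem hx hy
      | neg x _ hx => rw [map_neg]; exact neg_mem hx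
      | mem x hx =>
        obtain ⟨c', hc', rfl⟩ := hx
        rw [MonomialAlgebra.consHom_single]
        refine AddSubgroup.subset_closure ⟨β :: c', fun α => ?_, rfl⟩
        simp only [compList, hc' _]

theorem D_barBasis_mem (ix : Σ _ : List (Quotient s), M.T) :
    A.D N (M.barBasis ix) ∈ Submodule.span k (M.barBasis '' {ix' | M.label ix' = M.label ix}) := by
  obtain ⟨c, α⟩ := ix
  rw [barBasis_apply, MonomialAlgebra.D, AddMonoidHom.sub_apply]
  refine sub_mem ?_ ?_
  · cases c with
    | nil => simp
    | cons β c =>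
      rw [← MonomialAlgebra.consHom_single, MonomialAlgebra.actHom_consHom,
        MonomialAlgebra.smulHom_single]
      cases h : comp α.1 β with
      | none => rw [M.b_smul_vec_of_none α.2 h, Finsupp.single_zero]; exact zero_mem _
      | some γ =>
        rw [M.b_smul_vec α.2 h]
        split_ifs
        · refine Submodule.subset_span ⟨⟨c, γ, M.mem_of_comp α.2 h⟩, ?_, M.barBasis_apply _⟩
          change compList s γ c = compList s α (β :: c)
          rw [compList, h, Option.bind_some]
        · rw [Finsupp.single_zero]; exact zero_mem _
  · refine AddSubgroup.closure_induction (fun x hx => ?_) (zero_mem _)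
      (fun x y _ _ hx hy => add_mem hx hy) (fun x _ hx => neg_mem hx)
      (M.delHom_single_mem (M.vec α) c)
    obtain ⟨c', hc', rfl⟩ := hx
    exact Submodule.subset_span ⟨⟨c', α⟩, hc' α, M.barBasis_apply _⟩

end Basis

section Codes

variable {M}

open Classical in
/-- The index of a list of classes whose head is in the module. -/
def toIndex (M : PathModule A N) (t : M.T) : List (Quotient s) → Σ _ : List (Quotient s), M.T
  -- The argument `t` is only a default value for lists whose head is missing or not in the module.
  | [] => ⟨[], t⟩
  | α :: c => if h : α ∈ M.T then ⟨c, α, h⟩ else ⟨[], t⟩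

theorem toIndex_cons (t : M.T) {α : Quotient s} (h : α ∈ M.T) (c : List (Quotient s)) :
    M.toIndex t (α :: c) = ⟨c, α, h⟩ := dif_pos h

theorem exists_gaps_eq_of_mem {x y : P} {l : List P} (h : IsPath y x l)
    (hy : between s x y ∈ M.T) (hT : ∀ b ∈ l, between s x b ∈ M.T) :
    ∃ α c, gaps s y x l = α :: c ∧ α ∈ M.T ∧ compList s α c = some (between s x y) := by
  obtain ⟨α, c, hα, h'⟩ : ∃ α c, α ∈ M.T ∧ gaps s y x l = α :: c := by
    cases l with
    | nil => exact ⟨_, _, hy, rfl⟩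
    | cons b l => exact ⟨_, _, hT b (by simp), rfl⟩
  refine ⟨α, c, h', hα, ?_⟩
  have h1 := compList_gaps (s := s) le_rfl h
  have h2 := head_gaps (s := s) h α (by rw [h']; rfl)
  rw [h', compList, between_eq le_rfl, ← h2, srcCls_comp_self, Option.bind_some] at h1
  exact h1

include M in
theorem valid_iff {c : List (Quotient s)} : A.Valid c ↔
    (∀ α ∈ c, Nonid α) ∧ c.IsChain fun α β => tgtCls α = srcCls β := by
  unfold MonomialAlgebra.Valid
  simp only [M.deg_pos_iff, M.tgt_eq_src_iff]

theorem srcCls_compList {α γ : Quotient s} {c : List (Quotient s)}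
    (h : compList s α c = some γ) : srcCls γ = srcCls α := by
  induction c generalizing α with
  | nil => rw [compList, Option.some.injEq] at h; rw [h]
  | cons β c ih =>
    rw [compList, Option.bind_eq_some_iff] at h
    obtain ⟨δ, hδ, h⟩ := h
    rw [ih h, srcCls_comp hδ]

/-- This is the dictionary: vertices count letters, the weight is the internal degree, and the
interval is the composite. Surjectivity realizes a list of classes by a chain inside `[x, y]`. -/
theorem toIndex_image {x y : P} (hxy : x < y) (hT : between s x y ∈ M.T) (i j : ℕ) :
    (fun F => M.toIndex ⟨_, hT⟩ (gaps s y x (sortChain F))) ''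
      OrdComplex.weightFaces (OrdComplex.orderComplex (M.interval x y)) (M.wt y x) i j =
      M.barIndex i j ∩ M.label ⁻¹' {some (between s x y)} := by
  classical
  ext ⟨c, α, hα⟩
  constructor
  · rintro ⟨F, ⟨hF, hi, hj⟩, h⟩
    have hp := M.isPath_of_face hxy hF
    obtain ⟨α', c', h1, h2, h3⟩ := exists_gaps_eq_of_mem hp hT (M.mem_T_of_face hF)
    simp only [h1, toIndex_cons _ h2] at h
    obtain rfl : c' = c := congrArg Sigma.fst h
    obtain rfl : α' = α := congrArg (fun ix : Σ _ : List (Quotient s), M.T => ix.2.1) h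
    have hv : A.Valid (α' :: c') :=
      (valid_iff (M := M)).2 ⟨h1 ▸ nonid_of_mem_gaps hp, h1 ▸ isChain_gaps hp⟩
    rw [MonomialAlgebra.valid_cons] at hv
    refine ⟨⟨hv.2.1, ?_, hv.2.2, ?_⟩, h3⟩
    · have := congrArg List.length h1
      rw [gaps_length, length_sortChain, List.length_cons, hi] at this
      exact (Nat.succ_injective this).symm
    · rw [wt, h1, headWeight] at hj
      rw [← hj]
      exact (Nat.cast_add _ _).symm
  · rintro ⟨⟨hv, hi, hc, hj⟩, h⟩
    have h' : compList s α c = some (between s x y) := h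
    have h1 : cls s (le_refl x) = srcCls α := by
      rw [← srcCls_compList h', between_eq hxy.le]; rfl
    have hval : A.Valid (α :: c) :=
      MonomialAlgebra.valid_cons _ |>.2 ⟨M.deg_pos_iff.2 (M.nonid_of_mem hα), hv, hc⟩
    -- The identity class is put in front so that the realizing chain also has a gap for `α`. Its
    -- starting point is then forced to be `x`.
    have h2 : compList s (cls s (le_refl x)) (α :: c) = some (cls s hxy.le) := by
      rw [compList, h1, srcCls_comp_self, Option.bind_some, h', between_eq hxy.le]
    obtain ⟨z, hxz, hz, h3⟩ := exists_path_of_compList ((valid_iff (M := M)).1 hval).1 h2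
    obtain rfl : x = z := eq_of_cls_eq_refl hxz hz
    obtain ⟨l, hl, hg⟩ := h3.resolve_left fun h => List.cons_ne_nil _ _ h.1
    -- Only the first point is in the module by assumption; the others follow from closure under
    -- composition.
    have hlT : ∀ b ∈ l, between s x b ∈ M.T := by
      cases l with
      | nil => simp
      | cons b l =>
        rw [gaps, List.cons.injEq] at hg
        have hb : between s x b ∈ M.T := hg.1 ▸ hα
        intro b' hb'
        rcases List.mem_cons.1 hb' with rfl | hb'
        · exact hb
        · exact M.mem_of_comp hb
            (comp_between hl.1.le ((isPath_iff.1 hl.2).2.2 b' hb').1.le)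
    have hs : sortChain l.toFinset = l := sortChain_toFinset (isPath_iff.1 hl).2.1
    refine ⟨l.toFinset, ⟨M.toFinset_mem_faces hl hlT, ?_, ?_⟩, ?_⟩
    · have := congrArg List.length hg
      rw [gaps_length, List.length_cons] at this
      rw [← length_sortChain, hs, ← hi]
      exact Nat.succ_injective this
    · rw [wt, hs, hg, headWeight]
      have hj' : (M.r α : ℤ) + A.listDeg c = j := hj
      rw [MonomialAlgebra.listDeg] at hj'
      exact_mod_cast hj'
    · simp only [hs, hg, toIndex_cons _ hα]

theorem toIndex_injOn {x y : P} (hxy : x < y) (hT : between s x y ∈ M.T) :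
    Set.InjOn (fun F => M.toIndex ⟨_, hT⟩ (gaps s y x (sortChain F)))
      (OrdComplex.orderComplex (M.interval x y)).faces := by
  classical
  intro F hF F' hF' h
  have hp := M.isPath_of_face hxy hF
  have hp' := M.isPath_of_face hxy hF'
  obtain ⟨α, c, h1, h2, -⟩ := exists_gaps_eq_of_mem hp hT (M.mem_T_of_face hF)
  obtain ⟨α', c', h1', h2', -⟩ := exists_gaps_eq_of_mem hp' hT (M.mem_T_of_face hF')
  simp only [h1, h1', toIndex_cons _ h2, toIndex_cons _ h2'] at h
  obtain rfl : c = c' := congrArg Sigma.fst h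
  obtain rfl : α = α' := congrArg (fun ix : Σ _ : List (Quotient s), M.T => ix.2.1) h
  have h3 := (eq_of_gaps_eq (s := s) le_rfl le_rfl hp hp' rfl (h1.trans h1'.symm)).2
  rw [← toFinset_sortChain F, h3, toFinset_sortChain]

end Codes

section Exact

variable [IsScalarTower k S N] {M}

/-- The bar differential as a linear map. -/
def barD (_M : PathModule A N) : (List (Quotient s) →₀ N) →ₗ[k] (List (Quotient s) →₀ N) where
  toFun := A.D N
  map_add' := map_add _
  map_smul' t u := by
    -- Multiplication by a scalar is `S`-linear, so linearity of the differential over `k` is an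
    -- instance of its naturality.
    have h := A.D_barMap (t • (LinearMap.id : N →ₗ[S] N)) u
    have h' : ∀ u : List (Quotient s) →₀ N,
        MonomialAlgebra.barMap (t • (LinearMap.id : N →ₗ[S] N)) u = t • u := by
      intro u; ext c; simp
    rwa [h', h'] at h

/-- A composable list always has a composite, even if its product in the graded algebra is zero;
this rests on concatenation through `comp_eq_none`. Hence only labels in the module contribute. -/
theorem label_of_mem_barIndex {i : ℕ} {j : ℤ} {ix : Σ _ : List (Quotient s), M.T}
    (h : ix ∈ M.barIndex i j) : ∃ γ ∈ M.T, M.label ix = some γ := by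
  obtain ⟨c, α, hα⟩ := ix
  obtain ⟨hv, -, hc, -⟩ := h
  dsimp only at hv hc
  unfold label
  dsimp only
  clear j i
  induction c generalizing α with
  | nil => exact ⟨α, hα, rfl⟩
  | cons β c ih =>
    have h1 := hc β rfl
    rw [M.tgt_eq_src_iff] at h1
    cases h2 : comp α β with
    | none => exact absurd h1 (comp_eq_none.1 h2)
    | some γ =>
      rw [MonomialAlgebra.valid_cons] at hv
      obtain ⟨δ, h3, h4⟩ := ih γ (M.mem_of_comp hα h2) hv.2.1 fun β' h' => by
        rw [M.tgt_eq_src_iff, tgtCls_comp h2, ← M.tgt_eq_src_iff]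
        exact hv.2.2 β' h'
      exact ⟨δ, h3, by rw [compList, h2, Option.bind_some, h4]⟩

/-- Exactness of the bar complex in the basis of lists of classes. -/
def BasisExact (M : PathModule A N) (i : ℕ) (j : ℤ) : Prop :=
  ∀ z ∈ Submodule.span k (M.barBasis '' M.barIndex i j), M.barD z = 0 →
    ∃ w ∈ Submodule.span k (M.barBasis '' M.barIndex (i + 1) j), M.barD w = z

/-- On faces of weight `j`, `chainMap` is a bijection of bases and intertwines the bar differential
with the weight `j` part of the boundary, which is the differential of a layer modulo the next one.
-/
theorem label_exact_iff {x y : P} (hxy : x < y) (hT : between s x y ∈ M.T) (i j : ℕ) :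
    (∀ z ∈ Submodule.span k (M.barBasis '' (M.barIndex i j ∩ M.label ⁻¹' {some (between s x y)})),
      M.barD z = 0 → ∃ w ∈ Submodule.span k
        (M.barBasis '' (M.barIndex (i + 1) j ∩ M.label ⁻¹' {some (between s x y)})),
        M.barD w = z) ↔
      OrdComplex.RelExact k (OrdComplex.orderComplex (M.interval x y)) (M.wt y x) i j := by
  classical
  refine exact_transfer M.barBasis M.barD
    ((OrdComplex.weightPart k (M.wt y x) j).comp (OrdComplex.boundary k P)) (M.chainMap y x j)
    (fun F => M.toIndex ⟨_, hT⟩ (gaps s y x (sortChain F)))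
    (W := {F | F ∈ (OrdComplex.orderComplex (M.interval x y)).faces ∧ M.wt y x F = j})
    ((toIndex_injOn hxy hT).mono fun F hF => hF.1) ?_ (fun F hF => ⟨hF.1, hF.2.2⟩)
    (fun F hF => ⟨hF.1, hF.2.2⟩) (toIndex_image hxy hT i j) (toIndex_image hxy hT (i + 1) j) ?_ ?_
  · rintro F ⟨hF, hj⟩
    obtain ⟨α, c, h1, h2, -⟩ := exists_gaps_eq_of_mem (M.isPath_of_face hxy hF) hT
      (M.mem_T_of_face hF)
    rw [chainMap_single, if_pos hj, one_smul, h1, toIndex_cons _ h2, barBasis_apply]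
    rfl
  · intro u hu
    have h1 := OrdComplex.boundary_mem_supported (k := k)
      (t := (OrdComplex.orderComplex (M.interval x y)).faces)
      (fun F hF w _ => OrdComplex.down_closed _ F hF.1 _ (F.erase_subset w)) hu
    rw [Finsupp.mem_supported'] at h1 ⊢
    intro F hF
    rw [LinearMap.comp_apply, OrdComplex.weightPart_apply]
    split_ifs with h
    · exact h1 F fun h' => hF ⟨h', h⟩
    · rfl
  · intro u hu
    rw [LinearMap.comp_apply, chainMap_weightPart]
    refine hom_ext_supported (f := (M.barD.comp (M.chainMap y x j)).toAddMonoidHom)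
      (g := ((M.chainMap y x j).comp (OrdComplex.boundary k P)).toAddMonoidHom)
      (fun F hF t => ?_) hu
    simp only [LinearMap.toAddMonoidHom_coe]
    rw [← Finsupp.smul_single_one, map_smul, map_smul]
    congr 1
    rw [LinearMap.comp_apply, LinearMap.comp_apply, chainMap_single, if_pos hF.2, one_smul]
    have := M.D_codeVec y hxy hF.1
    rw [hF.2] at this
    exact this

theorem basisExact_iff (i j : ℕ) : M.BasisExact i j ↔
    ∀ x y : P, x ≤ y → between s x y ∈ M.T →
      OrdComplex.RelExact k (OrdComplex.orderComplex (M.interval x y)) (M.wt y x) i j := by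
  unfold BasisExact
  rw [exact_iff_forall_label M.barBasis M.barD M.label M.D_barBasis_mem]
  constructor
  · intro h x y hxy hT
    have hlt : x < y := by
      have := M.nonid_of_mem hT
      rwa [between_eq hxy, nonid_cls] at this
    exact (label_exact_iff hlt hT i j).1 (h _)
  · intro h g
    by_cases hg : ∃ γ ∈ M.T, g = some γ
    · obtain ⟨γ, hγ, rfl⟩ := hg
      obtain ⟨x, y, hxy, rfl⟩ := exists_cls γ
      rw [← between_eq hxy] at hγ ⊢
      have hlt : x < y := by
        have := M.nonid_of_mem hγ
        rwa [between_eq hxy, nonid_cls] at this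
      exact (label_exact_iff hlt hγ i j).2 (h x y hxy hγ)
    · have he : M.barIndex i j ∩ M.label ⁻¹' {g} = ∅ := by
        rw [Set.eq_empty_iff_forall_notMem]
        rintro ix ⟨h1, h2⟩
        obtain ⟨γ, h3, h4⟩ := label_of_mem_barIndex h1
        exact hg ⟨γ, h3, h2.symm.trans h4⟩
      intro z hz _
      rw [he, Set.image_empty, Submodule.span_empty, Submodule.mem_bot] at hz
      exact ⟨0, zero_mem _, by rw [map_zero, hz]⟩

/-- Every letter has positive degree, so `i` letters have total degree at least `i` and nothing
lives below the diagonal. -/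
theorem barIndex_eq_empty {i : ℕ} {j : ℤ} (h : j < i) : M.barIndex i j = ∅ := by
  rw [Set.eq_empty_iff_forall_notMem]
  rintro ⟨c, α⟩ ⟨h1, h2, -, h3⟩
  dsimp only at h1 h2 h3
  have : c.length ≤ A.listDeg c := by
    rw [MonomialAlgebra.listDeg, ← List.length_map (f := A.deg)]
    refine List.length_le_sum_of_one_le _ fun d hd => ?_
    obtain ⟨β, hβ, rfl⟩ := List.mem_map.1 hd
    exact h1.1 β hβ
  omega

theorem basisExact_of_lt {i : ℕ} {j : ℤ} (h : j < i) : M.BasisExact i j := by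
  intro z hz _
  rw [barIndex_eq_empty h, Set.image_empty, Submodule.span_empty, Submodule.mem_bot] at hz
  exact ⟨0, zero_mem _, by rw [map_zero, hz]⟩

/-- Exactness of the bar complex off the diagonal is sequential acyclicity of all the intervals. -/
theorem forall_basisExact_iff : (∀ (i : ℕ) (j : ℤ), j ≠ i → M.BasisExact i j) ↔
    ∀ x y : P, x ≤ y → between s x y ∈ M.T →
      (OrdComplex.orderComplex (M.interval x y)).IsSequentiallyAcyclic k := by
  have hlt : ∀ {x y : P}, x ≤ y → between s x y ∈ M.T → x < y := fun hxy hT => by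
    have := M.nonid_of_mem hT
    rwa [between_eq hxy, nonid_cls] at this
  constructor
  · intro h x y hxy hT
    rw [OrdComplex.isSequentiallyAcyclic_iff_relExact (M.wt_spec (hlt hxy hT) hT)
      (M.wt_le (hlt hxy hT))]
    intro i j hij
    exact (basisExact_iff i j).1 (h i j (by omega)) x y hxy hT
  · intro h i j hij
    rcases lt_or_gt_of_ne hij with h1 | h1
    · exact basisExact_of_lt h1
    · lift j to ℕ using by omega
      refine (basisExact_iff i j).2 fun x y hxy hT => ?_
      exact (OrdComplex.isSequentiallyAcyclic_iff_relExact (M.wt_spec (hlt hxy hT) hT)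
        (M.wt_le (hlt hxy hT))).1 (h x y hxy hT) i j (by omega)

end Exact

section Bar

variable [IsScalarTower k S N] (G : A.Grading N)
  (hG : ∀ α ∈ M.T, ∀ j : ℤ, G.p j (M.vec α) = if (M.r α : ℤ) = j then M.vec α else 0)

theorem idn_smul_vec {α : Quotient s} (hα : α ∈ M.T) (o : O) [Decidable (A.tgt α = o)] :
    A.b (A.idn o) • M.vec α = if A.tgt α = o then M.vec α else 0 := by
  split_ifs with h
  · have h1 := M.mul_eq_some.1 (A.mul_idn α)
    rw [← h, M.b_smul_vec hα h1.1, if_pos (by rw [A.deg_idn, add_zero])]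
  · refine M.b_smul_vec_of_none hα (comp_eq_none.2 fun h' => h ?_)
    rw [← M.tgt_eq_src_iff, A.src_idn] at h'
    exact h'

theorem repr_diagonal {f : N →+ N} {p : M.T → Prop} [DecidablePred p]
    (hf : ∀ (t : k) n, f (t • n) = t • f n)
    (h : ∀ α : M.T, f (M.vec α) = if p α then M.vec α else 0) (n : N) (α : M.T) :
    M.e.repr (f n) α = if p α then M.e.repr n α else 0 := by
  let f' : N →ₗ[k] N := { f with map_smul' := hf }
  have h1 : M.e.coord α ∘ₗ f' = if p α then M.e.coord α else 0 := by
    refine M.e.ext fun β => ?_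
    have h2 : f' (M.e β) = if p β then M.e β else 0 := by
      rw [← M.vec_coe]; exact h β
    rw [LinearMap.comp_apply, h2]
    by_cases hαβ : β = α
    · subst hαβ; split_ifs <;> simp
    · split_ifs <;> simp [Finsupp.single_eq_of_ne (Ne.symm hαβ)]
  have h3 := LinearMap.congr_fun h1 n
  split_ifs at h3 ⊢ <;> exact h3

/-- The source idempotents and the degree projections are diagonal with entries 0 and 1. This
criterion turns the description of the graded bar complex by fixed points into one by its monomial
basis. -/
theorem diagonal_eq_self_iff {f : N →+ N} {p : M.T → Prop}
    (hf : ∀ (t : k) n, f (t • n) = t • f n)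
    (h : ∀ α : M.T, (p α → f (M.vec α) = M.vec α) ∧ (¬ p α → f (M.vec α) = 0)) (n : N) :
    f n = n ↔ ∀ α, M.e.repr n α ≠ 0 → p α := by
  classical
  have h1 := M.repr_diagonal hf (p := p) (fun α => by
    split_ifs with h'
    · exact (h α).1 h'
    · exact (h α).2 h') n
  rw [← M.e.repr.injective.eq_iff, DFunLike.ext_iff]
  refine forall_congr' fun α => ?_
  rw [h1]
  split_ifs with h'
  · simp [h']
  · simp only [h', imp_false, not_not]
    exact eq_comm

theorem headIdem_smul_eq_self_iff (c : List (Quotient s)) (n : N) : A.headIdem c • n = n ↔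
    ∀ α, M.e.repr n α ≠ 0 → ∀ β ∈ c.head?, A.tgt α = A.src β := by
  classical
  refine M.diagonal_eq_self_iff (f := DistribSMul.toAddMonoidHom N (A.headIdem c))
    (p := fun α : M.T => ∀ β ∈ c.head?, A.tgt α = A.src β)
    (fun t n => smul_comm (A.headIdem c) t n) (fun α => ?_) n
  cases c with
  | nil => simp [MonomialAlgebra.headIdem]
  | cons β c =>
    simp only [DistribSMul.toAddMonoidHom_apply, MonomialAlgebra.headIdem, M.idn_smul_vec α.2]
    constructor
    · intro h; rw [if_pos (h β rfl)]
    · intro h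
      rw [if_neg]
      intro h'
      refine h fun β' hβ' => ?_
      obtain rfl : β = β' := by simpa using hβ'
      exact h'

include hG in
theorem p_eq_self_iff (j : ℤ) (n : N) : G.p j n = n ↔
    ∀ α : M.T, M.e.repr n α ≠ 0 → (M.r α : ℤ) = j := by
  refine M.diagonal_eq_self_iff (fun t n => ?_) (fun α => ?_) n
  · rw [← algebraMap_smul S t n, G.p_algebraMap_smul, algebraMap_smul]
  · rw [hG α α.2]
    exact ⟨fun h => if_pos h, fun h => if_neg h⟩

include hG in
theorem mem_bar_iff (i : ℕ) (j : ℤ) (z : List (Quotient s) →₀ N) :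
    (z ∈ A.Bar N i ∧ G.barProj j z = z) ↔
      z ∈ Submodule.span k (M.barBasis '' M.barIndex i j) := by
  rw [M.barBasis.mem_span_image]
  have h1 : ∀ c (α : M.T), M.barBasis.repr z ⟨c, α⟩ = M.e.repr (z c) α := fun c α =>
    Finsupp.basis_repr _ _ _
  have h2 : G.barProj j z = z ↔ ∀ c (α : M.T), M.e.repr (z c) α ≠ 0 →
      (M.r α : ℤ) = j - A.listDeg c := by
    rw [DFunLike.ext_iff]
    refine forall_congr' fun c => ?_
    rw [G.barProj_apply, p_eq_self_iff M G hG]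
  have h3 : z ∈ A.Bar N i ↔ ∀ c (α : M.T), M.e.repr (z c) α ≠ 0 →
      (∀ β ∈ c.head?, A.tgt α = A.src β) ∧ A.Valid c ∧ c.length = i := by
    refine forall_congr' fun c => ?_
    have h4 : z c = 0 ↔ ∀ α, M.e.repr (z c) α = 0 := by
      rw [← M.e.repr.map_eq_zero_iff, DFunLike.ext_iff]; rfl
    change A.headIdem c • z c = z c ∧ (¬ (A.Valid c ∧ c.length = i) → z c = 0) ↔ _
    rw [M.headIdem_smul_eq_self_iff, h4]
    constructor
    · rintro ⟨h5, h6⟩ α hα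
      exact ⟨h5 α hα, by_contra fun h => hα (h6 h α)⟩
    · intro h
      exact ⟨fun α hα => (h α hα).1, fun h' α => by_contra fun hα => h' (h α hα).2⟩
  rw [h2, h3]
  constructor
  · rintro ⟨h5, h6⟩ ⟨c, α⟩ hα
    have hα : M.e.repr (z c) α ≠ 0 := by rw [← h1]; simpa using hα
    obtain ⟨h7, h8, h9⟩ := h5 c α hα
    exact ⟨h8, h9, h7, by rw [h6 c α hα]; ring⟩
  · intro h
    have h' : ∀ c (α : M.T), M.e.repr (z c) α ≠ 0 → (⟨c, α⟩ : Σ _ : List (Quotient s), M.T) ∈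
        M.barIndex i j := fun c α hα => h (by rw [← h1] at hα; simpa using hα)
    exact ⟨fun c α hα => ⟨(h' c α hα).2.2.1, (h' c α hα).1, (h' c α hα).2.1⟩,
      fun c α hα => eq_sub_of_add_eq (h' c α hα).2.2.2⟩

include hG in
theorem barExact_iff (i : ℕ) (j : ℤ) : G.BarExact i j ↔ M.BasisExact i j := by
  constructor
  · intro h z hz hDz
    obtain ⟨h1, h2⟩ := (M.mem_bar_iff G hG i j z).2 hz
    obtain ⟨w, hw, hwj, hDw⟩ := h.exists_graded h1 h2 hDz
    exact ⟨w, (M.mem_bar_iff G hG _ _ w).1 ⟨hw, hwj⟩, hDw⟩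
  · intro h z hz hzj hDz
    obtain ⟨w, hw, hDw⟩ := h z ((M.mem_bar_iff G hG i j z).1 ⟨hz, hzj⟩) hDz
    exact ⟨w, ((M.mem_bar_iff G hG _ _ w).2 hw).1, hDw⟩

include hG in
/-- The bar homology is diagonal if and only if all the intervals are sequentially acyclic. -/
theorem forall_barExact_iff : (∀ (i : ℕ) (j : ℤ), j ≠ i → G.BarExact i j) ↔
    ∀ x y : P, x ≤ y → between s x y ∈ M.T →
      (OrdComplex.orderComplex (M.interval x y)).IsSequentiallyAcyclic k := by
  rw [← forall_basisExact_iff]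
  simp only [M.barExact_iff G hG]

end Bar

end PathModule

end RedIncAlg

end

noncomputable section

set_option linter.unusedSectionVars false

open scoped DirectSum

/-! ## Semisimplicity of the degree zero parts -/

/-- A ring which is spanned over a field by a complete system of orthogonal idempotents is
semisimple. -/
theorem isSemisimpleRing_of_idempotents {k R B ι : Type*} [Field k] [Ring R] [Ring B] [Algebra k B]
    [Fintype ι] [DecidableEq ι] (e : ι → B) (he : ∀ i j, e i * e j = if i = j then e i else 0)
    (h1 : ∑ i, e i = 1) (φ : R →+* B) (hφ : Function.Injective φ)
    (hR : ∀ x, φ x ∈ Submodule.span k (Set.range e))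
    (hspan : ∀ b ∈ Submodule.span k (Set.range e), ∃ x, φ x = b) : IsSemisimpleRing R := by
  -- The semisimple ring of functions on `ι` is mapped onto the image of `φ`, which is isomorphic to
  -- `R`.
  let g : (ι → k) →+* B :=
    { toFun := fun f => ∑ i, f i • e i
      map_one' := by simpa using h1
      map_mul' := fun f f' => by
        rw [Finset.sum_mul_sum]
        refine Finset.sum_congr rfl fun i _ => ?_
        rw [Finset.sum_eq_single i]
        · rw [smul_mul_smul_comm, he, if_pos rfl, Pi.mul_apply]
        · intro j _ hj
          rw [smul_mul_smul_comm, he, if_neg hj.symm, smul_zero]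
        · simp
      map_zero' := by simp
      map_add' := fun f f' => by
        rw [← Finset.sum_add_distrib]
        exact Finset.sum_congr rfl fun i _ => add_smul _ _ _ }
  have hg : ∀ f, g f ∈ φ.range := fun f => by
    obtain ⟨x, hx⟩ := hspan (g f) (sum_mem fun i _ =>
      Submodule.smul_mem _ _ (Submodule.subset_span ⟨i, rfl⟩))
    exact ⟨x, hx⟩
  have e1 : R ≃+* φ.range := RingEquiv.ofBijective φ.rangeRestrict
    ⟨fun a b h => hφ (congrArg Subtype.val h), φ.rangeRestrict_surjective⟩
  have hsurj : Function.Surjective (g.codRestrict φ.range hg) := by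
    rintro ⟨_, x, rfl⟩
    obtain ⟨f, hf⟩ := (Submodule.mem_span_range_iff_exists_fun k).1 (hR x)
    exact ⟨f, Subtype.ext hf⟩
  have : IsSemisimpleRing φ.range := RingHom.isSemisimpleRing_of_surjective _ hsurj
  exact RingHom.isSemisimpleRing_of_surjective e1.symm.toRingHom e1.symm.surjective

namespace RedIncAlg

section

variable {P : Type u} [PartialOrder P] {s : Setoid (NonemptyInterval P)} [IntervalAxioms s]
  {k : Type v} [Field k]

variable (s k) in
/-- The basis of monomials. -/
def xiBasis : Module.Basis (Quotient s) k (RedIncAlg k s) :=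
  Module.Basis.ofRepr (LinearEquiv.refl k (RedIncAlg k s) : RedIncAlg k s ≃ₗ[k] (Quotient s →₀ k))

@[simp] theorem xiBasis_apply (α : Quotient s) : xiBasis s k α = xi k α := by
  rw [Module.Basis.apply_eq_iff]
  rfl

theorem mem_degreeZero {a : RedIncAlg k s} :
    a ∈ degreeZero k s ↔ a ∈ Submodule.span k (xi k '' {β : Quotient s | ¬ Nonid β}) := by
  have h : xi k '' {β : Quotient s | ¬ Nonid β} = {a | ∃ x : P, a = xi k (cls s (le_refl x))} := by
    ext a
    constructor
    · rintro ⟨β, hβ, rfl⟩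
      obtain ⟨x, y, hxy, rfl⟩ := exists_cls β
      exact ⟨x, congrArg _ (eq_srcCls_of_not_nonid hβ)⟩
    · rintro ⟨x, rfl⟩
      exact ⟨_, fun h => h x rfl, rfl⟩
  rw [h]
  rfl

theorem mem_degreeZero_iff {a : RedIncAlg k s} :
    a ∈ degreeZero k s ↔ ∀ β, Nonid β → (xiBasis s k).repr a β = 0 := by
  have h := (xiBasis s k).mem_span_image (m := a) (s := {β | ¬ Nonid β})
  have h' : (xiBasis s k : Quotient s → RedIncAlg k s) = xi k := funext xiBasis_apply
  rw [h'] at h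
  rw [mem_degreeZero, h]
  constructor
  · intro h β hβ
    by_contra h'
    exact h (Finsupp.mem_support_iff.2 h') hβ
  · intro h β hβ hβ'
    exact Finsupp.mem_support_iff.1 hβ (h β hβ')

theorem mem_positiveIdeal_iff {a : RedIncAlg k s} :
    a ∈ positiveIdeal k s ↔ ∀ β, ¬ Nonid β → (xiBasis s k).repr a β = 0 := by
  have h := (xiBasis s k).mem_span_image (m := a) (s := {β | Nonid β})
  have h' : (xiBasis s k : Quotient s → RedIncAlg k s) = xi k := funext xiBasis_apply
  rw [h'] at h
  rw [mem_positiveIdeal, h]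
  constructor
  · intro h β hβ
    by_contra h'
    exact hβ (h (Finsupp.mem_support_iff.2 h'))
  · intro h β hβ
    by_contra hβ'
    exact Finsupp.mem_support_iff.1 hβ (h β hβ')

theorem isCompl_degreeZero_positiveIdeal :
    IsCompl (degreeZero k s).toAddSubgroup (positiveIdeal k s).asIdeal.toAddSubgroup := by
  constructor
  · rw [AddSubgroup.disjoint_def]
    intro a h1 h2
    have h1 : a ∈ degreeZero k s := h1
    have h2 : a ∈ positiveIdeal k s := TwoSidedIdeal.mem_asIdeal.1 h2
    rw [mem_degreeZero_iff] at h1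
    rw [mem_positiveIdeal_iff] at h2
    refine (xiBasis s k).repr.map_eq_zero_iff.1 (Finsupp.ext fun β => ?_)
    by_cases h : Nonid β
    · exact h1 β h
    · exact h2 β h
  · rw [codisjoint_iff, eq_top_iff]
    rintro a -
    have h : a ∈ Submodule.span k (xi k '' {β : Quotient s | ¬ Nonid β}) ⊔
        Submodule.span k (xi k '' {β : Quotient s | Nonid β}) := by
      rw [← Submodule.span_union, ← Set.image_union]
      have h1 : {β : Quotient s | ¬ Nonid β} ∪ {β | Nonid β} = Set.univ := by
        ext β; simp [em']
      rw [h1, Set.image_univ]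
      exact mem_span_xi a
    obtain ⟨b, hb, c, hc, rfl⟩ := Submodule.mem_sup.1 h
    exact AddSubgroup.mem_sup.2 ⟨b, mem_degreeZero.2 hb, c,
      TwoSidedIdeal.mem_asIdeal.2 (mem_positiveIdeal.2 hc), rfl⟩

theorem range_obj : Set.range (fun o : Obj.{u, v} s => o.down.1) = {β | ¬ Nonid β} := by
  ext β
  constructor
  · rintro ⟨o, rfl⟩
    exact not_nonid_obj o
  · intro h
    exact ⟨⟨⟨β, eq_srcCls_of_not_nonid h ▸ srcCls_mem β⟩⟩, rfl⟩

theorem isSemisimpleRing_degreeZero : IsSemisimpleRing (degreeZero k s) := by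
  classical
  have h : Set.range (fun o : Obj.{u, v} s => xi k o.down.1) = xi k '' {β : Quotient s | ¬ Nonid β} := by
    rw [← range_obj.{u, v}, ← Set.range_comp]
    rfl
  refine isSemisimpleRing_of_idempotents (k := k) (fun o : Obj.{u, v} s => xi k o.down.1)
    (fun o o' => ?_) (sum_xi_obj s k) (degreeZero k s).subtype Subtype.val_injective (fun x => ?_)
    fun b hb => ?_
  · rw [xi_mul_xi, xiMul_eq_elim]
    split_ifs with h
    · subst h
      have h1 := srcCls_comp_self o.down.1
      rw [srcCls_obj] at h1
      rw [h1]; rfl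
    · rw [comp_eq_none.2, Option.elim_none]
      rw [tgtCls_obj, srcCls_obj]
      exact fun h' => h (ULift.ext _ _ (Subtype.ext h'))
  · rw [h]
    exact mem_degreeZero.1 x.2
  · rw [h] at hb
    exact ⟨⟨b, mem_degreeZero.2 hb⟩, rfl⟩

variable (hfin : ∀ x y : P, (Set.Icc x y).Finite)

include hfin in
theorem isSemisimpleRing_grPiece_zero :
    IsSemisimpleRing (GrPiece (opIdeal s k) (RedIncAlg k s)ᵐᵒᵖ 0) := by
  classical
  let A := grMonomialAlgebra s k hfin
  refine isSemisimpleRing_of_idempotents (k := k) (fun o : Obj.{u, v} s => A.b (A.idn o))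
    (fun o o' => ?_) A.sum_idn (DirectSum.ofZeroRingHom (GrPiece (opIdeal s k) (RedIncAlg k s)ᵐᵒᵖ))
    (DirectSum.of_injective 0) (fun x => ?_) fun b hb => ?_
  · split_ifs with h
    · subst h
      exact A.b_idn_mul_b (A.tgt_idn o)
    · refine A.b_idn_mul_b_of_ne ?_
      rw [A.tgt_idn]
      exact fun h' => h h'.symm
  · obtain ⟨n, rfl⟩ := grMk_surjective _ 0 x
    refine Submodule.span_mono ?_ ((regular s k).of_grMk_mem_span hfin 0 n)
    rintro _ ⟨β, hβ, rfl⟩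
    have h1 : β ∈ {β : Quotient s | ¬ Nonid β} := fun h =>
      ((degree_pos_iff (k := k) hfin).2 h).ne' hβ
    rw [← range_obj.{u, v}] at h1
    obtain ⟨o, rfl⟩ := h1
    exact ⟨o, MonomialModule.grBasis_apply _ hfin _⟩
  · induction hb using Submodule.span_induction with
    | zero => exact ⟨0, map_zero _⟩
    | add x y _ _ hx hy =>
      obtain ⟨x, rfl⟩ := hx
      obtain ⟨y, rfl⟩ := hy
      exact ⟨x + y, map_add _ _ _⟩
    | smul t x _ hx =>
      obtain ⟨x, rfl⟩ := hx
      exact ⟨t • x, (smul_of_gr _ t x).symm⟩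
    | mem x hx =>
      obtain ⟨o, rfl⟩ := hx
      obtain ⟨r, hr⟩ := (isCompatible_grMonomialAlgebra (k := k) hfin).b_eq (A.idn o)
      have h0 := A.deg_idn o
      change A.b (A.idn o) = _ at hr
      change ∃ x, DirectSum.of (GrPiece (opIdeal s k) (RedIncAlg k s)ᵐᵒᵖ) 0 x = A.b (A.idn o)
      rw [hr]
      change (grMonomialAlgebra s k hfin).deg (A.idn o) = 0 at h0
      -- The representative lives in the piece indexed by the degree of an identity, which is only
      -- propositionally `0`.
      generalize (grMonomialAlgebra s k hfin).deg (A.idn o) = d at h0 r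
      subst h0
      exact ⟨r, rfl⟩

end

end RedIncAlg

/-! ## The grading of the associated graded module -/

section Grading

variable {k : Type*} [Field k] {B : Type u} [Ring B] [Algebra k B] (I : Ideal B) [I.IsTwoSided]
  (M : Type v) [AddCommGroup M] [Module B M] [Module k M] [IsScalarTower k B M]

/-- The projections of the associated graded module to its homogeneous components. -/
def grProj : ℤ → (⨁ d, GrPiece I M d) →+ ⨁ d, GrPiece I M d
  | Int.ofNat d => (DirectSum.of (GrPiece I M) d).comp (DFinsupp.evalAddMonoidHom d)
  | Int.negSucc _ => 0

variable {M}

theorem grProj_of (n : ℤ) (d : ℕ) (x : GrPiece I M d) :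
    grProj I M n (DirectSum.of (GrPiece I M) d x) =
      if (d : ℤ) = n then DirectSum.of (GrPiece I M) d x else 0 := by
  cases n with
  | negSucc n => simp [grProj]
  | ofNat e =>
    simp only [grProj, AddMonoidHom.comp_apply, Int.ofNat_eq_natCast, Nat.cast_inj]
    change DirectSum.of (GrPiece I M) e ((DirectSum.of (GrPiece I M) d x) e) = _
    split_ifs with h
    · subst h
      rw [DirectSum.of_eq_same]
    · rw [DirectSum.of_eq_of_ne _ _ _ (Ne.symm h), map_zero]

theorem grProj_hom_ext {X : Type*} [AddCommGroup X] {f g : (⨁ d, GrPiece I M d) →+ X}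
    (h : ∀ d x, f (DirectSum.of (GrPiece I M) d x) = g (DirectSum.of (GrPiece I M) d x))
    (x : ⨁ d, GrPiece I M d) : f x = g x :=
  DFunLike.congr_fun (DirectSum.addHom_ext h : f = g) x

variable {Q : Type*} {O : Type u} [Fintype O] {A : MonomialAlgebra k (⨁ d, GrPiece I B d) Q O}

/-- The grading of the associated graded module. -/
def grGradingProj (hA : A.IsCompatible) : A.Grading (⨁ d, GrPiece I M d) where
  p := grProj I M
  p_same n := grProj_hom_ext I (f := (grProj I M n).comp (grProj I M n)) fun d x => by
    rw [AddMonoidHom.comp_apply, grProj_of]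
    split_ifs with h
    · rw [grProj_of, if_pos h]
    · rw [map_zero]
  p_ne m n x hmn := grProj_hom_ext I (f := (grProj I M m).comp (grProj I M n)) (g := 0)
    (fun d x => by
      rw [AddMonoidHom.comp_apply, grProj_of, AddMonoidHom.zero_apply]
      split_ifs with h
      · rw [grProj_of, if_neg (fun h' => hmn (h'.symm.trans h))]
      · rw [map_zero]) x
  exists_sum x := by
    classical
    refine ⟨x.support.map Nat.castEmbedding, ?_⟩
    rw [Finset.sum_map]
    exact DirectSum.sum_support_of x
  p_b_smul α n x := by
    obtain ⟨r, hr⟩ := hA.b_eq α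
    rw [hr]
    refine grProj_hom_ext I (f := (grProj I M (A.deg α + n)).comp
      (DistribSMul.toAddMonoidHom _ (DirectSum.of (GrPiece I B) (A.deg α) r)))
      (g := (DistribSMul.toAddMonoidHom _ (DirectSum.of (GrPiece I B) (A.deg α) r)).comp
        (grProj I M n)) (fun d x => ?_) x
    simp only [AddMonoidHom.comp_apply, DistribSMul.toAddMonoidHom_apply]
    rw [of_smul_of_gr, grProj_of, grProj_of]
    simp only [Nat.cast_add, add_right_inj]
    split_ifs
    · rw [of_smul_of_gr]
    · rw [smul_zero]
  p_algebraMap_smul t n x := by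
    refine grProj_hom_ext I (f := (grProj I M n).comp
      (DistribSMul.toAddMonoidHom _ (algebraMap k (⨁ d, GrPiece I B d) t)))
      (g := (DistribSMul.toAddMonoidHom _ (algebraMap k (⨁ d, GrPiece I B d) t)).comp
        (grProj I M n)) (fun d x => ?_) x
    simp only [AddMonoidHom.comp_apply, DistribSMul.toAddMonoidHom_apply, algebraMap_smul]
    rw [smul_of_gr, grProj_of, grProj_of]
    split_ifs
    · rw [smul_of_gr]
    · rw [smul_zero]

theorem grGradingProj_eq_self_iff (hA : A.IsCompatible) (n : ℤ) (x : ⨁ d, GrPiece I M d) :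
    (grGradingProj I (M := M) hA).p n x = x ↔ x ∈ grGrading I M n := by
  cases n with
  | negSucc n =>
    change (0 : ⨁ d, GrPiece I M d) = x ↔ x ∈ (⊥ : AddSubgroup _)
    rw [AddSubgroup.mem_bot, eq_comm]
  | ofNat d =>
    constructor
    · intro h
      exact ⟨x d, h⟩
    · rintro ⟨x, rfl⟩
      exact (grProj_of I _ d x).trans (if_pos rfl)

end Grading

end

/-! ### Monomial right ideals and the Koszul criterion -/

noncomputable section

set_option linter.unusedSectionVars false

open scoped DirectSum

namespace RedIncAlg

section Ideal

variable {P : Type u} [PartialOrder P] {s : Setoid (NonemptyInterval P)} [IntervalAxioms s]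
  {k : Type v} [Field k] {J : Submodule (RedIncAlg k s)ᵐᵒᵖ (RedIncAlg k s)}

/-- The classes of the monomials in a right ideal. -/
def classes (J : Submodule (RedIncAlg k s)ᵐᵒᵖ (RedIncAlg k s)) : Set (Quotient s) :=
  {α | xi k α ∈ J}

theorem mem_classes_of_comp {α β γ : Quotient s} (hα : α ∈ classes J) (h : comp α β = some γ) :
    γ ∈ classes J := by
  have h1 := J.smul_mem (MulOpposite.op (xi k β)) hα
  rw [op_smul_eq_mul, xi_mul_xi, xiMul_eq_elim, h] at h1
  exact h1

theorem nonid_of_mem_classes (hJ : IsMonomialRightIdeal J) {α : Quotient s} (h : α ∈ classes J) :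
    Nonid α := by
  by_contra h'
  have := mem_positiveIdeal_iff.1 (hJ.le_positive _ h) α h'
  rw [← xiBasis_apply, Module.Basis.repr_self, Finsupp.single_eq_same] at this
  exact one_ne_zero this

/-- A monomial times a monomial is a monomial or zero, so the right ideal generated by monomials is
already their span over `k` together with their multiples. -/
theorem mem_span_classes (hJ : IsMonomialRightIdeal J) {a : RedIncAlg k s} (ha : a ∈ J) :
    a ∈ Submodule.span k (xi k '' classes J) := by
  obtain ⟨S, hS⟩ := hJ.generated
  have hSJ : ∀ α ∈ S, α ∈ classes J := fun α hα => by
    change xi k α ∈ J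
    rw [hS]
    exact Submodule.subset_span ⟨α, hα, rfl⟩
  rw [hS] at ha
  induction ha using Submodule.span_induction with
  | zero => exact zero_mem _
  | add x y _ _ hx hy => exact add_mem hx hy
  | mem x hx =>
    obtain ⟨α, hα, rfl⟩ := hx
    exact Submodule.subset_span ⟨α, hSJ α hα, rfl⟩
  | smul b x hx' hx =>
    clear hx'
    obtain ⟨b, rfl⟩ := MulOpposite.op_surjective b
    rw [op_smul_eq_mul]
    induction hx using Submodule.span_induction with
    | zero => rw [zero_mul]; exact zero_mem _
    | add x y _ _ hx hy => rw [add_mul]; exact add_mem hx hy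
    | smul t x _ hx => rw [smul_mul_assoc]; exact Submodule.smul_mem _ _ hx
    | mem x hx =>
      obtain ⟨α, hα, rfl⟩ := hx
      induction mem_span_xi b using Submodule.span_induction with
      | zero => rw [mul_zero]; exact zero_mem _
      | add x y _ _ hx hy => rw [mul_add]; exact add_mem hx hy
      | smul t x _ hx => rw [mul_smul_comm]; exact Submodule.smul_mem _ _ hx
      | mem x hx =>
        obtain ⟨β, rfl⟩ := hx
        rw [xi_mul_xi, xiMul_eq_elim]
        cases h : comp α β with
        | none => exact zero_mem _
        | some γ => exact Submodule.subset_span ⟨γ, mem_classes_of_comp hα h, rfl⟩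

/-- The basis of a monomial right ideal. -/
def idealBasis (hJ : IsMonomialRightIdeal J) : Module.Basis (classes J) k J :=
  Module.Basis.mk (v := fun α : classes J => (⟨xi k α.1, α.2⟩ : J))
    (by
      have h := ((xiBasis s k).linearIndependent.comp (Subtype.val : classes J → Quotient s)
        Subtype.val_injective)
      refine LinearIndependent.of_comp ((J.restrictScalars k).subtype) ?_
      convert h using 1
      ext1 α
      exact (xiBasis_apply _).symm)
    (by
      rintro ⟨a, ha⟩ -
      have h := mem_span_classes hJ ha
      have h2 : ∀ a ∈ Submodule.span k (xi k '' classes J), ∀ ha : a ∈ J, (⟨a, ha⟩ : J) ∈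
          Submodule.span k (Set.range fun α : classes J => (⟨xi k α.1, α.2⟩ : J)) := by
        intro a h
        have hle : Submodule.span k (xi k '' classes J) ≤ J.restrictScalars k := by
          rw [Submodule.span_le]
          rintro _ ⟨α, hα, rfl⟩
          exact hα
        induction h using Submodule.span_induction with
        | zero => intro _; exact zero_mem _
        | add x y hx hy h h' => intro _; exact add_mem (h (hle hx)) (h' (hle hy))
        | smul t x hx h => intro _; exact Submodule.smul_mem _ t (h (hle hx))
        | mem x hx =>
          obtain ⟨α, hα, rfl⟩ := hx
          intro _
          exact Submodule.subset_span ⟨⟨α, hα⟩, rfl⟩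
      exact h2 a h ha)

theorem idealBasis_apply (hJ : IsMonomialRightIdeal J) (α : classes J) :
    idealBasis hJ α = ⟨xi k α.1, α.2⟩ := by
  rw [idealBasis, Module.Basis.mk_apply]

open Classical in
/-- A monomial right ideal as a monomial module. -/
def idealModule (hJ : IsMonomialRightIdeal J) : MonomialModule s k (classes J) J where
  b := idealBasis hJ
  cl := Subtype.val
  act α β := (comp α.1 β).bind fun γ => if h : γ ∈ classes J then some ⟨γ, h⟩ else none
  xi_smul α β := by
    refine Subtype.ext ?_
    rw [idealBasis_apply]
    change MulOpposite.op (xi k β) • xi k α.1 = _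
    rw [op_smul_eq_mul, xi_mul_xi, xiMul_eq_elim]
    cases h : comp α.1 β with
    | none => rfl
    | some γ =>
      rw [Option.bind_some, dif_pos (mem_classes_of_comp α.2 h), Option.elim_some, Option.elim_some,
        idealBasis_apply]
  comp_cl α β := by
    cases h : comp α.1 β with
    | none => rfl
    | some γ => rw [Option.bind_some, dif_pos (mem_classes_of_comp α.2 h)]; rfl

theorem idealModule_act (hJ : IsMonomialRightIdeal J) {α : classes J} {β γ : Quotient s}
    (h : comp α.1 β = some γ) :
    (idealModule hJ).act α β = some ⟨γ, mem_classes_of_comp α.2 h⟩ := by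
  change (comp α.1 β).bind _ = _
  rw [h, Option.bind_some, dif_pos (mem_classes_of_comp α.2 h)]

theorem idealModule_act_none (hJ : IsMonomialRightIdeal J) {α : classes J} {β : Quotient s}
    (h : comp α.1 β = none) : (idealModule hJ).act α β = none := by
  change (comp α.1 β).bind _ = _
  rw [h, Option.bind_none]

variable (hfin : ∀ x y : P, (Set.Icc x y).Finite)

open Classical in
/-- The associated graded module of a monomial right ideal. -/
def idealPathModule (hJ : IsMonomialRightIdeal J) :
    PathModule (grMonomialAlgebra s k hfin) (⨁ d, GrPiece (opIdeal s k) J d) where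
  T := classes J
  e := (idealModule hJ).grBasis hfin
  vec α := if h : α ∈ classes J then (idealModule hJ).grVec hfin ⟨α, h⟩ else 0
  r α := if h : α ∈ classes J then (idealModule hJ).rk hfin ⟨α, h⟩ else 0
  vec_coe α := by rw [dif_pos α.2, MonomialModule.grBasis_apply]
  nonid_of_mem := nonid_of_mem_classes hJ
  mul_eq_some := grMul_eq_some hfin
  deg_add_le {α β γ} h := by
    rw [add_comm]
    exact rk_act hfin (regular s k) (x := α) h
  deg_pos_iff := degree_pos_iff hfin
  tgt_eq_src_iff {α β} := by
    constructor
    · intro h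
      exact congrArg (fun o : Obj.{u, v} s => o.down.1) h
    · intro h
      exact ULift.ext _ _ (Subtype.ext h)
  mem_of_comp := mem_classes_of_comp
  r_add_le {α β γ} hα h := by
    rw [dif_pos hα, dif_pos (mem_classes_of_comp hα h), add_comm]
    exact rk_act hfin (idealModule hJ) (idealModule_act hJ (α := ⟨α, hα⟩) h)
  b_smul_vec {α β γ} hα h := by
    rw [dif_pos hα, dif_pos hα, dif_pos (mem_classes_of_comp hα h),
      dif_pos (mem_classes_of_comp hα h), add_comm]
    change (regular s k).grBasis hfin β • _ = _
    rw [MonomialModule.grBasis_apply, grVec_smul_grVec,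
      idealModule_act hJ (α := ⟨α, hα⟩) h]
    rfl
  b_smul_vec_of_none {α β} hα h := by
    rw [dif_pos hα]
    change (regular s k).grBasis hfin β • _ = _
    rw [MonomialModule.grBasis_apply, grVec_smul_grVec,
      idealModule_act_none hJ (α := ⟨α, hα⟩) h]
    rfl
  exists_path_deg a b h := exists_path_degree hfin h
  exists_path_r a b h hT := by
    rw [dif_pos hT]
    have hr : Set.range (idealModule hJ).cl = classes J := Subtype.range_val
    obtain ⟨l, h1, h2, h3⟩ := exists_path_rk (idealModule hJ) hfin
      (fun x => nonid_of_mem_classes hJ x.2) h (x := ⟨_, hT⟩) rfl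
    rw [hr] at h2
    exact ⟨l, h1, h2, h3⟩

/-- The decomposition of the algebra, the semisimplicity conditions and the grading of the
associated module hold unconditionally. The only content of Koszulness is the linear resolution, to
which the bar criterion applies. -/
theorem isNongradedKoszul_iff (hJ : IsMonomialRightIdeal J) :
    IsNongradedKoszul (degreeZero k s) (positiveIdeal k s) J ↔
      ∀ x y : P, x ≤ y → between s x y ∈ classes J →
        (OrdComplex.orderComplex ((idealPathModule hfin hJ).interval x y)).IsSequentiallyAcyclic
          k := by
  classical
  have hA := isCompatible_grMonomialAlgebra (s := s) (k := k) hfin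
  let G := grGradingProj (opIdeal s k) (M := J) hA
  have hG := grGradingProj_eq_self_iff (opIdeal s k) (M := J) hA
  have hhom : G.homog = grGrading (opIdeal s k) J := by
    ext n x
    rw [MonomialAlgebra.Grading.mem_homog]
    exact hG n x
  have h1 := MonomialAlgebra.nonempty_linearResolution_iff hA G hG (fun n hn x => by
    obtain ⟨m, rfl⟩ := Int.eq_negSucc_of_lt_zero hn
    rfl)
  have h2 := (idealPathModule hfin hJ).forall_barExact_iff G (fun α hα j => by
    change grProj _ _ j (if h : α ∈ classes J then _ else _) =
      if ((if h : α ∈ classes J then (idealModule hJ).rk hfin ⟨α, h⟩ else 0 : ℕ) : ℤ) = j then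
        (if h : α ∈ classes J then _ else _) else 0
    have hα' : α ∈ classes J := hα
    rw [dif_pos hα', dif_pos hα']
    exact grProj_of _ j _ _)
  refine Iff.trans ?_ (h1.trans h2)
  constructor
  · intro h
    exact h.koszul.resolution
  · intro h
    exact
      { isCompl := isCompl_degreeZero_positiveIdeal
        semisimple := isSemisimpleRing_degreeZero
        koszul :=
          { semisimple := isSemisimpleRing_grPiece_zero hfin
            isGraded := hhom ▸ MonomialAlgebra.Grading.isGradedModule_homog hA G
            resolution := h } }

end Ideal

end RedIncAlg

end

/-- Koszulness of monomial right ideals in reduced incidence algebras. -/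
theorem theorem1p12 {P : Type u} [PartialOrder P] (hfin : ∀ x y : P, (Set.Icc x y).Finite)
    (s : Setoid (NonemptyInterval P)) [IntervalAxioms s] (k : Type v) [Field k]
    (J : Submodule (RedIncAlg k s)ᵐᵒᵖ (RedIncAlg k s)) (hJ : RedIncAlg.IsMonomialRightIdeal J) :
    IsNongradedKoszul (RedIncAlg.degreeZero k s) (RedIncAlg.positiveIdeal k s) J ↔
      ∀ (x y : P) (h : x ≤ y), RedIncAlg.xi k (cls s h) ∈ J →
        (OrdComplex.orderComplex (RedIncAlg.restrictedInterval J x y)).IsSequentiallyAcyclic k := by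
  rw [RedIncAlg.isNongradedKoszul_iff hfin hJ]
  have hint : ∀ x y : P, (RedIncAlg.idealPathModule hfin hJ).interval x y =
      RedIncAlg.restrictedInterval J x y := by
    intro x y
    ext z
    constructor
    · rintro ⟨h1, h2, h3⟩
      rw [RedIncAlg.between_eq h1.le] at h3
      exact ⟨h1, h2, h3⟩
    · rintro ⟨h1, h2, h3⟩
      refine ⟨h1, h2, ?_⟩
      rw [RedIncAlg.between_eq h1.le]
      exact h3
  refine forall_congr' fun x => forall_congr' fun y => forall_congr' fun h => ?_
  rw [RedIncAlg.between_eq h, hint]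
  rfl
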